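/- Let $h:\mathbb R\to(0,\infty)$ be continuous and suppose that, with constants $M,c_+,c_->0$ and $m\ge 1$: (i) $x=0$ is the only point of global maximum of $h$, that is, $h(x)<h(0)$ for all $x\neq 0$; (ii) $h$ is $C^1$ on $\mathbb R\setminus\{0\}$, and as $x\to 0$ one has $h(x)=M-c_+x^m+O(x^{m+1})$ for $x>0$ and $h(x)=M-c_-|x|^m+O(|x|^{m+1})$ for $x<0$; (iii) $\limsup_{|x|\to\infty}h(x)<M$. For $\epsilon>0$ let $\Omega_\epsilon=\{(x,y):x\in\mathbb R,\ 0<y<\epsilon h(x)\}$ and let $\Delta_\epsilon=-\partial_x^2-\partial_y^2$ be the Dirichlet Laplacian in $L^2(\Omega_\epsilon)$, i.e. the self-adjoint operator of the quadratic form $\int_{\Omega_\epsilon}|\nabla\psi|^2\,dx\,dy$ on $H^1_0(\Omega_\epsilon)$. Let $\nu(\epsilon)$ be the bottom of the essential spectrum of $\Delta_\epsilon$ ($\nu(\epsilon)=\infty$ if the essential spectrum is empty), let $\lambda_1(\epsilon)\le\lambda_2(\epsilon)\le\dots$ be the eigenvalues of $\Delta_\epsilon$ lying below $\nu(\epsilon)$,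 repeated according to multiplicity, and let $n(\epsilon)\le\infty$ be their number. Let $\mathbf H=-\frac{d^2}{dx^2}+q(x)$ in $L^2(\mathbb R)$, where $q(x)=2\pi^2M^{-3}c_+x^m$ for $x>0$ and $q(x)=2\pi^2M^{-3}c_-|x|^m$ for $x<0$, let $\mu_1\le\mu_2\le\dots$ be the eigenvalues of $\mathbf H$, and let $\alpha=2/(m+2)$. Then $\nu(\epsilon)\to\infty$ as $\epsilon\to0$. Moreover, for all sufficiently small $\epsilon>0$ the spectrum of $\Delta_\epsilon$ below $\nu(\epsilon)$ is non-empty; $n(\epsilon)\to\infty$ as $\epsilon\to0$; and for each $j\in\mathbb N$ the eigenvalue $\lambda_j(\epsilon)$ exists for all sufficiently small $\epsilon$ and $$\lim_{\epsilon\to0}\epsilon^{2\alpha}\Bigl(\lambda_j(\epsilon)-\frac{\pi^2}{M^2\epsilon^2}\Bigr)=\mu_j .$$ -/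

import Mathlib

open MeasureTheory Filter Topology
open scoped ContDiff

noncomputable section

namespace NarrowStrip

/-! ### Unbounded operators: eigenspaces, spectrum, essential spectrum, counting eigenvalues -/

section Spectral

variable {H : Type*} [NormedAddCommGroup H] [InnerProductSpace ℝ H]

/-- The eigenspace `{u ∈ dom A : A u = t u}` of an unbounded operator `A`. -/
def eigenspace (A : H →ₗ.[ℝ] H) (t : ℝ) : Submodule ℝ H :=
  A.graph.comap (LinearMap.id.prod (t • LinearMap.id))

/-- The resolvent set: those `t` for which `A - t : dom A → H` is bijective with bounded inverse. -/
def resolventSet (A : H →ₗ.[ℝ] H) : Set ℝ :=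
  {t | ∃ R : H →L[ℝ] H,
    (∀ f : H, ∃ hf : R f ∈ A.domain, A ⟨R f, hf⟩ - t • R f = f) ∧
    ∀ u : A.domain, R (A u - t • (u : H)) = u}

/-- The spectrum (of a self-adjoint operator, hence real). -/
def spec (A : H →ₗ.[ℝ] H) : Set ℝ := (resolventSet A)ᶜ

/-- The discrete spectrum: isolated points of the spectrum that are eigenvalues of finite
multiplicity. -/
def discSpec (A : H →ₗ.[ℝ] H) : Set ℝ :=
  {t | t ∈ spec A ∧ (∃ r > 0, spec A ∩ Metric.ball t r = {t}) ∧
    eigenspace A t ≠ ⊥ ∧ FiniteDimensional ℝ (eigenspace A t)}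

/-- The essential spectrum of a self-adjoint operator: the spectrum without its discrete part. -/
def essSpec (A : H →ₗ.[ℝ] H) : Set ℝ := spec A \ discSpec A

/-- The bottom of the essential spectrum; it is `⊤` if there is no essential spectrum. -/
def essBottom (A : H →ₗ.[ℝ] H) : EReal := sInf ((fun t : ℝ => (t : EReal)) '' essSpec A)

/-- The number of eigenvalues in `S`, counted with multiplicity: the dimension of the span of the
corresponding eigenspaces (which are linearly independent). -/
def eigenvalueCount (A : H →ₗ.[ℝ] H) (S : Set ℝ) : ℕ∞ :=
  Cardinal.toENat (Module.rank ℝ ↥(⨆ t ∈ S, eigenspace A t))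

/-- `t` is the `j`-th eigenvalue of `A` (`j = 0, 1, 2, …`), the eigenvalues being listed in
nondecreasing order and repeated according to multiplicity. -/
def IsNthEigenvalue (A : H →ₗ.[ℝ] H) (j : ℕ) (t : ℝ) : Prop :=
  eigenvalueCount A (Set.Iio t) ≤ j ∧ (j : ℕ∞) < eigenvalueCount A (Set.Iic t)

/-! ### The operator of a quadratic form -/

/-- Let `D` consist of the triples `(u, T₁ u, T₂ u)`, where `u` runs through the domain of the
quadratic form `a[u] = ‖T₁ u‖² + ‖T₂ u‖²`. This is the graph of the operator `A` of that form:
`u ∈ dom A` and `A u = f` if and only if `u` lies in the form domain and `a[u, v] = ⟨f, v⟩` for all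
`v` in the form domain. -/
def formGraph (D : Submodule ℝ (H × H × H)) : Submodule ℝ (H × H) where
  carrier := {w | ∃ a b : H, (w.1, a, b) ∈ D ∧
    ∀ v c d : H, (v, c, d) ∈ D → inner ℝ a c + inner ℝ b d = inner ℝ w.2 v}
  zero_mem' := ⟨0, 0, D.zero_mem, fun v c d _ => by simp⟩
  add_mem' := by
    rintro w w' ⟨a, b, h, hab⟩ ⟨a', b', h', hab'⟩
    refine ⟨a + a', b + b', D.add_mem h h', fun v c d hv => ?_⟩
    have h1 := hab v c d hv
    have h2 := hab' v c d hv
    simp only [inner_add_left, Prod.snd_add]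
    linarith
  smul_mem' := by
    rintro r w ⟨a, b, h, hab⟩
    refine ⟨r • a, r • b, D.smul_mem r h, fun v c d hv => ?_⟩
    have h1 := hab v c d hv
    simp only [real_inner_smul_left, Prod.smul_snd, ← h1]
    ring

/-- The operator of the quadratic form described by `D`. -/
def formOperator (D : Submodule ℝ (H × H × H)) : H →ₗ.[ℝ] H := (formGraph D).toLinearPMap

/-- If the form domain is dense, then the graph above is the graph of a (single-valued) operator. -/
theorem formOperator_graph (D : Submodule ℝ (H × H × H))
    (hD : ∀ f : H, (∀ v c d : H, (v, c, d) ∈ D → inner ℝ f v = 0) → f = 0) :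
    (formOperator D).graph = formGraph D := by
  refine Submodule.toLinearPMap_graph_eq _ ?_
  rintro ⟨u, f⟩ ⟨a, b, h, hab⟩ (rfl : u = 0)
  have h0 := hab _ _ _ h
  simp only [inner_zero_right] at h0
  have ha : inner ℝ a a = 0 :=
    le_antisymm (by linarith [real_inner_self_nonneg (x := b)]) real_inner_self_nonneg
  have hb : inner ℝ b b = 0 := by linarith
  rw [inner_self_eq_zero] at ha hb
  refine hD f fun v c d hv => ?_
  have := hab v c d hv
  simpa [ha, hb] using this.symm

end Spectral

/-! ### The Dirichlet Laplacian -/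

/-- Test functions `φ ∈ C_c^∞(Ω)` with their gradients, as triples `(φ, ∂φ/∂x, ∂φ/∂y)` in
`L²(Ω)`. -/
def testTriples (Ω : Set (ℝ × ℝ)) : Submodule ℝ
    (Lp ℝ 2 (volume.restrict Ω) × Lp ℝ 2 (volume.restrict Ω) × Lp ℝ 2 (volume.restrict Ω)) where
  carrier := {w | ∃ φ : ℝ × ℝ → ℝ, ContDiff ℝ ∞ φ ∧ HasCompactSupport φ ∧ tsupport φ ⊆ Ω ∧
    w.1 =ᵐ[volume.restrict Ω] φ ∧
    w.2.1 =ᵐ[volume.restrict Ω] (fun p => fderiv ℝ φ p (1, 0)) ∧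
    w.2.2 =ᵐ[volume.restrict Ω] (fun p => fderiv ℝ φ p (0, 1))}
  zero_mem' := by
    refine ⟨0, contDiff_const, HasCompactSupport.zero, by simp [tsupport], ?_, ?_, ?_⟩
    · exact Lp.coeFn_zero _ _ _
    · filter_upwards [Lp.coeFn_zero ℝ 2 (volume.restrict Ω)] with p hp
      exact hp.trans (by simp)
    · filter_upwards [Lp.coeFn_zero ℝ 2 (volume.restrict Ω)] with p hp
      exact hp.trans (by simp)
  add_mem' := by
    rintro w w' ⟨φ, h1, h2, h3, h4, h5, h6⟩ ⟨φ', k1, k2, k3, k4, k5, k6⟩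
    have hd : ∀ p, fderiv ℝ (φ + φ') p = fderiv ℝ φ p + fderiv ℝ φ' p := fun p =>
      fderiv_add (h1.differentiable (by simp) p) (k1.differentiable (by simp) p)
    refine ⟨φ + φ', h1.add k1, h2.add k2, (tsupport_add φ φ').trans (Set.union_subset h3 k3),
      ?_, ?_, ?_⟩
    · filter_upwards [Lp.coeFn_add w.1 w'.1, h4, k4] with p hp hp1 hp2
      simp only [Prod.fst_add, Prod.snd_add, hp, Pi.add_apply, hp1, hp2]
    · filter_upwards [Lp.coeFn_add w.2.1 w'.2.1, h5, k5] with p hp hp1 hp2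
      simp only [Prod.fst_add, Prod.snd_add, hp, Pi.add_apply, hp1, hp2, hd,
        _root_.add_apply]
    · filter_upwards [Lp.coeFn_add w.2.2 w'.2.2, h6, k6] with p hp hp1 hp2
      simp only [Prod.fst_add, Prod.snd_add, hp, Pi.add_apply, hp1, hp2, hd,
        _root_.add_apply]
  smul_mem' := by
    rintro r w ⟨φ, h1, h2, h3, h4, h5, h6⟩
    have hd : ∀ p, fderiv ℝ (r • φ) p = r • fderiv ℝ φ p := fun p =>
      fderiv_const_smul (h1.differentiable (by simp) p) r
    refine ⟨r • φ, h1.const_smul r, h2.smul_left (f := fun _ => r),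
      (closure_mono (Function.support_const_smul_subset r φ)).trans h3, ?_, ?_, ?_⟩
    · filter_upwards [Lp.coeFn_smul r w.1, h4] with p hp hp1
      simp [hp, hp1]
    · filter_upwards [Lp.coeFn_smul r w.2.1, h5] with p hp hp1
      simp [hp, hp1, hd]
    · filter_upwards [Lp.coeFn_smul r w.2.2, h6] with p hp hp1
      simp [hp, hp1, hd]

/-- The Sobolev space `H¹₀(Ω)`, as the space of triples `(ψ, ∂ψ/∂x, ∂ψ/∂y)`: the closure of
`C_c^∞(Ω)` in the `H¹` norm. -/
def sobolevZero (Ω : Set (ℝ × ℝ)) : Submodule ℝ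
    (Lp ℝ 2 (volume.restrict Ω) × Lp ℝ 2 (volume.restrict Ω) × Lp ℝ 2 (volume.restrict Ω)) :=
  (testTriples Ω).topologicalClosure

/-- The Dirichlet Laplacian `Δ = -∂²/∂x² - ∂²/∂y²` in `L²(Ω)`: the operator of the quadratic form
`∫_Ω |∇ψ|²` on `H¹₀(Ω)`. -/
def dirichletLaplacian (Ω : Set (ℝ × ℝ)) :
    Lp ℝ 2 (volume.restrict Ω) →ₗ.[ℝ] Lp ℝ 2 (volume.restrict Ω) :=
  formOperator (sobolevZero Ω)

/-- On an open set the graph of the Dirichlet Laplacian is the one prescribed by its form. -/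
theorem dirichletLaplacian_graph {Ω : Set (ℝ × ℝ)} (hΩ : IsOpen Ω) :
    (dirichletLaplacian Ω).graph = formGraph (sobolevZero Ω) := by
  refine formOperator_graph _ fun f hf => ?_
  have hloc : LocallyIntegrableOn (f : ℝ × ℝ → ℝ) Ω volume :=
    (locallyIntegrableOn_of_locallyIntegrable_restrict
      ((Lp.memLp f).locallyIntegrable (by norm_num)))
  have key := hΩ.ae_eq_zero_of_integral_contDiff_smul_eq_zero hloc ?_
  · rw [Lp.eq_zero_iff_ae_eq_zero]
    exact (ae_restrict_iff' hΩ.measurableSet).2 key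
  intro φ h1 h2 h3
  have hd : Continuous (fderiv ℝ φ) := h1.continuous_fderiv (by simp)
  have m0 : MemLp φ 2 (volume.restrict Ω) := h1.continuous.memLp_of_hasCompactSupport h2
  have m1 : MemLp (fun p => fderiv ℝ φ p (1, 0)) 2 (volume.restrict Ω) :=
    (hd.clm_apply continuous_const).memLp_of_hasCompactSupport (h2.fderiv_apply ℝ (1, 0))
  have m2 : MemLp (fun p => fderiv ℝ φ p (0, 1)) 2 (volume.restrict Ω) :=
    (hd.clm_apply continuous_const).memLp_of_hasCompactSupport (h2.fderiv_apply ℝ (0, 1))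
  have hmem : (m0.toLp, m1.toLp, m2.toLp) ∈ sobolevZero Ω :=
    Submodule.le_topologicalClosure _
      ⟨φ, h1, h2, h3, m0.coeFn_toLp, m1.coeFn_toLp, m2.coeFn_toLp⟩
  have h0 := hf _ _ _ hmem
  rw [L2.inner_def] at h0
  rw [← setIntegral_eq_integral_of_forall_compl_eq_zero (s := Ω), ← h0]
  · refine integral_congr_ae ?_
    filter_upwards [m0.coeFn_toLp] with p hp
    simp [hp]
  · intro p hp
    rw [image_eq_zero_of_notMem_tsupport fun h => hp (h3 h), zero_smul]

/-- The strip `{(x, y) : x ∈ ℝ, 0 < y < ε h(x)}`. -/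
def strip (h : ℝ → ℝ) (ε : ℝ) : Set (ℝ × ℝ) := {p | 0 < p.2 ∧ p.2 < ε * h p.1}

/-! ### One-dimensional Schrödinger operators -/

/-- `g` is the weak derivative of `χ` on the line. -/
def HasWeakDeriv (χ g : ℝ → ℝ) : Prop :=
  ∀ φ : ℝ → ℝ, ContDiff ℝ ∞ φ → HasCompactSupport φ →
    ∫ x, χ x * deriv φ x = - ∫ x, g x * φ x

/-- `L²` functions times bounded, compactly supported ones are integrable. -/
theorem integrable_mul_test (u : Lp ℝ 2 (volume : Measure ℝ)) {φ : ℝ → ℝ} (h1 : Continuous φ)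
    (h2 : HasCompactSupport φ) : Integrable (fun x => u x * φ x) :=
  MemLp.integrable_mul (p := 2) (q := 2) (Lp.memLp u) (h1.memLp_of_hasCompactSupport h2)

/-- The form domain `{χ ∈ H¹(ℝ) : ∫ q χ² < ∞}` for a potential `q ≥ 0`, as the space of triples
`(χ, χ', √q χ)` in `L²(ℝ)`. -/
def schrodingerForm (q : ℝ → ℝ) : Submodule ℝ
    (Lp ℝ 2 (volume : Measure ℝ) × Lp ℝ 2 (volume : Measure ℝ) × Lp ℝ 2 (volume : Measure ℝ)) where
  carrier := {w | HasWeakDeriv w.1 w.2.1 ∧ w.2.2 =ᵐ[volume] (fun x => √(q x) * w.1 x)}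
  zero_mem' := by
    refine ⟨fun φ _ _ => by simp, ?_⟩
    filter_upwards with x
    simp
  add_mem' := by
    rintro w w' ⟨h1, h2⟩ ⟨k1, k2⟩
    refine ⟨fun φ c s => ?_, ?_⟩
    · have hd : Continuous (deriv φ) := c.continuous_deriv (by simp)
      have e1 : ∫ x, (w + w').1 x * deriv φ x
          = (∫ x, w.1 x * deriv φ x) + ∫ x, w'.1 x * deriv φ x := by
        rw [← integral_add (integrable_mul_test _ hd s.deriv) (integrable_mul_test _ hd s.deriv)]
        refine integral_congr_ae ?_
        filter_upwards [Lp.coeFn_add w.1 w'.1] with x hx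
        simp only [Prod.fst_add, Prod.snd_add, hx, Pi.add_apply, add_mul]
      have e2 : ∫ x, (w + w').2.1 x * φ x
          = (∫ x, w.2.1 x * φ x) + ∫ x, w'.2.1 x * φ x := by
        rw [← integral_add (integrable_mul_test _ c.continuous s)
          (integrable_mul_test _ c.continuous s)]
        refine integral_congr_ae ?_
        filter_upwards [Lp.coeFn_add w.2.1 w'.2.1] with x hx
        simp only [Prod.fst_add, Prod.snd_add, hx, Pi.add_apply, add_mul]
      rw [e1, e2, h1 φ c s, k1 φ c s]
      ring
    · filter_upwards [Lp.coeFn_add w.1 w'.1, Lp.coeFn_add w.2.2 w'.2.2, h2, k2] with x a b c d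
      simp only [Prod.fst_add, Prod.snd_add, a, b, c, d, Pi.add_apply, mul_add]
  smul_mem' := by
    rintro r w ⟨h1, h2⟩
    refine ⟨fun φ c s => ?_, ?_⟩
    · have e1 : ∫ x, (r • w).1 x * deriv φ x = r * ∫ x, w.1 x * deriv φ x := by
        rw [← integral_const_mul]
        refine integral_congr_ae ?_
        filter_upwards [Lp.coeFn_smul r w.1] with x hx
        simp [hx, mul_assoc]
      have e2 : ∫ x, (r • w).2.1 x * φ x = r * ∫ x, w.2.1 x * φ x := by
        rw [← integral_const_mul]
        refine integral_congr_ae ?_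
        filter_upwards [Lp.coeFn_smul r w.2.1] with x hx
        simp [hx, mul_assoc]
      rw [e1, e2, h1 φ c s]
      ring
    · filter_upwards [Lp.coeFn_smul r w.1, Lp.coeFn_smul r w.2.2, h2] with x a b c
      simp [a, b, c, mul_left_comm]

/-- The Schrödinger operator `-d²/dx² + q` in `L²(ℝ)`, `q ≥ 0`: the operator of the quadratic form
`∫ (χ'² + q χ²)` on its natural domain. -/
def schrodinger (q : ℝ → ℝ) : Lp ℝ 2 (volume : Measure ℝ) →ₗ.[ℝ] Lp ℝ 2 (volume : Measure ℝ) :=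
  formOperator (schrodingerForm q)

/-- For continuous `q` the graph of the Schrödinger operator is the one prescribed by its form. -/
theorem schrodinger_graph {q : ℝ → ℝ} (hq : Continuous q) :
    (schrodinger q).graph = formGraph (schrodingerForm q) := by
  refine formOperator_graph _ fun f hf => ?_
  rw [Lp.eq_zero_iff_ae_eq_zero]
  refine ae_eq_zero_of_integral_contDiff_smul_eq_zero
    ((Lp.memLp f).locallyIntegrable (by norm_num)) fun φ h1 h2 => ?_
  have hd : Continuous (deriv φ) := h1.continuous_deriv (by simp)
  have m0 : MemLp φ 2 (volume : Measure ℝ) := h1.continuous.memLp_of_hasCompactSupport h2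
  have m1 : MemLp (deriv φ) 2 (volume : Measure ℝ) := hd.memLp_of_hasCompactSupport h2.deriv
  have m2 : MemLp (fun x => √(q x) * φ x) 2 (volume : Measure ℝ) :=
    (hq.sqrt.mul h1.continuous).memLp_of_hasCompactSupport h2.mul_left
  have hmem : (m0.toLp, m1.toLp, m2.toLp) ∈ schrodingerForm q := by
    refine ⟨fun η c s => ?_, ?_⟩
    · have e1 : ∫ x, m0.toLp φ x * deriv η x = ∫ x, φ x * deriv η x := by
        refine integral_congr_ae ?_
        filter_upwards [m0.coeFn_toLp] with x hx
        simp [hx]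
      have e2 : ∫ x, m1.toLp (deriv φ) x * η x = ∫ x, deriv φ x * η x := by
        refine integral_congr_ae ?_
        filter_upwards [m1.coeFn_toLp] with x hx
        simp [hx]
      have hdη : Continuous (deriv η) := c.continuous_deriv (by simp)
      refine (e1.trans ?_).trans (congrArg Neg.neg e2.symm)
      refine integral_mul_deriv_eq_deriv_mul_of_integrable
        (fun x _ => (h1.differentiable (by simp) x).hasDerivAt)
        (fun x _ => (c.differentiable (by simp) x).hasDerivAt) ?_ ?_ ?_
      · exact (h1.continuous.mul hdη).integrable_of_hasCompactSupport h2.mul_right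
      · exact (hd.mul c.continuous).integrable_of_hasCompactSupport h2.deriv.mul_right
      · exact (h1.continuous.mul c.continuous).integrable_of_hasCompactSupport h2.mul_right
    · filter_upwards [m2.coeFn_toLp, m0.coeFn_toLp] with x hx hx0
      simp only [hx, hx0]
  have h0 := hf _ _ _ hmem
  rw [L2.inner_def] at h0
  rw [← h0]
  refine integral_congr_ae ?_
  filter_upwards [m0.coeFn_toLp] with p hp
  simp [hp]

/-- The limiting potential: `2π² M⁻³ c₊ x^m` for `x > 0` and `2π² M⁻³ c₋ |x|^m` for `x < 0`. -/
def potential (M cp cm m : ℝ) (x : ℝ) : ℝ :=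
  if 0 < x then 2 * Real.pi ^ 2 * M⁻¹ ^ 3 * cp * x ^ m
  else 2 * Real.pi ^ 2 * M⁻¹ ^ 3 * cm * |x| ^ m

end NarrowStrip

end

/-!
In the strip of width `ε h(x)` the transversal Dirichlet problem has lowest eigenvalue
`π² / (ε h(x))²`, with a gap of order `1 / ε²` to the next one. A function of energy close to the
threshold `π² / (ε M)²` is therefore essentially a multiple `χ(x)` of the first transversal mode,
and `χ` feels the effective potential `Q(x) / ε²`, where
`Q(x) = π² / h(x)² - π² / M² ≈ q(x)` near `0`, with `q` the limiting potential. As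
`q(a x) = a^m q(x)`, the substitution `x = a t` turns `-d²/dx² + q(x) / ε²` into
`a⁻² (-d²/dt² + q(t))` if `a^(m + 2) = ε²`, that is `a = ε ^ α`. Away from `0` the excess `Q / ε²`
is of order `1 / ε²`, much larger than `a⁻²`, so that those points do not matter.

*Spectral theory.* All operators here come from closed quadratic forms. If such a form is at least
`Λ ‖u‖²` up to finitely many bounded functionals (`FormDefect`), then the spectrum below `Λ` is
discrete (`le_essBottom`), and the eigenvalues below `Λ` obey the min-max principle
(`exists_isNthEigenvalue`), expressed by the predicate `NegTriples D k s`: the form is less than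
`s ‖u‖²` on some `k`-dimensional space. For the Schrödinger form these functionals are averages
over small intervals (`exists_partition_poincare`); for the strip they are averages of the
coefficient of the first transversal mode (`formDefect_testTriples`). By `NegTriples.of_closure`
the min-max principle only needs test functions, also for the Schrödinger form, of which they are
a core (`schrodingerForm_le_closure_core`). So no compact embedding theorem is used.

*Lower bound for the eigenvalues.* The first transversal coefficient `χ` of a test function `ψ`
carries all of the energy above the threshold but for a multiple of
`(‖ψ‖² - ‖χ‖²) / ε²` (`energy_ge`, which rests on the gap inequality `dirichlet_gap` on each
slice). After rescaling and cutting off, `χ` is an admissible trial function for the limiting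
operator (`eventually_negTriples_schrodingerForm`). Only values of `h` enter, not its derivative:
the comparison on each slice is between Dirichlet problems on two nested intervals.

*Upper bound.* The trial functions are `u(x / a) S(y / k(x))`, where `S` is a test function that
almost minimizes the energy on `(0, 1)` and `k ≤ ε h` is a smooth profile which on the scale `a` is
a good approximation of `ε h` (`eventually_negTriples_testTriples`).
-/

noncomputable section

namespace NarrowStrip

/-! ### Quadratic forms bounded below up to finitely many functionals -/

section Abstract

variable {K H : Type*} [NormedAddCommGroup K] [InnerProductSpace ℝ K]
  [NormedAddCommGroup H] [InnerProductSpace ℝ H]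

/-- The eigenspace of the form `‖w‖²` relative to the form `‖J w‖²`, for the parameter `σ`. If `K`
is the form domain of an operator `A` with the norm `‖u‖² + a[u]` and `J` is its embedding in `H`,
this is the eigenspace of `A` for `σ - 1`. -/
def relEigenspace (J : K →L[ℝ] H) (σ : ℝ) : Submodule ℝ K where
  carrier := {w | ∀ w', inner ℝ w w' = σ * inner ℝ (J w) (J w')}
  zero_mem' := fun w' => by simp
  add_mem' := fun {a b} ha hb w' => by
    simp only [Set.mem_ofPred_eq] at ha hb
    simp only [map_add, inner_add_left, ha w', hb w', mul_add]
  smul_mem' := fun r a ha w' => by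
    simp only [Set.mem_ofPred_eq] at ha
    simp only [map_smul, real_inner_smul_left, ha w']
    ring

/-- The form `‖w‖²` is at least `Λ ‖J w‖²` up to finitely many bounded functionals, collected in
the map `T`. -/
def FiniteDefect (J : K →L[ℝ] H) (Λ : ℝ) : Prop :=
  ∃ (n : ℕ) (T : K →L[ℝ] EuclideanSpace ℝ (Fin n)), ∀ w, Λ * ‖J w‖ ^ 2 ≤ ‖w‖ ^ 2 + ‖T w‖ ^ 2

theorem FiniteDefect.mono {J : K →L[ℝ] H} {Λ Λ' : ℝ} (h : FiniteDefect J Λ) (hle : Λ' ≤ Λ) :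
    FiniteDefect J Λ' := by
  obtain ⟨n, T, hT⟩ := h
  refine ⟨n, T, fun w => le_trans ?_ (hT w)⟩
  gcongr

theorem FiniteDefect.finiteDimensional {J : K →L[ℝ] H} {Λ : ℝ} (h : FiniteDefect J Λ)
    (L : Submodule ℝ K) (hL : ∀ w ∈ L, w ≠ 0 → ‖w‖ ^ 2 < Λ * ‖J w‖ ^ 2) :
    FiniteDimensional ℝ L := by
  obtain ⟨n, T, hT⟩ := h
  refine FiniteDimensional.of_injective (T.toLinearMap.domRestrict L) ?_
  rw [← LinearMap.ker_eq_bot, LinearMap.ker_eq_bot']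
  rintro ⟨w, hw⟩ h0
  by_contra hne
  have hne' : w ≠ 0 := fun h => hne (by simp [h])
  have h1 : T w = 0 := h0
  have := hT w
  rw [h1] at this
  have := hL w hw hne'
  simp at *
  linarith

/-- If `‖w‖² - σ ‖J w‖²` is asymptotically nonpositive on the differences of a bounded sequence and
`σ < Λ`, then the sequence has a convergent subsequence: along a subsequence the finitely many
functionals converge, and then the defect inequality makes it a Cauchy sequence. -/
theorem FiniteDefect.exists_subseq_tendsto [CompleteSpace K] {J : K →L[ℝ] H} {Λ σ : ℝ}
    (h : FiniteDefect J Λ) (hσ : σ < Λ) (w : ℕ → K) (C : ℝ) (hw : ∀ n, ‖w n‖ ≤ C)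
    (hq : ∀ δ > 0, ∃ N, ∀ n ≥ N, ∀ m ≥ N,
      ‖w n - w m‖ ^ 2 - σ * ‖J (w n - w m)‖ ^ 2 ≤ δ) :
    ∃ (φ : ℕ → ℕ) (w₀ : K), StrictMono φ ∧ Tendsto (w ∘ φ) atTop (𝓝 w₀) := by
  obtain ⟨n, T, hT⟩ := h
  obtain ⟨y, -, φ, hφ, hy⟩ := tendsto_subseq_of_bounded (x := fun n => T (w n))
    (Metric.isBounded_closedBall (x := (0 : EuclideanSpace ℝ (Fin n))) (r := ‖T‖ * C)) (fun n => by
      rw [mem_closedBall_zero_iff]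
      exact (T.le_opNorm _).trans (by gcongr; exact hw n))
  have hcau : CauchySeq (w ∘ φ) := by
    rw [Metric.cauchySeq_iff]
    intro e he
    set D := |σ| / (Λ - σ) with hD
    have hpos : 0 < Λ - σ := by linarith
    have hDn : 0 ≤ D := by positivity
    set δ := e ^ 2 / (4 * (1 + D)) with hδ
    have hδp : 0 < δ := by positivity
    obtain ⟨N1, hN1⟩ := hq δ hδp
    have hc := hy.cauchySeq
    rw [Metric.cauchySeq_iff] at hc
    obtain ⟨N2, hN2⟩ := hc (√δ) (by positivity)
    refine ⟨max N1 N2, fun a ha b hb => ?_⟩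
    set d := w (φ a) - w (φ b) with hd
    have h1 : ‖d‖ ^ 2 - σ * ‖J d‖ ^ 2 ≤ δ :=
      hN1 _ ((le_trans (le_max_left _ _) ha).trans hφ.le_apply) _
        ((le_trans (le_max_left _ _) hb).trans hφ.le_apply)
    have h2 : ‖T d‖ ^ 2 ≤ δ := by
      have := hN2 a (le_trans (le_max_right _ _) ha) b (le_trans (le_max_right _ _) hb)
      rw [dist_eq_norm] at this
      simp only [Function.comp_apply, ← map_sub] at this
      have h3 := Real.sq_sqrt hδp.le
      rw [← h3]
      gcongr
    have h3 := hT d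
    have h4 : ‖J d‖ ^ 2 ≤ 2 * δ / (Λ - σ) := by
      rw [le_div_iff₀ hpos]; nlinarith
    have h5 : ‖d‖ ^ 2 ≤ δ + |σ| * (2 * δ / (Λ - σ)) := by
      have : σ * ‖J d‖ ^ 2 ≤ |σ| * (2 * δ / (Λ - σ)) := by
        gcongr
        exact le_abs_self _
      linarith
    have h6 : ‖d‖ ^ 2 ≤ 2 * (δ * (1 + D)) := by
      have : |σ| * (2 * δ / (Λ - σ)) = 2 * (δ * D) := by rw [hD]; ring
      nlinarith
    have h7 : δ * (1 + D) = e ^ 2 / 4 := by rw [hδ]; field_simp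
    simp only [Function.comp_apply, dist_eq_norm]
    refine lt_of_pow_lt_pow_left₀ 2 he.le ?_
    rw [← hd]
    nlinarith [sq_pos_of_pos he]
  obtain ⟨w₀, hw₀⟩ := cauchySeq_tendsto_of_complete hcau
  exact ⟨φ, w₀, hφ, hw₀⟩

section Resolvent
variable [CompleteSpace K] [CompleteSpace H]
open ContinuousLinearMap

/-- The self-adjoint operator on `K` representing `‖w‖² - σ ‖J w‖²`. -/
def relOp (J : K →L[ℝ] H) (σ : ℝ) : K →L[ℝ] K :=
  ContinuousLinearMap.id ℝ K - σ • (adjoint J ∘L J)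

theorem inner_relOp (J : K →L[ℝ] H) (σ : ℝ) (w w' : K) :
    inner ℝ (relOp J σ w) w' = inner ℝ w w' - σ * inner ℝ (J w) (J w') := by
  simp [relOp, inner_sub_left, real_inner_smul_left, adjoint_inner_left]

/-- Otherwise a normalized sequence with `relOp J σ (w n) → 0` has a limit, which is an
eigenvector. -/
theorem FiniteDefect.relOp_bounded_below {J : K →L[ℝ] H} {Λ σ : ℝ} (h : FiniteDefect J Λ)
    (hσ : σ < Λ) (hE : relEigenspace J σ = ⊥) : ∃ c > 0, ∀ w, c * ‖w‖ ≤ ‖relOp J σ w‖ := by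
  by_contra! hcon
  have h1 : ∀ n : ℕ, ∃ w : K, ‖w‖ = 1 ∧ ‖relOp J σ w‖ < 1 / ((n : ℝ) + 1) := by
    intro n
    obtain ⟨w, hw⟩ := hcon (1 / ((n : ℝ) + 1)) (by positivity)
    have hw0 : w ≠ 0 := by
      rintro rfl
      simp at hw
    have hwn : 0 < ‖w‖ := norm_pos_iff.2 hw0
    refine ⟨(‖w‖⁻¹) • w, by simp [norm_smul, hwn.ne'], ?_⟩
    rw [map_smul, norm_smul, norm_inv, norm_norm, inv_mul_lt_iff₀ hwn]
    linarith
  choose w hw1 hw2 using h1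
  have hlim : Tendsto (fun n => ‖relOp J σ (w n)‖) atTop (𝓝 0) :=
    squeeze_zero (fun _ => norm_nonneg _) (fun n => (hw2 n).le) tendsto_one_div_add_atTop_nhds_zero_nat
  obtain ⟨φ, w₀, hφ, hlim'⟩ := h.exists_subseq_tendsto hσ w 1 (fun n => (hw1 n).le) (by
    intro δ hδ
    have := (Metric.tendsto_atTop.1 hlim) (δ / 4) (by positivity)
    obtain ⟨N, hN⟩ := this
    refine ⟨N, fun n hn m hm => ?_⟩
    have a1 := hN n hn
    have a2 := hN m hm
    simp only [dist_zero_right, norm_norm] at a1 a2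
    have e : ‖w n - w m‖ ^ 2 - σ * ‖J (w n - w m)‖ ^ 2
        = inner ℝ (relOp J σ (w n - w m)) (w n - w m) := by
      rw [inner_relOp, real_inner_self_eq_norm_sq, real_inner_self_eq_norm_sq]
    rw [e]
    refine (real_inner_le_norm _ _).trans ?_
    have b1 : ‖w n - w m‖ ≤ 2 := (norm_sub_le _ _).trans (by rw [hw1, hw1]; norm_num)
    have b2 : ‖relOp J σ (w n - w m)‖ ≤ δ / 2 := by
      rw [map_sub]
      exact (norm_sub_le _ _).trans (by linarith)
    calc _ ≤ δ / 2 * 2 := by gcongr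
      _ = δ := by ring)
  have hF : relOp J σ w₀ = 0 := by
    have t1 : Tendsto (fun n => relOp J σ (w (φ n))) atTop (𝓝 (relOp J σ w₀)) :=
      ((relOp J σ).continuous.tendsto _).comp hlim'
    have t2 : Tendsto (fun n => relOp J σ (w (φ n))) atTop (𝓝 0) :=
      tendsto_zero_iff_norm_tendsto_zero.2 (hlim.comp hφ.tendsto_atTop)
    exact tendsto_nhds_unique t1 t2
  have hmem : w₀ ∈ relEigenspace J σ := by
    intro w'
    have := inner_relOp J σ w₀ w'
    rw [hF, inner_zero_left] at this
    linarith
  rw [hE, Submodule.mem_bot] at hmem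
  have t3 : Tendsto (fun n => ‖w (φ n)‖) atTop (𝓝 ‖w₀‖) := hlim'.norm
  simp only [hw1, hmem, norm_zero] at t3
  exact one_ne_zero (tendsto_nhds_unique tendsto_const_nhds t3)

/-- Below `Λ` there is a resolvent at every `σ` that is not an eigenvalue: `relOp J σ` is
self-adjoint and bounded below, hence invertible. -/
theorem FiniteDefect.exists_resolvent {J : K →L[ℝ] H} {Λ σ : ℝ} (h : FiniteDefect J Λ)
    (hσ : σ < Λ) (hE : relEigenspace J σ = ⊥) :
    ∃ R : H →L[ℝ] K, ∀ f w', inner ℝ (R f) w' - σ * inner ℝ (J (R f)) (J w') = inner ℝ f (J w') := by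
  obtain ⟨c, hc, hb⟩ := h.relOp_bounded_below hσ hE
  have hanti : AntilipschitzWith (Real.toNNReal c⁻¹) (relOp J σ) := by
    refine (relOp J σ).antilipschitz_of_bound fun w => ?_
    rw [Real.coe_toNNReal _ (by positivity), ← div_eq_inv_mul, le_div_iff₀ hc, mul_comm]
    exact hb w
  have hcl : IsClosed (Set.range (relOp J σ)) :=
    hanti.isClosed_range (relOp J σ).uniformContinuous
  have hker : (relOp J σ).ker = ⊥ := LinearMap.ker_eq_bot.2 hanti.injective
  have hself : adjoint (relOp J σ) = relOp J σ := by
    rw [eq_comm, ContinuousLinearMap.eq_adjoint_iff]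
    intro x y
    rw [inner_relOp, real_inner_comm (relOp J σ y), inner_relOp, real_inner_comm x,
      real_inner_comm (J x)]
  have hran : (relOp J σ).range = ⊤ := by
    have h1 := ContinuousLinearMap.orthogonal_range (relOp J σ)
    rw [hself, hker] at h1
    have h2 := Submodule.orthogonal_orthogonal_eq_closure (relOp J σ).range
    rw [h1, Submodule.bot_orthogonal_eq_top] at h2
    rw [eq_comm, IsClosed.submodule_topologicalClosure_eq (by
      rwa [LinearMap.coe_range])] at h2
    exact h2
  let e := ContinuousLinearEquiv.ofBijective (relOp J σ) hker hran
  refine ⟨(e.symm : K →L[ℝ] K) ∘L adjoint J, fun f w' => ?_⟩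
  rw [← inner_relOp]
  have : relOp J σ (e.symm (adjoint J f)) = adjoint J f := e.apply_symm_apply _
  simp only [comp_apply, ContinuousLinearEquiv.coe_coe, this, adjoint_inner_left]

end Resolvent

/-- The infimum `σ` of `‖w‖² / ‖J w‖²` over a closed subspace is attained if it is less than `Λ`;
the Euler-Lagrange equation of a minimizer is stated with test vectors from the subspace. -/
theorem FiniteDefect.exists_minimizer [CompleteSpace K] {J : K →L[ℝ] H} {Λ : ℝ}
    (h : FiniteDefect J Λ) (W : Submodule ℝ K) (hW : IsClosed (W : Set K))
    {v : K} (hv : v ∈ W) (hlt : ‖v‖ ^ 2 < Λ * ‖J v‖ ^ 2) :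
    ∃ σ w₀, σ * ‖J v‖ ^ 2 ≤ ‖v‖ ^ 2 ∧ w₀ ∈ W ∧ w₀ ≠ 0 ∧
      ∀ w ∈ W, inner ℝ w₀ w = σ * inner ℝ (J w₀) (J w) := by
  have hnorm : ∀ w : K, J w ≠ 0 → ‖J (‖J w‖⁻¹ • w)‖ = 1 := fun w hw => by
    rw [map_smul, norm_smul, norm_inv, norm_norm, inv_mul_cancel₀ (norm_ne_zero_iff.2 hw)]
  set S : Set ℝ := {r | ∃ w ∈ W, ‖J w‖ = 1 ∧ ‖w‖ ^ 2 = r} with hS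
  have hbdd : BddBelow S := ⟨0, by rintro _ ⟨w, -, -, rfl⟩; positivity⟩
  have hJv : J v ≠ 0 := by
    intro h0
    rw [h0] at hlt
    simp at hlt
    nlinarith [sq_nonneg ‖v‖]
  have hmin : ∀ w ∈ W, sInf S * ‖J w‖ ^ 2 ≤ ‖w‖ ^ 2 := by
    intro w hw
    by_cases h0 : J w = 0
    · rw [h0]; simp
    · have hp : 0 < ‖J w‖ := norm_pos_iff.2 h0
      have : sInf S ≤ ‖‖J w‖⁻¹ • w‖ ^ 2 :=
        csInf_le hbdd ⟨_, W.smul_mem _ hw, hnorm w h0, rfl⟩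
      rw [norm_smul, norm_inv, norm_norm, mul_pow, inv_pow, ← div_eq_inv_mul,
        le_div_iff₀ (by positivity)] at this
      exact this
  have hne : S.Nonempty := ⟨_, _, W.smul_mem (‖J v‖⁻¹) hv, hnorm v hJv, rfl⟩
  set σ := sInf S with hσ
  have hσΛ : σ < Λ := by
    have h1 := hmin v hv
    have hp : 0 < ‖J v‖ ^ 2 := by have := norm_pos_iff.2 hJv; positivity
    by_contra! hcon
    nlinarith
  obtain ⟨r, hr1, hr2, hr3⟩ := exists_seq_tendsto_sInf hne hbdd
  choose w hwW hwJ hwr using hr3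
  have hlim : Tendsto (fun n => ‖w n‖ ^ 2) atTop (𝓝 σ) := by simpa only [hwr] using hr2
  obtain ⟨C, hC⟩ : ∃ C, ∀ n, ‖w n‖ ≤ C := by
    obtain ⟨C, hC⟩ := hlim.bddAbove_range
    refine ⟨√C, fun n => Real.le_sqrt_of_sq_le ?_⟩
    exact hC ⟨n, rfl⟩
  obtain ⟨φ, w₀, hφ, hw₀⟩ := h.exists_subseq_tendsto hσΛ w C hC (by
    intro δ hδ
    obtain ⟨N, hN⟩ := (Metric.tendsto_atTop.1 hlim) (δ / 4) (by positivity)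
    refine ⟨N, fun n hn m hm => ?_⟩
    have a1 := (abs_lt.1 (hN n hn)).2
    have a2 := (abs_lt.1 (hN m hm)).2
    have p1 := parallelogram_law_with_norm ℝ (w n) (w m)
    have p2 := parallelogram_law_with_norm ℝ (J (w n)) (J (w m))
    rw [hwJ, hwJ] at p2
    have p3 := hmin _ (W.add_mem (hwW n) (hwW m))
    rw [map_add] at p3
    rw [map_sub]
    nlinarith)
  have hw₀W : w₀ ∈ W := hW.mem_of_tendsto hw₀ (Eventually.of_forall fun n => hwW _)
  have hJ0 : ‖J w₀‖ = 1 := by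
    have t : Tendsto (fun n => ‖J (w (φ n))‖) atTop (𝓝 ‖J w₀‖) :=
      ((J.continuous.tendsto _).comp hw₀).norm
    simp only [hwJ] at t
    exact (tendsto_nhds_unique tendsto_const_nhds t).symm
  have hn0 : ‖w₀‖ ^ 2 = σ := by
    have t : Tendsto (fun n => ‖w (φ n)‖ ^ 2) atTop (𝓝 (‖w₀‖ ^ 2)) := hw₀.norm.pow 2
    exact tendsto_nhds_unique t (hlim.comp hφ.tendsto_atTop)
  refine ⟨σ, w₀, hmin v hv, hw₀W, fun h0 => by simp [h0] at hJ0, fun u hu => ?_⟩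
  -- The form `‖w‖² - σ ‖J w‖²` is nonnegative on `W` and vanishes at `w₀`.
  by_contra hne
  set b := inner ℝ w₀ u - σ * inner ℝ (J w₀) (J u) with hb
  have hb0 : b ≠ 0 := fun h => hne (by linarith)
  set q := ‖u‖ ^ 2 - σ * ‖J u‖ ^ 2 with hq
  have hq0 : 0 ≤ q := by have := hmin u hu; linarith
  have key : ∀ s : ℝ, 0 ≤ 2 * s * b + s ^ 2 * q := by
    intro s
    have h1 := hmin _ (W.add_mem hw₀W (W.smul_mem s hu))
    rw [map_add, map_smul, norm_add_sq_real, norm_add_sq_real, norm_smul, norm_smul,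
      real_inner_smul_right, real_inner_smul_right, hJ0, hn0, mul_pow, mul_pow,
      Real.norm_eq_abs, sq_abs] at h1
    rw [hb, hq]
    nlinarith
  have := key (-b / (q + 1))
  have e : 2 * (-b / (q + 1)) * b + (-b / (q + 1)) ^ 2 * q = -(b ^ 2 * (q + 2)) / (q + 1) ^ 2 := by
    field_simp; ring
  rw [e] at this
  have : -(b ^ 2 * (q + 2)) / (q + 1) ^ 2 < 0 := by
    apply div_neg_of_neg_of_pos
    · have : 0 < b ^ 2 := by positivity
      nlinarith
    · positivity
  linarith

/-! ### Spans of eigenspaces -/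

theorem relEigenspace_orthogonal {J : K →L[ℝ] H} {σ τ : ℝ} (hne : σ ≠ τ) {u v : K}
    (hu : u ∈ relEigenspace J σ) (hv : v ∈ relEigenspace J τ) :
    inner ℝ (J u) (J v) = 0 := by
  have h1 := hu v
  have h2 := hv u
  rw [real_inner_comm, real_inner_comm (J u)] at h2
  have : (σ - τ) * inner ℝ (J u) (J v) = 0 := by linarith
  exact (mul_eq_zero.1 this).resolve_left (sub_ne_zero.2 hne)

/-- The span of the eigenspaces with parameter in `S`. -/
def specSpan (J : K →L[ℝ] H) (S : Set ℝ) : Submodule ℝ K := ⨆ σ ∈ S, relEigenspace J σ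

theorem relEigenspace_le_specSpan {J : K →L[ℝ] H} {S : Set ℝ} {σ : ℝ} (h : σ ∈ S) :
    relEigenspace J σ ≤ specSpan J S := le_iSup₂_of_le σ h le_rfl

theorem mem_specSpan {J : K →L[ℝ] H} {σ : ℝ} {w : K} (hw : w ∈ relEigenspace J σ)
    (S : Set ℝ) (h : σ ∈ S) : w ∈ specSpan J S := relEigenspace_le_specSpan h hw

theorem norm_sq_sum_relEigenspace {J : K →L[ℝ] H} (f : ℝ → K) (hf : ∀ σ, f σ ∈ relEigenspace J σ)
    (s : Finset ℝ) : ‖J (∑ σ ∈ s, f σ)‖ ^ 2 = ∑ σ ∈ s, ‖J (f σ)‖ ^ 2 ∧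
      ‖∑ σ ∈ s, f σ‖ ^ 2 = ∑ σ ∈ s, σ * ‖J (f σ)‖ ^ 2 := by
  have key : ∀ σ ∈ s, ∑ τ ∈ s, inner ℝ (J (f σ)) (J (f τ)) = ‖J (f σ)‖ ^ 2 := by
    intro σ hσ
    rw [Finset.sum_eq_single_of_mem σ hσ, real_inner_self_eq_norm_sq]
    intro τ _ hne
    exact relEigenspace_orthogonal hne.symm (hf σ) (hf τ)
  constructor
  · rw [map_sum, ← real_inner_self_eq_norm_sq, sum_inner]
    refine Finset.sum_congr rfl fun σ hσ => ?_
    rw [inner_sum, key σ hσ]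
  · rw [← real_inner_self_eq_norm_sq, sum_inner]
    refine Finset.sum_congr rfl fun σ hσ => ?_
    rw [hf σ _, map_sum, inner_sum, key σ hσ]

theorem exists_finset_of_mem_specSpan {J : K →L[ℝ] H} {S : Set ℝ} {w : K}
    (hw : w ∈ specSpan J S) : ∃ (f : ℝ → K) (s : Finset ℝ), (∀ σ, f σ ∈ relEigenspace J σ) ∧
      (↑s ⊆ S) ∧ w = ∑ σ ∈ s, f σ := by
  have h1 : w ∈ ⨆ σ : ℝ, ⨆ _ : σ ∈ S, relEigenspace J σ := hw
  rw [Submodule.mem_iSup_iff_exists_finsupp] at h1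
  obtain ⟨f, hf, hsum⟩ := h1
  have hz : ∀ σ, σ ∉ S → f σ = 0 := fun σ hσ => by
    have := hf σ
    simpa [hσ] using this
  refine ⟨f, f.support, fun σ => ?_, fun σ hσ => ?_, ?_⟩
  · by_cases h : σ ∈ S
    · have := hf σ
      simpa [h] using this
    · rw [hz σ h]; exact Submodule.zero_mem _
  · by_contra h
    exact (Finsupp.mem_support_iff.1 hσ) (hz σ h)
  · rw [← hsum]; rfl

theorem J_ne_zero_of_mem_specSpan {J : K →L[ℝ] H} {S : Set ℝ} {w : K}
    (hw : w ∈ specSpan J S) (h0 : J w = 0) : w = 0 := by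
  obtain ⟨f, s, hf, -, rfl⟩ := exists_finset_of_mem_specSpan hw
  obtain ⟨h1, h2⟩ := norm_sq_sum_relEigenspace f hf s
  rw [h0, norm_zero, zero_pow two_ne_zero, eq_comm,
    Finset.sum_eq_zero_iff_of_nonneg (fun _ _ => by positivity)] at h1
  rw [Finset.sum_eq_zero (f := fun σ => σ * ‖J (f σ)‖ ^ 2)
    fun σ hσ => by simp only [h1 σ hσ, mul_zero]] at h2
  exact norm_eq_zero.1 ((pow_eq_zero_iff two_ne_zero).1 h2)

theorem norm_sq_lt_of_mem_specSpan {J : K →L[ℝ] H} {S : Set ℝ} {τ : ℝ} (hS : ∀ σ ∈ S, σ < τ)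
    {w : K} (hw : w ∈ specSpan J S) (hne : w ≠ 0) : ‖w‖ ^ 2 < τ * ‖J w‖ ^ 2 := by
  obtain ⟨f, s, hf, hs, rfl⟩ := exists_finset_of_mem_specSpan hw
  obtain ⟨h1, h2⟩ := norm_sq_sum_relEigenspace f hf s
  have hJ : J (∑ σ ∈ s, f σ) ≠ 0 := fun h0 => hne (J_ne_zero_of_mem_specSpan hw h0)
  have hpos : 0 < ‖J (∑ σ ∈ s, f σ)‖ ^ 2 := by have := norm_pos_iff.2 hJ; positivity
  obtain ⟨σ, hσ, hσ0⟩ : ∃ σ ∈ s, ‖J (f σ)‖ ^ 2 ≠ 0 := by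
    by_contra! hcon
    rw [h1, Finset.sum_eq_zero hcon] at hpos
    exact lt_irrefl _ hpos
  rw [h1, h2, Finset.mul_sum]
  refine Finset.sum_lt_sum (fun τ' hτ' => ?_) ⟨σ, hσ, ?_⟩
  · have := hS τ' (hs hτ')
    gcongr
  · have := hS σ (hs hσ)
    have : 0 < ‖J (f σ)‖ ^ 2 := lt_of_le_of_ne (by positivity) (Ne.symm hσ0)
    gcongr

theorem FiniteDefect.finiteDimensional_specSpan {J : K →L[ℝ] H} {Λ : ℝ} (h : FiniteDefect J Λ)
    {S : Set ℝ} (hS : ∀ σ ∈ S, σ < Λ) : FiniteDimensional ℝ (specSpan J S) :=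
  h.finiteDimensional _ fun _ hw hne => norm_sq_lt_of_mem_specSpan hS hw hne

theorem FiniteDefect.finite_eigenvalues {J : K →L[ℝ] H} {Λ : ℝ} (h : FiniteDefect J Λ) :
    {σ | σ < Λ ∧ relEigenspace J σ ≠ ⊥}.Finite := by
  have hfin : FiniteDimensional ℝ (specSpan J (Set.Iio Λ)) :=
    h.finiteDimensional_specSpan fun σ hσ => hσ
  have h1 : ∀ σ : {σ | σ < Λ ∧ relEigenspace J σ ≠ ⊥}, ∃ w ∈ relEigenspace J σ.1, w ≠ 0 :=
    fun σ => (Submodule.ne_bot_iff _).1 σ.2.2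
  choose w hw hw0 using h1
  have hmem : ∀ σ, w σ ∈ specSpan J (Set.Iio Λ) := fun σ => mem_specSpan (hw σ) _ (Set.mem_Iio.2 σ.2.1)
  have hJ0 : ∀ σ, J (w σ) ≠ 0 := fun σ h0 => hw0 σ (J_ne_zero_of_mem_specSpan (hmem σ) h0)
  have hli : LinearIndependent ℝ (fun σ => J (w σ)) :=
    linearIndependent_of_ne_zero_of_inner_eq_zero hJ0 fun σ τ hne =>
      relEigenspace_orthogonal (fun h => hne (Subtype.ext h)) (hw σ) (hw τ)
  have hli' : LinearIndependent ℝ w := LinearIndependent.of_comp (J : K →ₗ[ℝ] H) hli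
  have hli'' : LinearIndependent ℝ (fun σ => (⟨w σ, hmem σ⟩ : specSpan J (Set.Iio Λ))) :=
    LinearIndependent.of_comp (specSpan J (Set.Iio Λ)).subtype hli'
  exact hli''.finite_of_isNoetherian

/-- The form is at least `τ ‖J v‖²` on the vectors orthogonal to all eigenvectors with parameter
below `τ`: otherwise a minimizer over these vectors would be a further such eigenvector. -/
theorem FiniteDefect.le_of_orthogonal [CompleteSpace K] {J : K →L[ℝ] H} {Λ τ : ℝ}
    (h : FiniteDefect J Λ) (hτ : τ ≤ Λ) {v : K}
    (hv : ∀ u ∈ specSpan J (Set.Iio τ), inner ℝ (J u) (J v) = 0) :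
    τ * ‖J v‖ ^ 2 ≤ ‖v‖ ^ 2 := by
  by_contra! hcon
  set N := specSpan J (Set.Iio τ) with hN
  have hfin : FiniteDimensional ℝ N := h.finiteDimensional_specSpan fun σ hσ => lt_of_lt_of_le hσ hτ
  let P : Submodule ℝ H := N.map (J : K →ₗ[ℝ] H)
  have hPfin : FiniteDimensional ℝ P := inferInstance
  let W : Submodule ℝ K := Pᗮ.comap (J : K →ₗ[ℝ] H)
  have hW : IsClosed (W : Set K) := (Submodule.isClosed_orthogonal P).preimage J.continuous
  have hmemW : ∀ v, v ∈ W ↔ ∀ u ∈ N, inner ℝ (J u) (J v) = 0 := by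
    intro v
    simp only [W, P, Submodule.mem_comap, Submodule.mem_orthogonal, Submodule.mem_map]
    constructor
    · intro h u hu
      exact h _ ⟨u, hu, rfl⟩
    · rintro h _ ⟨u, hu, rfl⟩
      exact h u hu
  obtain ⟨σ, w₀, hσ, hw₀W, hw₀, hcrit⟩ :=
    (h.mono hτ).exists_minimizer W hW ((hmemW v).2 hv) hcon
  have hστ : σ < τ := by
    have : σ * ‖J v‖ ^ 2 < τ * ‖J v‖ ^ 2 := lt_of_le_of_lt hσ hcon
    exact lt_of_mul_lt_mul_right this (by positivity)
  have hNorth : ∀ n ∈ N, inner ℝ w₀ n = 0 := by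
    intro n hn
    obtain ⟨f, s, hf, hs, rfl⟩ := exists_finset_of_mem_specSpan hn
    rw [inner_sum]
    refine Finset.sum_eq_zero fun t ht => ?_
    rw [real_inner_comm, hf t w₀,
      (hmemW w₀).1 hw₀W _ (mem_specSpan (hf t) _ (hs ht)), mul_zero]
  have hE : w₀ ∈ relEigenspace J σ := by
    intro w'
    obtain ⟨y, hy, z, hz, hyz⟩ := P.exists_add_mem_mem_orthogonal (J w')
    obtain ⟨n, hn, rfl⟩ := hy
    have hz' : w' - n ∈ W := by
      change J (w' - n) ∈ Pᗮ
      have : J (w' - n) = z := by rw [map_sub, hyz]; simp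
      rwa [this]
    have h1 := hcrit _ hz'
    have h2 : inner ℝ (J w₀) (J n) = 0 := by
      rw [real_inner_comm]; exact (hmemW w₀).1 hw₀W n hn
    rw [map_sub, inner_sub_right, inner_sub_right, hNorth n hn, h2] at h1
    linarith
  have hN0 : w₀ ∈ N := mem_specSpan hE _ (Set.mem_Iio.2 hστ)
  have := (hmemW w₀).1 hw₀W w₀ hN0
  exact hw₀ (J_ne_zero_of_mem_specSpan hN0 (inner_self_eq_zero.1 this))

/-- The form is less than `s ‖J w‖²` on some `k`-dimensional space, given by a spanning family.
The strict inequality forces the family to be linearly independent. -/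
def NegFamily (J : K →L[ℝ] H) (k : ℕ) (s : ℝ) : Prop :=
  ∃ Φ : Fin k → K, ∀ c : Fin k → ℝ, c ≠ 0 →
    ‖∑ i, c i • Φ i‖ ^ 2 < s * ‖J (∑ i, c i • Φ i)‖ ^ 2

theorem NegFamily.mono {J : K →L[ℝ] H} {k : ℕ} {s s' : ℝ} (h : NegFamily J k s) (hs : s ≤ s') :
    NegFamily J k s' := by
  obtain ⟨Φ, hΦ⟩ := h
  refine ⟨Φ, fun c hc => (hΦ c hc).trans_le ?_⟩
  gcongr

theorem FiniteDefect.negFamily_iff [CompleteSpace K] {J : K →L[ℝ] H} {Λ s : ℝ}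
    (h : FiniteDefect J Λ) (hs : s ≤ Λ) {k : ℕ} :
    NegFamily J k s ↔ k ≤ Module.finrank ℝ (specSpan J (Set.Iio s)) := by
  have hfin : FiniteDimensional ℝ (specSpan J (Set.Iio s)) :=
    h.finiteDimensional_specSpan fun σ hσ => lt_of_lt_of_le hσ hs
  constructor
  · rintro ⟨Φ, hΦ⟩
    by_contra! hlt
    set N := specSpan J (Set.Iio s)
    let b := Module.finBasis ℝ N
    let A : (Fin k → ℝ) →ₗ[ℝ] (Fin (Module.finrank ℝ N) → ℝ) :=
      LinearMap.pi fun i => (innerₛₗ ℝ (J (b i))) ∘ₗ (J : K →ₗ[ℝ] H) ∘ₗ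
        (Fintype.linearCombination ℝ Φ)
    have : A.ker ≠ ⊥ := by
      apply LinearMap.ker_ne_bot_of_finrank_lt
      simpa using hlt
    obtain ⟨c, hc, hc0⟩ := (Submodule.ne_bot_iff _).1 this
    have h1 := hΦ c hc0
    refine absurd h1 (not_lt.2 (h.le_of_orthogonal hs fun u hu => ?_))
    have h2 : ∀ i, inner ℝ (J (b i)) (J (∑ i, c i • Φ i)) = 0 := fun i => by
      have := congrFun (LinearMap.mem_ker.1 hc) i
      simpa [A, Fintype.linearCombination_apply] using this
    have h3 := b.sum_repr ⟨u, hu⟩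
    have h4 := congrArg (Submodule.subtype _) h3
    rw [map_sum] at h4
    simp only [map_smul, Submodule.subtype_apply] at h4
    rw [← h4, map_sum, sum_inner]
    refine Finset.sum_eq_zero fun i _ => ?_
    rw [map_smul, real_inner_smul_left, h2 i, mul_zero]
  · intro hk
    let b := Module.finBasis ℝ (specSpan J (Set.Iio s))
    refine ⟨fun i => (b (Fin.castLE hk i) : K), fun c hc => ?_⟩
    have hli : LinearIndependent ℝ (fun i => (b (Fin.castLE hk i) : K)) :=
      (b.linearIndependent.map' (Submodule.subtype _) (Submodule.ker_subtype _)).comp _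
        (Fin.castLE_injective hk)
    refine norm_sq_lt_of_mem_specSpan (S := Set.Iio s) (fun σ hσ => hσ) ?_ ?_
    · exact Submodule.sum_mem _ fun i _ => Submodule.smul_mem _ _ (Subtype.mem _)
    · intro h0
      exact hc (funext (Fintype.linearIndependent_iff.1 hli c h0))

/-- The min-max principle: if `NegFamily J (j + 1) s₀` for some `s₀ < Λ`, the infimum of all such
parameters is the `j`-th eigenvalue. -/
theorem FiniteDefect.exists_eigenvalue [CompleteSpace K] {J : K →L[ℝ] H} {Λ s₀ : ℝ}
    (h : FiniteDefect J Λ) (hs : s₀ < Λ) {j : ℕ} (hneg : NegFamily J (j + 1) s₀) :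
    ∃ σ ≤ s₀, (∀ s, σ < s → NegFamily J (j + 1) s) ∧
      (∀ s, NegFamily J (j + 1) s → σ ≤ s) ∧
      Module.finrank ℝ (specSpan J (Set.Iio σ)) ≤ j ∧
      j < Module.finrank ℝ (specSpan J (Set.Iic σ)) := by
  set A := {s | NegFamily J (j + 1) s} with hA
  have hbdd : BddBelow A := by
    refine ⟨0, ?_⟩
    rintro s ⟨Φ, hΦ⟩
    by_contra! hneg
    have := hΦ 1 (by simp)
    nlinarith [sq_nonneg ‖∑ i, (1 : Fin (j+1) → ℝ) i • Φ i‖,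
      sq_nonneg ‖J (∑ i, (1 : Fin (j+1) → ℝ) i • Φ i)‖]
  set σ := sInf A with hσ
  have h1 : ∀ s, σ < s → NegFamily J (j + 1) s := by
    intro s hs
    obtain ⟨s', hs', hlt⟩ := exists_lt_of_csInf_lt ⟨s₀, hneg⟩ hs
    exact NegFamily.mono hs' hlt.le
  have hσ0 : σ ≤ s₀ := csInf_le hbdd hneg
  have hσΛ : σ < Λ := hσ0.trans_lt hs
  refine ⟨σ, hσ0, h1, fun s hs => csInf_le hbdd hs, ?_, ?_⟩
  · by_contra! hcon
    -- Only finitely many eigenvalues lie below `σ`, so they stay away from `σ`.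
    have hfin : ({t | t < Λ ∧ relEigenspace J t ≠ ⊥} ∩ Set.Iio σ).Finite :=
      h.finite_eigenvalues.inter_of_left _
    obtain ⟨s, hsσ, hle⟩ : ∃ s < σ, specSpan J (Set.Iio σ) ≤ specSpan J (Set.Iio s) := by
      obtain ⟨m, hm⟩ : ∃ m < σ, ∀ t ∈ {t | t < Λ ∧ relEigenspace J t ≠ ⊥} ∩ Set.Iio σ, t ≤ m := by
        rcases ({t | t < Λ ∧ relEigenspace J t ≠ ⊥} ∩ Set.Iio σ).eq_empty_or_nonempty with he | he
        · exact ⟨σ - 1, by linarith, by simp [he]⟩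
        · obtain ⟨m, hm, hmax⟩ := hfin.exists_maximal he
          refine ⟨m, hm.2, fun t ht => ?_⟩
          by_contra! hlt
          exact absurd (hmax ht hlt.le) (not_le.2 hlt)
      refine ⟨(m + σ) / 2, by linarith, iSup₂_le fun t ht => ?_⟩
      by_cases hb : relEigenspace J t = ⊥
      · rw [hb]; exact bot_le
      · have := hm.2 t ⟨⟨lt_trans ht hσΛ, hb⟩, ht⟩
        exact relEigenspace_le_specSpan (by rw [Set.mem_Iio]; linarith)
    have hN : NegFamily J (j + 1) s := by
      rw [h.negFamily_iff (hsσ.trans hσΛ).le]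
      have : FiniteDimensional ℝ (specSpan J (Set.Iio s)) :=
        h.finiteDimensional_specSpan fun t ht => lt_trans ht (hsσ.trans hσΛ)
      exact (Nat.succ_le_of_lt hcon).trans (Submodule.finrank_mono hle)
    exact absurd (csInf_le hbdd hN) (not_le.2 hsσ)
  · have hfin : ({t | t < Λ ∧ relEigenspace J t ≠ ⊥} ∩ Set.Ioi σ).Finite :=
      h.finite_eigenvalues.inter_of_left _
    obtain ⟨s, hsσ, hsΛ, hle⟩ : ∃ s, σ < s ∧ s < Λ ∧
        specSpan J (Set.Iio s) ≤ specSpan J (Set.Iic σ) := by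
      obtain ⟨m, hm1, hm2, hm⟩ : ∃ m, σ < m ∧ m < Λ ∧
          ∀ t ∈ {t | t < Λ ∧ relEigenspace J t ≠ ⊥} ∩ Set.Ioi σ, m ≤ t := by
        rcases ({t | t < Λ ∧ relEigenspace J t ≠ ⊥} ∩ Set.Ioi σ).eq_empty_or_nonempty with he | he
        · exact ⟨(σ + Λ) / 2, by linarith, by linarith, by simp [he]⟩
        · obtain ⟨m, hm, hmin⟩ := hfin.exists_minimal he
          refine ⟨m, hm.2, hm.1.1, fun t ht => ?_⟩
          by_contra! hlt
          exact absurd (hmin ht hlt.le) (not_le.2 hlt)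
      refine ⟨m, hm1, hm2, iSup₂_le fun t ht => ?_⟩
      by_cases hb : relEigenspace J t = ⊥
      · rw [hb]; exact bot_le
      · refine relEigenspace_le_specSpan ?_
        by_contra hcon
        rw [Set.mem_Iic, not_le] at hcon
        exact absurd (hm t ⟨⟨lt_trans ht hm2, hb⟩, hcon⟩) (not_le.2 ht)
    have h2 := (h.negFamily_iff hsΛ.le).1 (h1 s hsσ)
    have : FiniteDimensional ℝ (specSpan J (Set.Iic σ)) :=
      h.finiteDimensional_specSpan fun t ht => lt_of_le_of_lt ht hσΛ
    exact (Nat.lt_of_succ_le h2).trans_le (Submodule.finrank_mono hle)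

end Abstract

/-! ### The operator of a closed quadratic form -/

section FormOperator

variable {H : Type*} [NormedAddCommGroup H] [InnerProductSpace ℝ H]

/-- The product `H × H × H` with the Hilbert norm. -/
abbrev TripleSpace (H : Type*) : Type _ := WithLp 2 (H × WithLp 2 (H × H))

/-- The form domain with the form norm `‖u‖² + a[u]`. -/
def formSpace (D : Submodule ℝ (H × H × H)) : Submodule ℝ (TripleSpace H) where
  carrier := {w | (w.fst, w.snd.fst, w.snd.snd) ∈ D}
  zero_mem' := D.zero_mem
  add_mem' := fun ha hb => D.add_mem ha hb
  smul_mem' := fun r _ ha => D.smul_mem r ha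

theorem isClosed_formSpace {D : Submodule ℝ (H × H × H)} (hD : IsClosed (D : Set (H × H × H))) :
    IsClosed (formSpace D : Set (TripleSpace H)) := by
  have hc : Continuous fun w : TripleSpace H => (w.fst, w.snd.fst, w.snd.snd) := by
    have h1 : Continuous fun w : TripleSpace H => w.fst := WithLp.continuous_fst 2 _ _
    have h2 : Continuous fun w : TripleSpace H => w.snd := WithLp.continuous_snd 2 _ _
    have h3 : Continuous fun w : WithLp 2 (H × H) => w.fst := WithLp.continuous_fst 2 _ _
    have h4 : Continuous fun w : WithLp 2 (H × H) => w.snd := WithLp.continuous_snd 2 _ _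
    exact h1.prodMk ((h3.comp h2).prodMk (h4.comp h2))
  exact hD.preimage hc

/-- The form domain as a Hilbert space. -/
def FormDomain (D : Submodule ℝ (H × H × H)) : Type _ := formSpace D

instance (D : Submodule ℝ (H × H × H)) : NormedAddCommGroup (FormDomain D) :=
  inferInstanceAs (NormedAddCommGroup (formSpace D))

instance (D : Submodule ℝ (H × H × H)) : InnerProductSpace ℝ (FormDomain D) :=
  inferInstanceAs (InnerProductSpace ℝ (formSpace D))

/-- The underlying triple of an element of the form domain. -/
def FormDomain.triple {D : Submodule ℝ (H × H × H)} : FormDomain D →ₗ[ℝ] H × H × H where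
  toFun w := (w.1.fst, w.1.snd.fst, w.1.snd.snd)
  map_add' _ _ := rfl
  map_smul' _ _ := rfl

theorem FormDomain.triple_mem {D : Submodule ℝ (H × H × H)} (w : FormDomain D) :
    w.triple ∈ D := w.2

/-- The element of the form domain given by a triple. -/
def FormDomain.mk {D : Submodule ℝ (H × H × H)} : D →ₗ[ℝ] FormDomain D where
  toFun x := ⟨WithLp.toLp 2 (x.1.1, WithLp.toLp 2 x.1.2), x.2⟩
  map_add' _ _ := rfl
  map_smul' _ _ := rfl

theorem FormDomain.triple_mk {D : Submodule ℝ (H × H × H)} (x : D) :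
    (FormDomain.mk x).triple = x := rfl

/-- The embedding of the form domain in the Hilbert space. -/
def formEmb (D : Submodule ℝ (H × H × H)) : FormDomain D →L[ℝ] H :=
  (WithLp.fstL 2 ℝ H (WithLp 2 (H × H))).comp (formSpace D).subtypeL

theorem formEmb_apply {D : Submodule ℝ (H × H × H)} (w : FormDomain D) :
    formEmb D w = w.triple.1 := rfl

theorem inner_formDomain {D : Submodule ℝ (H × H × H)} (w w' : FormDomain D) :
    inner ℝ w w' = inner ℝ w.triple.1 w'.triple.1 +
      (inner ℝ w.triple.2.1 w'.triple.2.1 + inner ℝ w.triple.2.2 w'.triple.2.2) := by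
  have h1 : inner ℝ w w' = inner ℝ (w.1 : TripleSpace H) (w'.1 : TripleSpace H) := rfl
  rw [h1, WithLp.prod_inner_apply, WithLp.prod_inner_apply]
  rfl

theorem norm_sq_formDomain {D : Submodule ℝ (H × H × H)} (w : FormDomain D) :
    ‖w‖ ^ 2 = ‖w.triple.1‖ ^ 2 + (‖w.triple.2.1‖ ^ 2 + ‖w.triple.2.2‖ ^ 2) := by
  simp only [← real_inner_self_eq_norm_sq, inner_formDomain]

/-- The form described by `D` is bounded below by `Λ`, up to finitely many functionals that are
bounded in `H`. -/
def FormDefect (D : Submodule ℝ (H × H × H)) (Λ : ℝ) : Prop :=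
  ∃ (n : ℕ) (g : Fin n → H), ∀ w ∈ D,
    Λ * ‖w.1‖ ^ 2 ≤ ‖w.2.1‖ ^ 2 + ‖w.2.2‖ ^ 2 + ∑ i, inner ℝ (g i) w.1 ^ 2

/-- The form described by `D` is less than `s ‖u‖²` on some `k`-dimensional subspace of its domain,
given by a spanning family. -/
def NegTriples (D : Submodule ℝ (H × H × H)) (k : ℕ) (s : ℝ) : Prop :=
  ∃ Φ : Fin k → H × H × H, (∀ i, Φ i ∈ D) ∧ ∀ c : Fin k → ℝ, c ≠ 0 →
    ‖(∑ i, c i • Φ i).2.1‖ ^ 2 + ‖(∑ i, c i • Φ i).2.2‖ ^ 2 < s * ‖(∑ i, c i • Φ i).1‖ ^ 2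

theorem FormDefect.closure {D : Submodule ℝ (H × H × H)} {Λ : ℝ} (h : FormDefect D Λ) :
    FormDefect D.topologicalClosure Λ := by
  obtain ⟨n, g, hg⟩ := h
  refine ⟨n, g, fun w hw => ?_⟩
  have hcl : IsClosed {w : H × H × H |
      Λ * ‖w.1‖ ^ 2 ≤ ‖w.2.1‖ ^ 2 + ‖w.2.2‖ ^ 2 + ∑ i, inner ℝ (g i) w.1 ^ 2} := by
    refine isClosed_le (by fun_prop) ?_
    refine ((by fun_prop : Continuous fun w : H × H × H => ‖w.2.1‖ ^ 2 + ‖w.2.2‖ ^ 2)).add ?_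
    refine continuous_finsetSum _ fun i _ => ?_
    exact (continuous_const.inner continuous_fst).pow 2
  exact closure_minimal (fun w hw => hg w hw) hcl hw

/-- Negative subspaces can be found in a core: being negative is stable under small perturbations
of the spanning family. -/
theorem NegTriples.of_closure {D : Submodule ℝ (H × H × H)} {k : ℕ} {s : ℝ}
    (h : NegTriples D.topologicalClosure k s) : NegTriples D k s := by
  obtain ⟨Φ, hΦD, hΦ⟩ := h
  let F : (Fin k → H × H × H) × (Fin k → ℝ) → ℝ := fun z =>
    ‖(∑ i, z.2 i • z.1 i).2.1‖ ^ 2 + ‖(∑ i, z.2 i • z.1 i).2.2‖ ^ 2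
      - s * ‖(∑ i, z.2 i • z.1 i).1‖ ^ 2
  have hF : Continuous F := by fun_prop
  -- Negativity on the compact unit sphere of coefficients is an open condition on the family.
  have hev : ∀ᶠ Ψ in 𝓝 Φ, ∀ c ∈ Metric.sphere (0 : Fin k → ℝ) 1, F (Ψ, c) < 0 := by
    refine (isCompact_sphere _ _).eventually_forall_of_forall_eventually fun c hc => ?_
    have hc0 : c ≠ 0 := by
      rintro rfl
      simp at hc
    have : F (Φ, c) < 0 := by
      have := hΦ c hc0
      simp only [F]
      linarith
    exact hF.continuousAt.eventually_lt continuousAt_const this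
  have hmem : Φ ∈ _root_.closure (Set.univ.pi fun _ : Fin k => (D : Set (H × H × H))) := by
    rw [closure_pi_set]
    exact fun i _ => hΦD i
  obtain ⟨Ψ, hΨ, hΨD⟩ := mem_closure_iff_nhds.1 hmem _ hev
  refine ⟨Ψ, fun i => hΨD i (Set.mem_univ i), fun c hc => ?_⟩
  have hcn : 0 < ‖c‖ := norm_pos_iff.2 hc
  have h1 : F (Ψ, ‖c‖⁻¹ • c) < 0 := hΨ _ (by simp [norm_smul, hcn.ne'])
  have h2 : F (Ψ, ‖c‖⁻¹ • c) = (‖c‖⁻¹) ^ 2 * F (Ψ, c) := by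
    have e : ∑ i, (‖c‖⁻¹ • c) i • Ψ i = ‖c‖⁻¹ • ∑ i, c i • Ψ i := by
      simp [Finset.smul_sum, mul_smul]
    simp only [F, e, Prod.smul_fst, Prod.smul_snd, norm_smul, mul_pow, norm_inv, norm_norm]
    ring
  rw [h2] at h1
  have h3 : F (Ψ, c) < 0 := by
    by_contra! hcon
    have : 0 ≤ (‖c‖⁻¹) ^ 2 * F (Ψ, c) := by positivity
    linarith
  simp only [F] at h3
  linarith

/-- The shift by `1` comes from the norm `‖u‖² + a[u]` on the form domain. -/
theorem FormDefect.finiteDefect {D : Submodule ℝ (H × H × H)} {Λ : ℝ} (h : FormDefect D Λ) :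
    FiniteDefect (formEmb D) (Λ + 1) := by
  obtain ⟨n, g, hg⟩ := h
  refine ⟨n, ((EuclideanSpace.equiv (Fin n) ℝ).symm : (Fin n → ℝ) →L[ℝ] _).comp
    (ContinuousLinearMap.pi fun i => (innerSL ℝ (g i)).comp (formEmb D)), fun w => ?_⟩
  have h1 := hg _ w.triple_mem
  rw [EuclideanSpace.real_norm_sq_eq, norm_sq_formDomain]
  simp only [formEmb_apply] at *
  simp
  simp only [formEmb_apply]
  linarith

theorem negFamily_formEmb {D : Submodule ℝ (H × H × H)} {k : ℕ} {s : ℝ} :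
    NegFamily (formEmb D) k (s + 1) ↔ NegTriples D k s := by
  constructor
  · rintro ⟨Φ, hΦ⟩
    refine ⟨fun i => (Φ i).triple, fun i => (Φ i).triple_mem, fun c hc => ?_⟩
    have h1 := hΦ c hc
    rw [norm_sq_formDomain, formEmb_apply, map_sum] at h1
    simp only [map_smul] at h1
    linarith
  · rintro ⟨Φ, hD, hΦ⟩
    refine ⟨fun i => FormDomain.mk ⟨Φ i, hD i⟩, fun c hc => ?_⟩
    have h1 := hΦ c hc
    rw [norm_sq_formDomain, formEmb_apply, map_sum]
    simp only [map_smul, FormDomain.triple_mk]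
    linarith

variable {A : H →ₗ.[ℝ] H} {D : Submodule ℝ (H × H × H)}

theorem mem_formGraph_iff {u f : H} : (u, f) ∈ formGraph D ↔
    ∃ w : FormDomain D, formEmb D w = u ∧
      ∀ w', inner ℝ w w' = inner ℝ (f + u) (formEmb D w') := by
  constructor
  · rintro ⟨a, b, hmem, hab⟩
    refine ⟨FormDomain.mk ⟨(u, a, b), hmem⟩, rfl, fun w' => ?_⟩
    have := hab _ _ _ w'.triple_mem
    rw [inner_formDomain, inner_add_left, FormDomain.triple_mk, formEmb_apply, add_comm]
    exact congrArg (· + _) this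
  · rintro ⟨w, rfl, hw⟩
    refine ⟨_, _, w.triple_mem, fun v c d hv => ?_⟩
    have := hw (FormDomain.mk ⟨(v, c, d), hv⟩)
    rw [inner_formDomain, inner_add_left, add_comm] at this
    exact add_right_cancel this

theorem eigenspace_eq_map (hA : A.graph = formGraph D) (t : ℝ) :
    eigenspace A t = (relEigenspace (formEmb D) (t + 1)).map (formEmb D : FormDomain D →ₗ[ℝ] H) := by
  ext u
  have : u ∈ eigenspace A t ↔ (u, t • u) ∈ A.graph := Iff.rfl
  rw [this, hA, mem_formGraph_iff, Submodule.mem_map]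
  constructor
  · rintro ⟨w, rfl, hw⟩
    refine ⟨w, fun w' => ?_, rfl⟩
    rw [hw, inner_add_left, real_inner_smul_left]
    ring
  · rintro ⟨w, hw, rfl⟩
    refine ⟨w, rfl, fun w' => ?_⟩
    rw [hw, inner_add_left, real_inner_smul_left]
    simp only [ContinuousLinearMap.coe_coe]
    ring

theorem eigenspace_eq_bot_iff (hA : A.graph = formGraph D) (t : ℝ) :
    eigenspace A t = ⊥ ↔ relEigenspace (formEmb D) (t + 1) = ⊥ := by
  rw [eigenspace_eq_map hA]
  constructor
  · intro h
    rw [Submodule.eq_bot_iff] at h ⊢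
    intro w hw
    have h0 := h _ (Submodule.mem_map_of_mem hw)
    exact J_ne_zero_of_mem_specSpan (mem_specSpan hw {t + 1} rfl) h0
  · intro h
    rw [h, Submodule.map_bot]

theorem eigenvalueCount_eq (hA : A.graph = formGraph D) (S : Set ℝ) :
    eigenvalueCount A S =
      Cardinal.toENat (Module.rank ℝ (specSpan (formEmb D) ((fun t => t + 1) '' S))) := by
  have h1 : (⨆ t ∈ S, eigenspace A t) =
      (specSpan (formEmb D) ((fun t => t + 1) '' S)).map (formEmb D : FormDomain D →ₗ[ℝ] H) := by
    rw [specSpan, iSup_image]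
    simp only [Submodule.map_iSup, eigenspace_eq_map hA]
  have hinj : Function.Injective
      ((formEmb D : FormDomain D →ₗ[ℝ] H).domRestrict
        (specSpan (formEmb D) ((fun t => t + 1) '' S))) := by
    rw [← LinearMap.ker_eq_bot, LinearMap.ker_eq_bot']
    rintro ⟨w, hw⟩ h0
    exact Subtype.ext (J_ne_zero_of_mem_specSpan hw h0)
  rw [eigenvalueCount, h1, ← LinearMap.range_domRestrict,
    (LinearEquiv.ofInjective _ hinj).rank_eq]

theorem eigenvalueCount_mono (A : H →ₗ.[ℝ] H) {S T : Set ℝ} (h : S ⊆ T) :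
    eigenvalueCount A S ≤ eigenvalueCount A T :=
  Cardinal.toENat.monotone' (Submodule.rank_mono (biSup_mono fun _ ht => h ht))

theorem mem_spec_of_eigenspace_ne_bot (A : H →ₗ.[ℝ] H) {t : ℝ} (h : eigenspace A t ≠ ⊥) :
    t ∈ spec A := by
  rintro ⟨R, -, hR⟩
  refine h ((Submodule.eq_bot_iff _).2 fun u hu => ?_)
  have hu' : (u, t • u) ∈ A.graph := hu
  obtain ⟨x, hx1, hx2⟩ := (LinearPMap.mem_graph_iff A).1 hu'
  have := hR x
  simp only at hx1 hx2
  rw [hx2, hx1, sub_self, map_zero] at this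
  exact this.symm

theorem IsNthEigenvalue.eigenspace_ne_bot {A : H →ₗ.[ℝ] H} {j : ℕ} {t : ℝ}
    (h : IsNthEigenvalue A j t) : eigenspace A t ≠ ⊥ := by
  intro hb
  have h1 : (⨆ s ∈ Set.Iic t, eigenspace A s) ≤ ⨆ s ∈ Set.Iio t, eigenspace A s := by
    refine iSup₂_le fun s hs => ?_
    rcases (Set.mem_Iic.1 hs).eq_or_lt with rfl | hlt
    · rw [hb]; exact bot_le
    · exact le_iSup₂_of_le (f := fun s (_ : s ∈ Set.Iio t) => eigenspace A s) s hlt le_rfl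
  have h2 : eigenvalueCount A (Set.Iic t) ≤ eigenvalueCount A (Set.Iio t) :=
    Cardinal.toENat.monotone' (Submodule.rank_mono h1)
  exact absurd (h.2.trans_le (h2.trans h.1)) (lt_irrefl _)

variable [CompleteSpace H]

theorem completeSpace_formDomain (hD : IsClosed (D : Set (H × H × H))) :
    CompleteSpace (FormDomain D) :=
  (isClosed_formSpace hD).completeSpace_coe

/-- Below the level `Λ` every point of the spectrum is an eigenvalue. -/
theorem mem_resolventSet_of_eigenspace_eq_bot (hA : A.graph = formGraph D)
    (hD : IsClosed (D : Set (H × H × H))) {Λ t : ℝ} (h : FormDefect D Λ) (ht : t < Λ)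
    (hE : eigenspace A t = ⊥) : t ∈ resolventSet A := by
  have := completeSpace_formDomain hD
  obtain ⟨R, hR⟩ := h.finiteDefect.exists_resolvent (σ := t + 1) (by linarith)
    ((eigenspace_eq_bot_iff hA t).1 hE)
  have hgraph : ∀ f, (formEmb D (R f), f + t • formEmb D (R f)) ∈ A.graph := by
    intro f
    rw [hA, mem_formGraph_iff]
    refine ⟨R f, rfl, fun w' => ?_⟩
    have := hR f w'
    rw [inner_add_left, inner_add_left, real_inner_smul_left]
    linarith
  refine ⟨(formEmb D).comp R, fun f => ?_, fun u => ?_⟩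
  · have hdom := LinearPMap.mem_domain_of_mem_graph (hgraph f)
    refine ⟨hdom, ?_⟩
    have h2 := (LinearPMap.image_iff hdom).2 (hgraph f)
    change A ⟨formEmb D (R f), hdom⟩ - t • formEmb D (R f) = f
    rw [← h2]
    simp
  · have h1 := A.graph.sub_mem (A.mem_graph u) (hgraph (A u - t • (u : H)))
    have h2 : (u : H) - formEmb D (R (A u - t • (u : H))) ∈ eigenspace A t := by
      change (_, t • ((u : H) - formEmb D (R (A u - t • (u : H))))) ∈ A.graph
      convert h1 using 2
      · rfl
      · rw [Prod.snd_sub, smul_sub]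
        simp only
        abel
    rw [hE, Submodule.mem_bot, sub_eq_zero] at h2
    exact h2.symm

/-- If a form is bounded below by `Λ` up to finitely many functionals, the spectrum of its operator
below `Λ` is discrete. -/
theorem le_essBottom (hA : A.graph = formGraph D) (hD : IsClosed (D : Set (H × H × H)))
    {Λ : ℝ} (h : FormDefect D Λ) : (Λ : EReal) ≤ essBottom A := by
  have := completeSpace_formDomain hD
  refine le_sInf ?_
  rintro _ ⟨t, ⟨ht, htd⟩, rfl⟩
  by_contra! hlt
  have hlt' : t < Λ := EReal.coe_lt_coe_iff.1 hlt
  have hspec : ∀ s < Λ, s ∈ spec A ↔ eigenspace A s ≠ ⊥ := fun s hs =>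
    ⟨fun h1 h2 => h1 (mem_resolventSet_of_eigenspace_eq_bot hA hD h hs h2),
      mem_spec_of_eigenspace_ne_bot A⟩
  have hfin : {s | s < Λ ∧ eigenspace A s ≠ ⊥}.Finite := by
    refine (h.finiteDefect.finite_eigenvalues.image fun σ => σ - 1).subset ?_
    rintro s ⟨hs, hs2⟩
    exact ⟨s + 1, ⟨by linarith, fun hb => hs2 ((eigenspace_eq_bot_iff hA s).2 hb)⟩, by simp⟩
  have hE : eigenspace A t ≠ ⊥ := (hspec t hlt').1 ht
  refine htd ⟨ht, ?_, hE, ?_⟩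
  · have hopen : IsOpen (({s | s < Λ ∧ eigenspace A s ≠ ⊥} \ {t})ᶜ ∩ Set.Iio Λ) :=
      (hfin.subset Set.sdiff_subset).isClosed.isOpen_compl.inter isOpen_Iio
    obtain ⟨r, hr, hsub⟩ := Metric.isOpen_iff.1 hopen t ⟨by simp, hlt'⟩
    refine ⟨r, hr, Set.Subset.antisymm ?_ ?_⟩
    · rintro s ⟨hs, hsr⟩
      obtain ⟨h1, h2⟩ := hsub hsr
      by_contra hne
      exact h1 ⟨⟨h2, (hspec s h2).1 hs⟩, hne⟩
    · rintro _ rfl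
      exact ⟨ht, Metric.mem_ball_self hr⟩
  · have : FiniteDimensional ℝ (relEigenspace (formEmb D) (t + 1)) := by
      have := h.finiteDefect.finiteDimensional_specSpan (S := {t + 1}) (by
        rintro _ rfl; linarith)
      exact Submodule.finiteDimensional_of_le
        (relEigenspace_le_specSpan (J := formEmb D) (Set.mem_singleton (t + 1)))
    rw [eigenspace_eq_map hA]
    infer_instance

/-- The min-max principle below the level `Λ`. -/
theorem exists_isNthEigenvalue (hA : A.graph = formGraph D) (hD : IsClosed (D : Set (H × H × H)))
    {Λ s₀ : ℝ} (h : FormDefect D Λ) (hs : s₀ < Λ) {j : ℕ} (hneg : NegTriples D (j + 1) s₀) :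
    ∃ t ≤ s₀, IsNthEigenvalue A j t ∧ (∀ s, t < s → NegTriples D (j + 1) s) ∧
      ∀ s, NegTriples D (j + 1) s → t ≤ s := by
  have := completeSpace_formDomain hD
  obtain ⟨σ, hσ, h1, h2, h3, h4⟩ := h.finiteDefect.exists_eigenvalue (s₀ := s₀ + 1)
    (by linarith) (negFamily_formEmb.2 hneg)
  have hIio : (fun t : ℝ => t + 1) '' Set.Iio (σ - 1) = Set.Iio σ := by
    simp
  have hIic : (fun t : ℝ => t + 1) '' Set.Iic (σ - 1) = Set.Iic σ := by
    simp
  refine ⟨σ - 1, by linarith, ⟨?_, ?_⟩, fun s hs => ?_, fun s hs => ?_⟩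
  · have : FiniteDimensional ℝ (specSpan (formEmb D) (Set.Iio σ)) :=
      h.finiteDefect.finiteDimensional_specSpan fun x hx => by
        rw [Set.mem_Iio] at hx; linarith
    rw [eigenvalueCount_eq hA, hIio, ← Module.finrank_eq_rank, Cardinal.toENat_nat]
    exact_mod_cast h3
  · have : FiniteDimensional ℝ (specSpan (formEmb D) (Set.Iic σ)) :=
      h.finiteDefect.finiteDimensional_specSpan fun x hx => by
        rw [Set.mem_Iic] at hx; linarith
    rw [eigenvalueCount_eq hA, hIic, ← Module.finrank_eq_rank, Cardinal.toENat_nat]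
    exact_mod_cast h4
  · exact negFamily_formEmb.1 (h1 (s + 1) (by linarith))
  · have := h2 _ (negFamily_formEmb.2 hs)
    linarith

end FormOperator

/-! ### Weak derivatives on the line -/

section Line

theorem exists_forall_abs_ge_eq_zero {f : ℝ → ℝ} (hf : HasCompactSupport f) :
    ∃ R > 0, ∀ x, R ≤ |x| → f x = 0 := by
  obtain ⟨R, hR, hsub⟩ := hf.isCompact.isBounded.subset_ball_lt 0 0
  refine ⟨R, hR, fun x hx => image_eq_zero_of_notMem_tsupport fun h => ?_⟩
  have := hsub h
  rw [mem_ball_zero_iff, Real.norm_eq_abs] at this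
  linarith

theorem integral_eq_intervalIntegral_of_abs_ge {f : ℝ → ℝ} {R : ℝ}
    (hf : ∀ x, R ≤ |x| → f x = 0) : ∫ x, f x = ∫ x in (-R)..R, f x := by
  refine (intervalIntegral.integral_eq_integral_of_support_subset fun x hx => ?_).symm
  have h : |x| < R := by
    by_contra! h
    exact hx (hf x h)
  exact ⟨(abs_lt.1 h).1, (abs_lt.1 h).2.le⟩

theorem hasCompactSupport_of_abs_ge {f : ℝ → ℝ} {R : ℝ} (hf : ∀ x, R ≤ |x| → f x = 0) :
    HasCompactSupport f := by
  refine HasCompactSupport.of_support_subset_isCompact (isCompact_Icc (a := -R) (b := R))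
    fun x hx => ?_
  have h : |x| < R := by
    by_contra! h
    exact hx (hf x h)
  exact ⟨(abs_lt.1 h).1.le, (abs_lt.1 h).2.le⟩

/-- A test function of vanishing integral is the derivative of a test function. -/
theorem exists_test_primitive {φ : ℝ → ℝ} (h1 : ContDiff ℝ ∞ φ) (h2 : HasCompactSupport φ)
    (h0 : ∫ x, φ x = 0) : ∃ Φ : ℝ → ℝ, ContDiff ℝ ∞ Φ ∧ HasCompactSupport Φ ∧ deriv Φ = φ := by
  obtain ⟨R, hR, hφ⟩ := exists_forall_abs_ge_eq_zero h2
  have hd : ∀ x, HasDerivAt (fun x => ∫ t in (-R)..x, φ t) (φ x) x := fun x =>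
    intervalIntegral.integral_hasDerivAt_right (h1.continuous.intervalIntegrable _ _)
      (h1.continuous.stronglyMeasurableAtFilter _ _) h1.continuous.continuousAt
  have hd' : deriv (fun x => ∫ t in (-R)..x, φ t) = φ := funext fun x => (hd x).deriv
  refine ⟨_, contDiff_infty_iff_deriv.2 ⟨fun x => (hd x).differentiableAt, by rwa [hd']⟩,
    hasCompactSupport_of_abs_ge (R := R) fun x hx => ?_, hd'⟩
  have hz : ∀ a b, (∀ t ∈ Set.uIcc a b, φ t = 0) → ∫ t in a..b, φ t = 0 := fun a b h => by
    rw [intervalIntegral.integral_congr (g := fun _ => 0) h]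
    simp
  rcases le_abs.1 hx with h | h
  · rw [← intervalIntegral.integral_add_adjacent_intervals
      (h1.continuous.intervalIntegrable (-R) R) (h1.continuous.intervalIntegrable R x),
      ← integral_eq_intervalIntegral_of_abs_ge hφ, h0, hz, add_zero]
    intro t ht
    rw [Set.uIcc_of_le h] at ht
    exact hφ t (ht.1.trans (le_abs_self _))
  · refine hz _ _ fun t ht => hφ t ?_
    rw [Set.uIcc_of_ge (by linarith)] at ht
    exact le_abs.2 (Or.inr (by linarith [ht.2]))

/-- Integration by parts for the primitive of a locally integrable function. -/
theorem hasWeakDeriv_primitive {f : ℝ → ℝ} (hf : LocallyIntegrable f volume) :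
    HasWeakDeriv (fun x => ∫ t in (0 : ℝ)..x, f t) f := by
  intro φ h1 h2
  obtain ⟨R₁, hR₁, hφ₁⟩ := exists_forall_abs_ge_eq_zero h2
  obtain ⟨R₂, hR₂, hφ₂⟩ := exists_forall_abs_ge_eq_zero h2.deriv
  set R := max R₁ R₂
  have hR : 0 < R := lt_max_of_lt_left hR₁
  have hφ : ∀ x, R ≤ |x| → φ x = 0 := fun x hx => hφ₁ x ((le_max_left _ _).trans hx)
  have hd : ∀ x, R ≤ |x| → deriv φ x = 0 := fun x hx => hφ₂ x ((le_max_right _ _).trans hx)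
  have hii : ∀ a b, IntervalIntegrable f volume a b := fun a b =>
    intervalIntegrable_iff.mpr
      ((hf.integrableOn_isCompact isCompact_uIcc).mono_set Set.uIoc_subset_uIcc)
  have hF := (hii (-R) R).absolutelyContinuousOnInterval_intervalIntegral (c := 0)
    (by rw [Set.uIcc_of_le (by linarith)]; constructor <;> linarith)
  have hφac : AbsolutelyContinuousOnInterval φ (-R) R :=
    ContDiffOn.absolutelyContinuousOnInterval ((h1.of_le (by simp)).contDiffOn)
  have key := hF.integral_mul_deriv_eq_deriv_mul hφac
  rw [hφ R (le_abs_self R), hφ (-R) (by rw [abs_neg]; exact le_abs_self R)] at key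
  simp only [mul_zero, sub_zero, zero_sub] at key
  rw [integral_eq_intervalIntegral_of_abs_ge (R := R) (fun x hx => by rw [hd x hx, mul_zero]), key,
    integral_eq_intervalIntegral_of_abs_ge (R := R) (fun x hx => by rw [hφ x hx, mul_zero])]
  congr 1
  refine intervalIntegral.integral_congr_ae ?_
  filter_upwards [_root_.LocallyIntegrable.ae_hasDerivAt_integral hf] with x hx _
  rw [(hx 0).deriv]

/-- A function with vanishing weak derivative is constant. -/
theorem ae_eq_const_of_hasWeakDeriv_zero {v : ℝ → ℝ} (hv : LocallyIntegrable v volume)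
    (h : HasWeakDeriv v (fun _ => 0)) : ∃ c, ∀ᵐ x, v x = c := by
  obtain ⟨ρ, hρ1, hρ2, hρ3⟩ : ∃ ρ : ℝ → ℝ, ContDiff ℝ ∞ ρ ∧ HasCompactSupport ρ ∧ ∫ x, ρ x = 1 := by
    let b : ContDiffBump (0 : ℝ) := default
    exact ⟨b.normed volume, b.contDiff_normed, b.hasCompactSupport_normed, b.integral_normed⟩
  refine ⟨∫ x, v x * ρ x, ?_⟩
  set c := ∫ x, v x * ρ x with hc
  refine ae_eq_of_integral_contDiff_smul_eq hv (locallyIntegrable_const c) fun η h1 h2 => ?_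
  have hint : ∀ g : ℝ → ℝ, ContDiff ℝ ∞ g → HasCompactSupport g → Integrable (fun x => v x * g x) :=
    fun g g1 g2 => by
      simpa [mul_comm] using hv.integrable_smul_left_of_hasCompactSupport g1.continuous g2
  have hi : ∀ g : ℝ → ℝ, ContDiff ℝ ∞ g → HasCompactSupport g → Integrable g :=
    fun g g1 g2 => g1.continuous.integrable_of_hasCompactSupport g2
  set I := ∫ x, η x with hI
  obtain ⟨Φ, k1, k2, k3⟩ := exists_test_primitive (φ := fun x => η x - I * ρ x)
    (h1.sub (contDiff_const.mul hρ1)) (h2.sub (hρ2.mul_left (f := fun _ => I))) (by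
      rw [integral_sub (hi _ h1 h2) ((hi _ hρ1 hρ2).const_mul I), integral_const_mul, hρ3]
      simp [hI])
  have := h Φ k1 k2
  rw [k3] at this
  simp only [zero_mul, integral_zero, neg_zero] at this
  have e : ∫ x, v x * (η x - I * ρ x) = (∫ x, v x * η x) - I * c := by
    rw [hc, ← integral_const_mul, ← integral_sub (hint _ h1 h2) ((hint _ hρ1 hρ2).const_mul I)]
    congr 1
    ext x
    ring
  rw [e] at this
  simp only [smul_eq_mul, integral_mul_const]
  rw [← hI]
  have e2 : ∫ x, η x * v x = ∫ x, v x * η x := by simp only [mul_comm]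
  rw [e2]
  linarith

/-- A locally integrable function is a primitive of its weak derivative. -/
theorem HasWeakDeriv.ae_eq_primitive {v f : ℝ → ℝ} (hv : LocallyIntegrable v volume)
    (hf : LocallyIntegrable f volume) (h : HasWeakDeriv v f) :
    ∃ c, ∀ᵐ x, v x = c + ∫ t in (0 : ℝ)..x, f t := by
  have hii : ∀ a b, IntervalIntegrable f volume a b := fun a b =>
    intervalIntegrable_iff.mpr
      ((hf.integrableOn_isCompact isCompact_uIcc).mono_set Set.uIoc_subset_uIcc)
  have hcont : Continuous fun x => ∫ t in (0 : ℝ)..x, f t :=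
    intervalIntegral.continuous_primitive hii 0
  have hF := hasWeakDeriv_primitive hf
  obtain ⟨c, hc⟩ := ae_eq_const_of_hasWeakDeriv_zero (v := fun x => v x - ∫ t in (0 : ℝ)..x, f t)
    (hv.sub hcont.locallyIntegrable) (by
      intro φ h1 h2
      have hd : Continuous (deriv φ) := h1.continuous_deriv (by simp)
      have e1 : Integrable fun x => v x * deriv φ x := by
        simpa [mul_comm] using hv.integrable_smul_left_of_hasCompactSupport hd h2.deriv
      have e2 : Integrable fun x => (∫ t in (0 : ℝ)..x, f t) * deriv φ x :=
        (hcont.mul hd).integrable_of_hasCompactSupport h2.deriv.mul_left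
      simp only [sub_mul]
      rw [integral_sub e1 e2, h φ h1 h2, hF φ h1 h2]
      simp)
  exact ⟨c, hc.mono fun x hx => by linarith⟩

/-- A monotone function with `F x ≠ 0` stays away from `0` on a half-line. -/
theorem eq_zero_of_monotone_integrable {F : ℝ → ℝ} (hm : Monotone F) (hi : Integrable F) (x : ℝ) :
    F x = 0 := by
  have key : ∀ s : Set ℝ, MeasurableSet s → volume s = ⊤ → ∀ c > 0, (∀ y ∈ s, c ≤ |F y|) → False := by
    intro s hs hvol c hc h
    have h1 : Integrable (s.indicator fun _ => c) := by
      refine hi.mono (measurable_const.indicator hs).aestronglyMeasurable (ae_of_all _ fun y => ?_)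
      by_cases hy : y ∈ s
      · rw [Set.indicator_of_mem hy, Real.norm_eq_abs, Real.norm_eq_abs, abs_of_pos hc]
        exact h y hy
      · rw [Set.indicator_of_notMem hy, norm_zero]
        exact norm_nonneg _
    rw [integrable_indicator_iff hs, integrableOn_const_iff, hvol] at h1
    simp [hc.ne'] at h1
  rcases lt_trichotomy (F x) 0 with h | h | h
  · exact (key (Set.Iic x) measurableSet_Iic Real.volume_Iic (-F x) (by linarith) fun y hy => by
      have := hm (Set.mem_Iic.1 hy)
      exact (by linarith : -F x ≤ -F y).trans (neg_le_abs _)).elim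
  · exact h
  · exact (key (Set.Ici x) measurableSet_Ici Real.volume_Ici (F x) h fun y hy =>
      (hm (Set.mem_Ici.1 hy)).trans (le_abs_self _)).elim

/-- An `H¹` solution of `u'' = p u` with `p > 0` vanishes, as `(u²)' / 2 = u u'` is monotone and
integrable. -/
theorem ae_eq_zero_of_weak_ode {u v p : ℝ → ℝ} (hu : MemLp u 2 volume) (hv : MemLp v 2 volume)
    (hp : Continuous p) (hp0 : ∀ x, 0 < p x) (h1 : HasWeakDeriv u v)
    (h2 : HasWeakDeriv v (fun x => p x * u x)) : ∀ᵐ x, u x = 0 := by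
  have hul : LocallyIntegrable u volume := hu.locallyIntegrable (by norm_num)
  have hvl : LocallyIntegrable v volume := hv.locallyIntegrable (by norm_num)
  have hpu : LocallyIntegrable (fun x => p x * u x) volume := hul.continuous_mul hp
  obtain ⟨c, hc⟩ := h1.ae_eq_primitive hul hvl
  obtain ⟨d, hd⟩ := h2.ae_eq_primitive hvl hpu
  have hii : ∀ {f : ℝ → ℝ} (_ : LocallyIntegrable f volume) (a b), IntervalIntegrable f volume a b :=
    fun hf a b => intervalIntegrable_iff.mpr
      ((hf.integrableOn_isCompact isCompact_uIcc).mono_set Set.uIoc_subset_uIcc)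
  set U : ℝ → ℝ := fun x => c + ∫ t in (0 : ℝ)..x, v t with hU
  set V : ℝ → ℝ := fun x => d + ∫ t in (0 : ℝ)..x, p t * u t with hV
  have hUc : Continuous U := continuous_const.add (intervalIntegral.continuous_primitive (hii hvl) 0)
  have hVc : Continuous V := continuous_const.add (intervalIntegral.continuous_primitive (hii hpu) 0)
  have hU' : ∀ x, HasDerivAt U (V x) x := by
    intro x
    have : U = fun x => c + ∫ t in (0 : ℝ)..x, V t := by
      ext x
      simp only [hU]
      congr 1
      exact intervalIntegral.integral_congr_ae (hd.mono fun t ht _ => ht)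
    rw [this]
    exact (intervalIntegral.integral_hasDerivAt_right (hVc.intervalIntegrable _ _)
      (hVc.stronglyMeasurableAtFilter _ _) hVc.continuousAt).const_add c
  have hV' : ∀ x, HasDerivAt V (p x * U x) x := by
    intro x
    have hpU := hp.mul hUc
    have : V = fun x => d + ∫ t in (0 : ℝ)..x, p t * U t := by
      ext x
      simp only [hV]
      congr 1
      exact intervalIntegral.integral_congr_ae (hc.mono fun t ht _ => by rw [ht])
    rw [this]
    exact (intervalIntegral.integral_hasDerivAt_right (hpU.intervalIntegrable _ _)
      (hpU.stronglyMeasurableAtFilter _ _) hpU.continuousAt).const_add d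
  have hUV : ∀ x, HasDerivAt (fun x => U x * V x) (V x * V x + U x * (p x * U x)) x :=
    fun x => (hU' x).mul (hV' x)
  have hmono : Monotone fun x => U x * V x := by
    refine monotone_of_deriv_nonneg (fun x => (hUV x).differentiableAt) fun x => ?_
    rw [(hUV x).deriv]
    nlinarith [mul_self_nonneg (V x), mul_nonneg (hp0 x).le (mul_self_nonneg (U x))]
  have hint : Integrable fun x => U x * V x := by
    have := MemLp.integrable_mul (p := 2) (q := 2) (hu.ae_eq hc) (hv.ae_eq hd)
    exact this
  have hz := eq_zero_of_monotone_integrable hmono hint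
  filter_upwards [hc] with x hx
  rw [hx]
  have h0 : V x * V x + U x * (p x * U x) = 0 := by
    rw [← (hUV x).deriv, show (fun x => U x * V x) = fun _ => 0 from funext hz]
    simp
  have h3 : p x * (U x * U x) = 0 := by
    nlinarith [mul_self_nonneg (V x), mul_nonneg (hp0 x).le (mul_self_nonneg (U x))]
  have := (mul_eq_zero.1 h3).resolve_left (hp0 x).ne'
  exact mul_self_eq_zero.1 this

end Line

/-! ### Inner products in `L²` and density in a form domain -/

section L2

variable {X : Type*} [MeasurableSpace X] {μ : Measure X}

theorem inner_Lp_eq_integral {f g : Lp ℝ 2 μ} {φ ψ : X → ℝ} (hf : f =ᵐ[μ] φ) (hg : g =ᵐ[μ] ψ) :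
    inner ℝ f g = ∫ x, φ x * ψ x ∂μ := by
  rw [L2.inner_def]
  refine integral_congr_ae ?_
  filter_upwards [hf, hg] with x h1 h2
  rw [h1, h2]
  simp [mul_comm]

theorem norm_sq_Lp_eq_integral {f : Lp ℝ 2 μ} {φ : X → ℝ} (hf : f =ᵐ[μ] φ) :
    ‖f‖ ^ 2 = ∫ x, φ x ^ 2 ∂μ := by
  rw [← real_inner_self_eq_norm_sq, inner_Lp_eq_integral hf hf]
  simp only [sq]

end L2

/-- A subspace of a closed form domain is dense if its orthogonal complement for the form scalar
product is trivial. -/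
theorem le_topologicalClosure_of_orthogonal {H : Type*} [NormedAddCommGroup H]
    [InnerProductSpace ℝ H] [CompleteSpace H] {D D₀ : Submodule ℝ (H × H × H)} (h₀ : D₀ ≤ D)
    (hD : IsClosed (D : Set (H × H × H)))
    (h : ∀ w ∈ D, (∀ v ∈ D₀, inner ℝ w.1 v.1 + (inner ℝ w.2.1 v.2.1 + inner ℝ w.2.2 v.2.2) = 0) →
      w = 0) : D ≤ D₀.topologicalClosure := by
  intro w hw
  set P := D₀.topologicalClosure with hP
  have hPD : P ≤ D := Submodule.topologicalClosure_minimal _ h₀ hD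
  have : CompleteSpace (formSpace P) :=
    (isClosed_formSpace D₀.isClosed_topologicalClosure).completeSpace_coe
  let w' : TripleSpace H := WithLp.toLp 2 (w.1, WithLp.toLp 2 w.2)
  obtain ⟨p, hp, r, hr, hpr⟩ := (formSpace P).exists_add_mem_mem_orthogonal w'
  have hpP : (p.fst, p.snd.fst, p.snd.snd) ∈ P := hp
  have hrD : (r.fst, r.snd.fst, r.snd.snd) ∈ D := by
    have e : (r.fst, r.snd.fst, r.snd.snd) = w - (p.fst, p.snd.fst, p.snd.snd) := by
      have : r = w' - p := by rw [hpr]; simp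
      rw [this]
      rfl
    rw [e]
    exact D.sub_mem hw (hPD hpP)
  have hr0 := h _ hrD fun v hv => by
    have hvP : (WithLp.toLp 2 (v.1, WithLp.toLp 2 v.2) : TripleSpace H) ∈ formSpace P :=
      D₀.le_topologicalClosure hv
    have := (Submodule.mem_orthogonal' _ _).1 hr _ hvP
    rw [WithLp.prod_inner_apply, WithLp.prod_inner_apply] at this
    exact this
  have e : w = (p.fst, p.snd.fst, p.snd.snd) + (r.fst, r.snd.fst, r.snd.snd) := by
    have : (w'.fst, w'.snd.fst, w'.snd.snd) = w := rfl
    rw [← this, hpr]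
    rfl
  rw [e, hr0, add_zero]
  exact hpP

/-! ### A form core for Schrödinger operators -/

section Core

theorem deriv_integrable_parts {u η : ℝ → ℝ} (hu : ContDiff ℝ 1 u) (hη : ContDiff ℝ 1 η)
    (hη2 : HasCompactSupport η) : ∫ x, u x * deriv η x = - ∫ x, deriv u x * η x := by
  have hd : Continuous (deriv u) := hu.continuous_deriv le_rfl
  have hdη : Continuous (deriv η) := hη.continuous_deriv le_rfl
  refine integral_mul_deriv_eq_deriv_mul_of_integrable
    (fun x _ => (hu.differentiable one_ne_zero x).hasDerivAt)
    (fun x _ => (hη.differentiable one_ne_zero x).hasDerivAt) ?_ ?_ ?_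
  · exact (hu.continuous.mul hdη).integrable_of_hasCompactSupport hη2.deriv.mul_left
  · exact (hd.mul hη.continuous).integrable_of_hasCompactSupport hη2.mul_left
  · exact (hu.continuous.mul hη.continuous).integrable_of_hasCompactSupport hη2.mul_left

theorem mem_schrodingerForm_of_contDiff {q u : ℝ → ℝ}
    (hu : ContDiff ℝ 1 u) {w : Lp ℝ 2 (volume : Measure ℝ) × Lp ℝ 2 (volume : Measure ℝ) ×
      Lp ℝ 2 (volume : Measure ℝ)} (h1 : w.1 =ᵐ[volume] u) (h2 : w.2.1 =ᵐ[volume] deriv u)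
    (h3 : w.2.2 =ᵐ[volume] fun x => √(q x) * u x) : w ∈ schrodingerForm q := by
  refine ⟨fun η c s => ?_, ?_⟩
  · have e1 : ∫ x, w.1 x * deriv η x = ∫ x, u x * deriv η x := by
      refine integral_congr_ae ?_
      filter_upwards [h1] with x hx
      rw [hx]
    have e2 : ∫ x, w.2.1 x * η x = ∫ x, deriv u x * η x := by
      refine integral_congr_ae ?_
      filter_upwards [h2] with x hx
      rw [hx]
    rw [e1, e2]
    exact deriv_integrable_parts hu (c.of_le (by simp)) s
  · filter_upwards [h3, h1] with x hx hx0
    rw [hx, hx0]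

/-- The triples `(φ, φ', √q φ)` with `φ ∈ C_c^∞`. -/
def schrodingerCore (q : ℝ → ℝ) : Submodule ℝ
    (Lp ℝ 2 (volume : Measure ℝ) × Lp ℝ 2 (volume : Measure ℝ) × Lp ℝ 2 (volume : Measure ℝ)) where
  carrier := {w | ∃ φ : ℝ → ℝ, ContDiff ℝ ∞ φ ∧ HasCompactSupport φ ∧
    w.1 =ᵐ[volume] φ ∧ w.2.1 =ᵐ[volume] deriv φ ∧ w.2.2 =ᵐ[volume] fun x => √(q x) * φ x}
  zero_mem' := by
    refine ⟨0, contDiff_const, HasCompactSupport.zero, Lp.coeFn_zero _ _ _, ?_, ?_⟩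
    · filter_upwards [Lp.coeFn_zero ℝ 2 (volume : Measure ℝ)] with p hp
      exact hp.trans (by simp)
    · filter_upwards [Lp.coeFn_zero ℝ 2 (volume : Measure ℝ)] with p hp
      exact hp.trans (by simp)
  add_mem' := by
    rintro w w' ⟨φ, h1, h2, h4, h5, h6⟩ ⟨φ', k1, k2, k4, k5, k6⟩
    refine ⟨φ + φ', h1.add k1, h2.add k2, ?_, ?_, ?_⟩
    · filter_upwards [Lp.coeFn_add w.1 w'.1, h4, k4] with p hp hp1 hp2
      simp only [Prod.fst_add, hp, Pi.add_apply, hp1, hp2]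
    · filter_upwards [Lp.coeFn_add w.2.1 w'.2.1, h5, k5] with p hp hp1 hp2
      rw [deriv_add (h1.differentiable (by simp) p) (k1.differentiable (by simp) p)]
      simp only [Prod.fst_add, Prod.snd_add, hp, Pi.add_apply, hp1, hp2]
    · filter_upwards [Lp.coeFn_add w.2.2 w'.2.2, h6, k6] with p hp hp1 hp2
      simp only [Prod.snd_add, hp, Pi.add_apply, hp1, hp2, mul_add]
  smul_mem' := by
    rintro r w ⟨φ, h1, h2, h4, h5, h6⟩
    refine ⟨r • φ, h1.const_smul r, h2.smul_left (f := fun _ => r), ?_, ?_, ?_⟩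
    · filter_upwards [Lp.coeFn_smul r w.1, h4] with p hp hp1
      simp [hp, hp1]
    · filter_upwards [Lp.coeFn_smul r w.2.1, h5] with p hp hp1
      rw [deriv_const_smul r (h1.differentiable (by simp) p)]
      simp [hp, hp1]
    · filter_upwards [Lp.coeFn_smul r w.2.2, h6] with p hp hp1
      simp [hp, hp1, mul_left_comm]

theorem schrodingerCore_le (q : ℝ → ℝ) : schrodingerCore q ≤ schrodingerForm q := by
  rintro w ⟨φ, h1, -, h3, h4, h5⟩
  exact mem_schrodingerForm_of_contDiff (h1.of_le (by simp)) h3 h4 h5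

theorem exists_mem_schrodingerCore {q : ℝ → ℝ} (hq : Continuous q) {φ : ℝ → ℝ}
    (h1 : ContDiff ℝ ∞ φ) (h2 : HasCompactSupport φ) : ∃ w ∈ schrodingerCore q,
      w.1 =ᵐ[volume] φ ∧ w.2.1 =ᵐ[volume] deriv φ ∧ w.2.2 =ᵐ[volume] fun x => √(q x) * φ x := by
  have hd : Continuous (deriv φ) := h1.continuous_deriv (by simp)
  have m0 : MemLp φ 2 (volume : Measure ℝ) := h1.continuous.memLp_of_hasCompactSupport h2
  have m1 : MemLp (deriv φ) 2 (volume : Measure ℝ) := hd.memLp_of_hasCompactSupport h2.deriv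
  have m2 : MemLp (fun x => √(q x) * φ x) 2 (volume : Measure ℝ) :=
    (hq.sqrt.mul h1.continuous).memLp_of_hasCompactSupport h2.mul_left
  exact ⟨(m0.toLp, m1.toLp, m2.toLp), ⟨φ, h1, h2, m0.coeFn_toLp, m1.coeFn_toLp, m2.coeFn_toLp⟩,
    m0.coeFn_toLp, m1.coeFn_toLp, m2.coeFn_toLp⟩

theorem isClosed_schrodingerForm {q : ℝ → ℝ} (hq : Continuous q) :
    IsClosed (schrodingerForm q : Set (Lp ℝ 2 (volume : Measure ℝ) ×
      Lp ℝ 2 (volume : Measure ℝ) × Lp ℝ 2 (volume : Measure ℝ))) := by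
  have hcont : ∀ {f : ℝ → ℝ} (hf : MemLp f 2 (volume : Measure ℝ)),
      (Continuous fun u : Lp ℝ 2 (volume : Measure ℝ) => ∫ x, u x * f x) := by
    intro f hf
    have : (fun u : Lp ℝ 2 (volume : Measure ℝ) => ∫ x, u x * f x) =
        fun u => inner ℝ u (hf.toLp f) := by
      ext u
      rw [inner_Lp_eq_integral (Filter.EventuallyEq.refl _ _) hf.coeFn_toLp]
    rw [this]
    exact continuous_id.inner continuous_const
  have hset : (schrodingerForm q : Set (Lp ℝ 2 (volume : Measure ℝ) ×
      Lp ℝ 2 (volume : Measure ℝ) × Lp ℝ 2 (volume : Measure ℝ))) =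
      {w | ∀ φ : ℝ → ℝ, ContDiff ℝ ∞ φ → HasCompactSupport φ →
        (∫ x, w.1 x * deriv φ x = - ∫ x, w.2.1 x * φ x) ∧
        ∫ x, w.2.2 x * φ x = ∫ x, w.1 x * (√(q x) * φ x)} := by
    ext w
    constructor
    · rintro ⟨h1, h2⟩ φ c s
      refine ⟨h1 φ c s, integral_congr_ae ?_⟩
      filter_upwards [h2] with x hx
      rw [hx]
      ring
    · intro h
      refine ⟨fun φ c s => (h φ c s).1, ?_⟩
      refine ae_eq_of_integral_contDiff_smul_eq ((Lp.memLp w.2.2).locallyIntegrable (by norm_num))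
        (((Lp.memLp w.1).locallyIntegrable (by norm_num)).continuous_mul hq.sqrt) fun φ c s => ?_
      have := (h φ c s).2
      simp only [smul_eq_mul]
      simp only [mul_comm] at this ⊢
      rw [this]
      congr 1
      ext x
      ring
  rw [hset]
  simp only [Set.ofPred_forall]
  refine isClosed_iInter fun φ => isClosed_iInter fun c => isClosed_iInter fun s => ?_
  have hd : Continuous (deriv φ) := c.continuous_deriv (by simp)
  have m0 : MemLp φ 2 (volume : Measure ℝ) := c.continuous.memLp_of_hasCompactSupport s
  have m1 : MemLp (deriv φ) 2 (volume : Measure ℝ) := hd.memLp_of_hasCompactSupport s.deriv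
  have m2 : MemLp (fun x => √(q x) * φ x) 2 (volume : Measure ℝ) :=
    (hq.sqrt.mul c.continuous).memLp_of_hasCompactSupport s.mul_left
  exact (isClosed_eq ((hcont m1).comp continuous_fst)
      ((hcont m0).comp (continuous_fst.comp continuous_snd)).neg).inter
    (isClosed_eq ((hcont m0).comp (continuous_snd.comp continuous_snd))
      ((hcont m2).comp continuous_fst))

/-- Test functions form a core: a function orthogonal to all of them for the form scalar product
solves `u'' = (1 + q) u` weakly, hence vanishes. -/
theorem schrodingerForm_le_closure_core {q : ℝ → ℝ} (hq : Continuous q) (hq0 : ∀ x, 0 ≤ q x) :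
    schrodingerForm q ≤ (schrodingerCore q).topologicalClosure := by
  refine le_topologicalClosure_of_orthogonal (schrodingerCore_le q) (isClosed_schrodingerForm hq)
    fun w hw horth => ?_
  have hu := Lp.memLp w.1
  have hv := Lp.memLp w.2.1
  have h0 : ∀ᵐ x, w.1 x = 0 := by
    refine ae_eq_zero_of_weak_ode (p := fun x => 1 + q x) hu hv (by fun_prop)
      (fun x => by have := hq0 x; linarith) hw.1 fun φ c s => ?_
    obtain ⟨v, hv, e1, e2, e3⟩ := exists_mem_schrodingerCore hq c s
    have := horth v hv
    rw [inner_Lp_eq_integral (Filter.EventuallyEq.refl _ _) e1,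
      inner_Lp_eq_integral (Filter.EventuallyEq.refl _ _) e2, inner_Lp_eq_integral hw.2 e3] at this
    have i1 : Integrable fun x => w.1 x * φ x := integrable_mul_test _ c.continuous s
    have i2 : Integrable fun x => √(q x) * w.1 x * (√(q x) * φ x) := by
      have := integrable_mul_test w.1 (φ := fun x => q x * φ x) (hq.mul c.continuous) s.mul_left
      refine this.congr (ae_of_all _ fun x => ?_)
      have := Real.mul_self_sqrt (hq0 x)
      simp only
      calc w.1 x * (q x * φ x) = w.1 x * ((√(q x) * √(q x)) * φ x) := by rw [this]
        _ = _ := by ring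
    have e : ∫ x, (1 + q x) * w.1 x * φ x =
        (∫ x, w.1 x * φ x) + ∫ x, √(q x) * w.1 x * (√(q x) * φ x) := by
      rw [← integral_add i1 i2]
      congr 1
      ext x
      have := Real.mul_self_sqrt (hq0 x)
      calc (1 + q x) * w.1 x * φ x = (1 + √(q x) * √(q x)) * w.1 x * φ x := by rw [this]
        _ = _ := by ring
    rw [e]
    linarith
  have z1 : w.1 = 0 := (Lp.eq_zero_iff_ae_eq_zero).2 h0
  have z3 : w.2.2 = 0 := by
    refine (Lp.eq_zero_iff_ae_eq_zero).2 ?_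
    filter_upwards [hw.2, h0] with x hx hx0
    rw [hx, hx0, mul_zero]
    rfl
  have z2 : w.2.1 = 0 := by
    refine (Lp.eq_zero_iff_ae_eq_zero).2 ?_
    refine ae_eq_zero_of_integral_contDiff_smul_eq_zero (hv.locallyIntegrable (by norm_num))
      fun φ c s => ?_
    have := hw.1 φ c s
    rw [integral_congr_ae (g := fun _ => 0) (by
      filter_upwards [h0] with x hx
      rw [hx, zero_mul])] at this
    simp only [integral_zero, smul_eq_mul] at this ⊢
    simp only [mul_comm (φ _)]
    linarith
  exact Prod.ext z1 (Prod.ext z2 z3)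

end Core

/-! ### Averages over small intervals -/

section Poincare

theorem sq_intervalIntegral_le {f : ℝ → ℝ} (hf : Continuous f) {a b : ℝ} (hab : a ≤ b) :
    (∫ x in a..b, f x) ^ 2 ≤ (b - a) * ∫ x in a..b, f x ^ 2 := by
  rcases hab.eq_or_lt with rfl | hlt
  · simp
  set m := ∫ x in a..b, f x with hm
  have h1 : 0 ≤ ∫ x in a..b, ((b - a) * f x - m) ^ 2 :=
    intervalIntegral.integral_nonneg hab fun x _ => sq_nonneg _
  have e : ∫ x in a..b, ((b - a) * f x - m) ^ 2 =
      (b - a) ^ 2 * (∫ x in a..b, f x ^ 2) - 2 * (b - a) * m * m + (b - a) * m ^ 2 := by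
    have : ∀ x, ((b - a) * f x - m) ^ 2 =
        (b - a) ^ 2 * f x ^ 2 - 2 * (b - a) * m * f x + m ^ 2 := fun x => by ring
    simp only [this]
    rw [intervalIntegral.integral_add, intervalIntegral.integral_sub,
      intervalIntegral.integral_const_mul, intervalIntegral.integral_const_mul,
      intervalIntegral.integral_const, smul_eq_mul]
    all_goals exact Continuous.intervalIntegrable (by fun_prop) _ _
  rw [e] at h1
  have hp : 0 < b - a := by linarith
  have h2 : 0 ≤ (b - a) * ((b - a) * (∫ x in a..b, f x ^ 2) - m ^ 2) := by nlinarith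
  have := nonneg_of_mul_nonneg_right h2 hp
  linarith

/-- The Poincaré inequality on an interval, with the mean value moved to the right-hand side. -/
theorem poincare_interval {u : ℝ → ℝ} (hu : ContDiff ℝ 1 u) {a b : ℝ} (hab : a < b) :
    ∫ x in a..b, u x ^ 2 ≤
      (b - a) ^ 2 * (∫ x in a..b, deriv u x ^ 2) + (b - a)⁻¹ * (∫ x in a..b, u x) ^ 2 := by
  have hd : Continuous (deriv u) := hu.continuous_deriv le_rfl
  have hp : 0 < b - a := by linarith
  set m := ∫ x in a..b, u x with hm
  set B := ∫ x in a..b, |deriv u x| with hB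
  have hosc : ∀ x ∈ Set.Icc a b, ∀ y ∈ Set.Icc a b, |u x - u y| ≤ B := by
    intro x hx y hy
    have e : u x - u y = ∫ t in y..x, deriv u t :=
      (intervalIntegral.integral_deriv_eq_sub
        (fun t _ => hu.differentiable one_ne_zero t) (hd.intervalIntegrable _ _)).symm
    rw [e]
    refine (intervalIntegral.norm_integral_le_integral_norm_uIoc (f := deriv u)).trans ?_
    rw [hB, intervalIntegral.integral_of_le hab.le]
    refine setIntegral_mono_set ?_ (ae_of_all _ fun t => abs_nonneg _) ?_
    · exact (hd.abs.integrableOn_Icc).mono_set Set.Ioc_subset_Icc_self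
    · refine LE.le.eventuallyLE fun t ht => ?_
      rw [Set.mem_uIoc] at ht
      rcases ht with ht | ht
      · exact ⟨lt_of_le_of_lt hy.1 ht.1, ht.2.trans hx.2⟩
      · exact ⟨lt_of_le_of_lt hx.1 ht.1, ht.2.trans hy.2⟩
  have hdev : ∀ x ∈ Set.Icc a b, ((b - a) * u x - m) ^ 2 ≤ (B * (b - a)) ^ 2 := by
    intro x hx
    have e : (b - a) * u x - m = ∫ y in a..b, (u x - u y) := by
      rw [intervalIntegral.integral_sub (Continuous.intervalIntegrable (by fun_prop) _ _)
        (hu.continuous.intervalIntegrable _ _)]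
      simp [hm]
    have := intervalIntegral.norm_integral_le_of_norm_le_const (a := a) (b := b) (C := B)
      (f := fun y => u x - u y) fun y hy => by
        rw [Set.uIoc_of_le hab.le] at hy
        exact hosc x hx y ⟨hy.1.le, hy.2⟩
    rw [← e, abs_of_pos hp, Real.norm_eq_abs] at this
    exact sq_le_sq' (abs_le.1 this).1 (abs_le.1 this).2
  have h1 : ∫ x in a..b, ((b - a) * u x - m) ^ 2 ≤ (b - a) * (B * (b - a)) ^ 2 := by
    have := intervalIntegral.integral_mono_on (μ := volume) hab.le
      (Continuous.intervalIntegrable (u := fun x => ((b - a) * u x - m) ^ 2)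
        (by have := hu.continuous; fun_prop) _ _)
      (continuous_const.intervalIntegrable a b) hdev
    simpa using this
  have e : ∫ x in a..b, ((b - a) * u x - m) ^ 2 =
      (b - a) ^ 2 * (∫ x in a..b, u x ^ 2) - 2 * (b - a) * m * m + (b - a) * m ^ 2 := by
    have : ∀ x, ((b - a) * u x - m) ^ 2 =
        (b - a) ^ 2 * u x ^ 2 - 2 * (b - a) * m * u x + m ^ 2 := fun x => by ring
    simp only [this]
    have := hu.continuous
    rw [intervalIntegral.integral_add, intervalIntegral.integral_sub,
      intervalIntegral.integral_const_mul, intervalIntegral.integral_const_mul,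
      intervalIntegral.integral_const, smul_eq_mul]
    all_goals exact Continuous.intervalIntegrable (by fun_prop) _ _
  have h2 : B ^ 2 ≤ (b - a) * ∫ x in a..b, deriv u x ^ 2 := by
    have := sq_intervalIntegral_le hd.abs hab.le
    simpa only [sq_abs] using this
  rw [e] at h1
  have h3 : (b - a) ^ 2 * ∫ x in a..b, u x ^ 2 ≤ (b - a) ^ 2 *
      ((b - a) ^ 2 * (∫ x in a..b, deriv u x ^ 2) + (b - a)⁻¹ * m ^ 2) := by
    have e2 : (b - a) ^ 2 *
      ((b - a) ^ 2 * (∫ x in a..b, deriv u x ^ 2) + (b - a)⁻¹ * m ^ 2) =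
      (b - a) ^ 3 * ((b - a) * ∫ x in a..b, deriv u x ^ 2) + (b - a) * m ^ 2 := by
      field_simp
    rw [e2]
    have := mul_le_mul_of_nonneg_left h2 (by positivity : 0 ≤ (b - a) ^ 3)
    nlinarith
  exact le_of_mul_le_mul_left h3 (by positivity)

/-- On a bounded interval `K ∫ u²` is controlled by `∫ u'²` and finitely many averages of `u`: apply
the Poincaré inequality on intervals of length at most `1 / √K`. This is the only form of
compactness that is needed. -/
theorem exists_partition_poincare (K R : ℝ) (hK : 0 ≤ K) (hR : 0 < R) :
    ∃ (n : ℕ) (C : ℝ) (a : ℕ → ℝ), 0 ≤ C ∧ Monotone a ∧ ∀ u : ℝ → ℝ, ContDiff ℝ 1 u →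
      HasCompactSupport u → K * ∫ x in (-R)..R, u x ^ 2 ≤
        (∫ x, deriv u x ^ 2) + C * ∑ k ∈ Finset.range n, (∫ x in (a k)..(a (k + 1)), u x) ^ 2 := by
  obtain ⟨n, hn⟩ := exists_nat_gt (K * (2 * R) ^ 2)
  have hn0 : (0 : ℝ) < n := lt_of_le_of_lt (by positivity) hn
  have hn1 : (1 : ℝ) ≤ n := by
    have : 0 < n := by exact_mod_cast hn0
    exact_mod_cast this
  set l := 2 * R / n with hl
  have hl0 : 0 < l := by positivity
  have hKl : K * l ^ 2 ≤ 1 := by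
    rw [hl, div_pow, ← mul_div_assoc, div_le_one (by positivity)]
    nlinarith
  refine ⟨n, K * l⁻¹, fun k => -R + k * l, by positivity, ?_, fun u hu hus => ?_⟩
  · intro i j hij
    have : (i : ℝ) ≤ j := by exact_mod_cast hij
    simp only
    gcongr
  have hd : Continuous (deriv u) := hu.continuous_deriv le_rfl
  have hend : -R + (n : ℝ) * l = R := by rw [hl]; field_simp; ring
  have hsplit : ∀ f : ℝ → ℝ, Continuous f → ∫ x in (-R)..R, f x =
      ∑ k ∈ Finset.range n, ∫ x in (-R + k * l)..(-R + (k + 1 : ℕ) * l), f x := by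
    intro f hf
    rw [intervalIntegral.sum_integral_adjacent_intervals (a := fun k : ℕ => -R + k * l)
      fun k _ => hf.intervalIntegrable _ _]
    simp only [Nat.cast_zero, zero_mul, add_zero, hend]
  have hle : ∫ x in (-R)..R, deriv u x ^ 2 ≤ ∫ x, deriv u x ^ 2 := by
    rw [intervalIntegral.integral_of_le (by linarith)]
    refine setIntegral_le_integral ?_ (ae_of_all _ fun x => sq_nonneg _)
    refine (hd.pow 2).integrable_of_hasCompactSupport ?_
    have := hus.deriv.mul_right (f' := deriv u)
    simpa only [sq] using this
  refine le_trans ?_ (add_le_add_left hle _)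
  rw [hsplit (fun x => u x ^ 2) (hu.continuous.pow 2),
    hsplit (fun x => deriv u x ^ 2) (hd.pow 2), Finset.mul_sum, Finset.mul_sum,
    ← Finset.sum_add_distrib]
  refine Finset.sum_le_sum fun k _ => ?_
  have hlen : -R + ((k + 1 : ℕ) : ℝ) * l - (-R + k * l) = l := by push_cast; ring
  have h1 := poincare_interval hu (a := -R + k * l) (b := -R + (k + 1 : ℕ) * l) (by linarith)
  rw [hlen] at h1
  have h2 : 0 ≤ ∫ x in (-R + k * l)..(-R + (k + 1 : ℕ) * l), deriv u x ^ 2 :=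
    intervalIntegral.integral_nonneg (by linarith) fun x _ => sq_nonneg _
  calc K * ∫ x in (-R + k * l)..(-R + (k + 1 : ℕ) * l), u x ^ 2 ≤ K * _ :=
        mul_le_mul_of_nonneg_left h1 hK
    _ = (K * l ^ 2) * (∫ x in (-R + k * l)..(-R + (k + 1 : ℕ) * l), deriv u x ^ 2) +
        K * l⁻¹ * (∫ x in (-R + k * l)..(-R + (k + 1 : ℕ) * l), u x) ^ 2 := by ring
    _ ≤ _ := by gcongr; nlinarith

theorem formDefect_schrodingerCore {q : ℝ → ℝ} (hq : Continuous q) (hq0 : ∀ x, 0 ≤ q x)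
    {Λ R : ℝ} (hR : 0 < R) (hΛ : ∀ x, R ≤ |x| → Λ ≤ q x) : FormDefect (schrodingerCore q) Λ := by
  have hΛ' : ∀ x, R ≤ |x| → max Λ 0 ≤ q x := fun x hx => max_le (hΛ x hx) (hq0 x)
  obtain ⟨n, C, a, hC, ha, hP⟩ := exists_partition_poincare (max Λ 0) R (le_max_right _ _) hR
  have hfin : ∀ k, volume (Set.Ioc (a k) (a (k + 1))) ≠ ⊤ := fun k => by simp
  refine ⟨n, fun k => √C • indicatorConstLp 2 measurableSet_Ioc (hfin k) (1 : ℝ), ?_⟩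
  rintro w ⟨u, h1, h2, e1, e2, e3⟩
  have hu1 : ContDiff ℝ 1 u := h1.of_le (by simp)
  rw [norm_sq_Lp_eq_integral e1, norm_sq_Lp_eq_integral e2, norm_sq_Lp_eq_integral e3]
  have key := hP u hu1 h2
  have es : ∑ i : Fin n, inner ℝ (√C • indicatorConstLp 2 measurableSet_Ioc (hfin i) (1 : ℝ)) w.1 ^ 2
      = C * ∑ k ∈ Finset.range n, (∫ x in (a k)..(a (k + 1)), u x) ^ 2 := by
    rw [Finset.mul_sum, Finset.sum_range]
    refine Finset.sum_congr rfl fun i _ => ?_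
    rw [real_inner_smul_left, L2.inner_indicatorConstLp_one, mul_pow, Real.sq_sqrt hC,
      intervalIntegral.integral_of_le (ha (Nat.le_succ _))]
    congr 2
    exact integral_congr_ae (ae_restrict_of_ae e1)
  rw [es]
  have hc := h1.continuous
  have hsupp : ∀ {g : ℝ → ℝ}, Continuous g → Integrable fun x => g x * u x ^ 2 := by
    intro g hg
    refine (hg.mul (hc.pow 2)).integrable_of_hasCompactSupport ?_
    have := (h2.mul_left (f' := u) (f := u)).mul_left (f := g)
    simpa only [sq] using this
  have hmain : Λ * ∫ x, u x ^ 2 ≤ (∫ x, (√(q x) * u x) ^ 2) +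
      max Λ 0 * ∫ x in (-R)..R, u x ^ 2 := by
    have i1 : Integrable fun x => u x ^ 2 := by simpa using hsupp (g := fun _ => 1) continuous_const
    rw [intervalIntegral.integral_of_le (by linarith), ← integral_const_mul,
      ← integral_indicator measurableSet_Ioc, ← integral_const_mul]
    have i2 : Integrable fun x => (√(q x) * u x) ^ 2 := by
      simp only [mul_pow]
      exact hsupp (hq.sqrt.pow 2)
    rw [← integral_add i2 ((i1.indicator measurableSet_Ioc).const_mul _)]
    refine integral_mono (i1.const_mul _)
      (i2.add ((i1.indicator measurableSet_Ioc).const_mul _)) fun x => ?_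
    have hs : (√(q x) * u x) ^ 2 = q x * u x ^ 2 := by rw [mul_pow, Real.sq_sqrt (hq0 x)]
    simp only [hs]
    have hn := sq_nonneg (u x)
    by_cases hx : x ∈ Set.Ioc (-R) R
    · rw [Set.indicator_of_mem hx]
      nlinarith [mul_nonneg (hq0 x) hn, mul_le_mul_of_nonneg_right (le_max_left Λ 0) hn]
    · rw [Set.indicator_of_notMem hx]
      have : R ≤ |x| := by
        by_contra! hlt
        exact hx ⟨(abs_lt.1 hlt).1, (abs_lt.1 hlt).2.le⟩
      have := mul_le_mul_of_nonneg_right (hΛ x this) hn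
      linarith
  linarith

theorem formDefect_schrodingerForm {q : ℝ → ℝ} (hq : Continuous q) (hq0 : ∀ x, 0 ≤ q x)
    {Λ R : ℝ} (hR : 0 < R) (hΛ : ∀ x, R ≤ |x| → Λ ≤ q x) : FormDefect (schrodingerForm q) Λ := by
  obtain ⟨n, g, hg⟩ := (formDefect_schrodingerCore hq hq0 hR hΛ).closure
  exact ⟨n, g, fun w hw => hg w (schrodingerForm_le_closure_core hq hq0 hw)⟩

end Poincare

/-! ### The transversal problem -/

section Transversal
open Real

theorem contDiff_div_sin {f : ℝ → ℝ} (hf : ContDiff ℝ 1 f) {a b : ℝ} (ha : 0 < a) (hb : b < π)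
    (hsupp : ∀ y, y ∉ Set.Icc a b → f y = 0) : ContDiff ℝ 1 fun y => f y / sin y := by
  rw [contDiff_iff_contDiffAt]
  intro y
  by_cases hy : y ∈ Set.Icc a b
  · exact hf.contDiffAt.div contDiff_sin.contDiffAt
      (sin_pos_of_pos_of_lt_pi (ha.trans_le hy.1) (hy.2.trans_lt hb)).ne'
  · refine (contDiffAt_const (c := (0 : ℝ))).congr_of_eventuallyEq ?_
    filter_upwards [isClosed_Icc.isOpen_compl.mem_nhds hy] with z hz
    rw [hsupp z hz, zero_div]

/-- Spectral gap of the Dirichlet problem on `(0, π)`: besides `∫ f² ≤ ∫ f'²`, the part of `f`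
orthogonal to the ground state `sin` contributes to the energy. The constant `2 / π²` is not
optimal. -/
theorem dirichlet_gap_pi {f : ℝ → ℝ} (hf : ContDiff ℝ 1 f) {a b : ℝ} (ha : 0 < a) (hb : b < π)
    (hsupp : ∀ y, y ∉ Set.Icc a b → f y = 0) :
    (2 / π) * (∫ y in (0 : ℝ)..π, f y * sin y) ^ 2 ≤ ∫ y in (0 : ℝ)..π, f y ^ 2 ∧
    (∫ y in (0 : ℝ)..π, f y ^ 2) + (2 / π ^ 2) * ((∫ y in (0 : ℝ)..π, f y ^ 2) -
      (2 / π) * (∫ y in (0 : ℝ)..π, f y * sin y) ^ 2) ≤ ∫ y in (0 : ℝ)..π, deriv f y ^ 2 := by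
  have hpi := pi_pos
  set v : ℝ → ℝ := fun y => f y / sin y with hv
  have hvC : ContDiff ℝ 1 v := contDiff_div_sin hf ha hb hsupp
  have hvc : Continuous v := hvC.continuous
  have hv'c : Continuous (deriv v) := hvC.continuous_deriv le_rfl
  have hvd : ∀ y, HasDerivAt v (deriv v y) y := fun y =>
    (hvC.differentiable one_ne_zero y).hasDerivAt
  have hfv : ∀ y, f y = v y * sin y := by
    intro y
    by_cases hy : y ∈ Set.Icc a b
    · have := (sin_pos_of_pos_of_lt_pi (ha.trans_le hy.1) (hy.2.trans_lt hb)).ne'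
      simp only [hv]
      field_simp
    · simp only [hv, hsupp y hy, zero_div, zero_mul]
  have hf' : ∀ y, deriv f y = deriv v y * sin y + v y * cos y := by
    intro y
    have : f = fun y => v y * sin y := funext hfv
    conv_lhs => rw [this]
    exact ((hvd y).mul (hasDerivAt_sin y)).deriv
  have hii : ∀ {g : ℝ → ℝ}, Continuous g → ∀ x y, IntervalIntegrable g volume x y :=
    fun hg x y => hg.intervalIntegrable x y
  -- Jacobi's factorisation with `v = f / sin`: `f'² - f² = v'² sin² + (v² sin cos)'`.
  set E := ∫ y in (0 : ℝ)..π, (deriv v y * sin y) ^ 2 with hE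
  have hJ : ∫ y in (0 : ℝ)..π, deriv f y ^ 2 = (∫ y in (0 : ℝ)..π, f y ^ 2) + E := by
    have hb0 : ∫ y in (0 : ℝ)..π, (2 * v y * deriv v y * (sin y * cos y) +
        v y ^ 2 * (cos y * cos y + sin y * (-sin y))) = 0 := by
      rw [intervalIntegral.integral_eq_sub_of_hasDerivAt
        (f := fun y => v y ^ 2 * (sin y * cos y)) (fun y _ => ?_) (hii (by fun_prop) _ _)]
      · simp
      · have h1 := ((hvd y).pow 2).mul ((hasDerivAt_sin y).mul (hasDerivAt_cos y))
        refine h1.congr_deriv ?_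
        simp
    have e : ∀ y, deriv f y ^ 2 = f y ^ 2 + (deriv v y * sin y) ^ 2 +
        (2 * v y * deriv v y * (sin y * cos y) +
        v y ^ 2 * (cos y * cos y + sin y * (-sin y))) := fun y => by
      rw [hf', hfv]; ring
    simp only [e]
    have hfc := hf.continuous
    rw [intervalIntegral.integral_add (hii (by fun_prop) _ _) (hii (by fun_prop) _ _), hb0,
      intervalIntegral.integral_add (hii (by fun_prop) _ _) (hii (by fun_prop) _ _), add_zero]
  set I := ∫ y in (0 : ℝ)..π, f y * sin y with hI
  set c := 2 / π * I with hc
  set V := ∫ y in (0 : ℝ)..π, ((v y - c) * sin y) ^ 2 with hV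
  have hV0 : 0 ≤ V := intervalIntegral.integral_nonneg hpi.le fun y _ => sq_nonneg _
  have hss : ∫ y in (0 : ℝ)..π, sin y ^ 2 = π / 2 := by rw [integral_sin_sq]; simp
  have hVeq : V = (∫ y in (0 : ℝ)..π, f y ^ 2) - 2 / π * I ^ 2 := by
    have e : ∀ y, ((v y - c) * sin y) ^ 2 = f y ^ 2 - 2 * c * (f y * sin y) + c ^ 2 * sin y ^ 2 :=
      fun y => by rw [hfv]; ring
    have hfc := hf.continuous
    rw [hV]
    simp only [e]
    rw [intervalIntegral.integral_add (hii (by fun_prop) _ _) (hii (by fun_prop) _ _),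
      intervalIntegral.integral_sub (hii (by fun_prop) _ _) (hii (by fun_prop) _ _),
      intervalIntegral.integral_const_mul, intervalIntegral.integral_const_mul, hss, ← hI, hc]
    field_simp
    ring
  refine ⟨by linarith, ?_⟩
  rw [hJ, ← hVeq]
  -- It remains to prove the weighted Poincaré inequality `V ≤ (π² / 2) E`. By parts,
  -- `V = -∫ v' G` with `G y = ∫₀^y (v - c) sin²`, and `G² ≤ (π / 2) V sin²`.
  have hgc : Continuous fun y => (v y - c) * sin y ^ 2 := by fun_prop
  set G : ℝ → ℝ := fun y => ∫ t in (0 : ℝ)..y, (v t - c) * sin t ^ 2 with hG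
  have hGd : ∀ y, HasDerivAt G ((v y - c) * sin y ^ 2) y := fun y =>
    intervalIntegral.integral_hasDerivAt_right (hii hgc _ _)
      (hgc.stronglyMeasurableAtFilter _ _) hgc.continuousAt
  have hGc : Continuous G := continuous_iff_continuousAt.2 fun y => (hGd y).continuousAt
  have hG0 : G 0 = 0 := by simp [hG]
  have hGpi : G π = 0 := by
    have e : ∀ y, (v y - c) * sin y ^ 2 = f y * sin y - c * sin y ^ 2 := fun y => by
      rw [hfv]; ring
    have hfc := hf.continuous
    simp only [hG, e]
    rw [intervalIntegral.integral_sub (hii (by fun_prop) _ _) (hii (by fun_prop) _ _),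
      intervalIntegral.integral_const_mul, hss, ← hI, hc]
    field_simp
    ring
  have hparts : V = - ∫ y in (0 : ℝ)..π, deriv v y * G y := by
    have h1 := intervalIntegral.integral_mul_deriv_eq_deriv_mul (a := 0) (b := π)
      (u := fun y => v y - c) (v := G) (u' := deriv v) (v' := fun y => (v y - c) * sin y ^ 2)
      (fun y _ => (hvd y).sub_const c) (fun y _ => hGd y) (hii hv'c _ _) (hii hgc _ _)
    rw [hG0, hGpi] at h1
    simp only [mul_zero, sub_zero, zero_sub] at h1
    rw [← h1, hV]
    congr 1
    ext y
    ring
  have hCS : ∀ x y, 0 ≤ x → x ≤ y → y ≤ π → (∫ t in x..y, (v t - c) * sin t ^ 2) ^ 2 ≤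
      V * ∫ t in x..y, sin t ^ 2 := by
    intro x y hx hxy hy
    have hVxy : ∫ t in x..y, ((v t - c) * sin t) ^ 2 ≤ V :=
      intervalIntegral.integral_mono_interval hx hxy hy
        (ae_of_all _ fun t => sq_nonneg _) (hii (by fun_prop) _ _)
    have hs0 : 0 ≤ ∫ t in x..y, sin t ^ 2 :=
      intervalIntegral.integral_nonneg hxy fun t _ => sq_nonneg _
    refine le_trans ?_ (mul_le_mul_of_nonneg_right hVxy hs0)
    set p := ∫ t in x..y, ((v t - c) * sin t) ^ 2 with hp
    set q := ∫ t in x..y, sin t ^ 2 with hq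
    set r := ∫ t in x..y, (v t - c) * sin t ^ 2 with hr
    have key : ∀ s : ℝ, 0 ≤ q * (s * s) + (2 * r) * s + p := by
      intro s
      have h1 : 0 ≤ ∫ t in x..y, ((v t - c) * sin t + s * sin t) ^ 2 :=
        intervalIntegral.integral_nonneg hxy fun t _ => sq_nonneg _
      have e : ∀ t, ((v t - c) * sin t + s * sin t) ^ 2 =
          s ^ 2 * sin t ^ 2 + 2 * s * ((v t - c) * sin t ^ 2) + ((v t - c) * sin t) ^ 2 :=
        fun t => by ring
      simp only [e] at h1
      rw [intervalIntegral.integral_add (hii (by fun_prop) _ _) (hii (by fun_prop) _ _),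
        intervalIntegral.integral_add (hii (by fun_prop) _ _) (hii (by fun_prop) _ _),
        intervalIntegral.integral_const_mul, intervalIntegral.integral_const_mul] at h1
      linarith
    have := discrim_le_zero key
    rw [discrim] at this
    linarith
  have hGb : ∀ y ∈ Set.Icc 0 π, G y ^ 2 ≤ V * (π / 2) * sin y ^ 2 := by
    intro y hy
    rw [mul_assoc]
    have hsy := sin_nonneg_of_nonneg_of_le_pi hy.1 hy.2
    rcases le_total y (π / 2) with h | h
    · refine (hCS 0 y le_rfl hy.1 hy.2).trans (mul_le_mul_of_nonneg_left ?_ hV0)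
      have h1 : ∫ t in (0 : ℝ)..y, sin t ^ 2 ≤ ∫ t in (0 : ℝ)..y, sin y ^ 2 := by
        refine intervalIntegral.integral_mono_on hy.1 (hii (by fun_prop) _ _)
          (hii (by fun_prop) _ _) fun t ht => ?_
        have h2 : sin t ≤ sin y := sin_le_sin_of_le_of_le_pi_div_two (by linarith [ht.1]) h ht.2
        have h3 := sin_nonneg_of_nonneg_of_le_pi ht.1 (ht.2.trans hy.2)
        gcongr
      refine h1.trans ?_
      rw [intervalIntegral.integral_const, smul_eq_mul, sub_zero]
      gcongr
    · have e : G y = - ∫ t in y..π, (v t - c) * sin t ^ 2 := by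
        have := intervalIntegral.integral_add_adjacent_intervals (hii hgc 0 y) (hii hgc y π)
        have h0 : ∫ t in (0 : ℝ)..π, (v t - c) * sin t ^ 2 = 0 := hGpi
        simp only [hG]
        linarith
      rw [e, neg_sq]
      refine (hCS y π hy.1 hy.2 le_rfl).trans (mul_le_mul_of_nonneg_left ?_ hV0)
      have h1 : ∫ t in y..π, sin t ^ 2 ≤ ∫ t in y..π, sin y ^ 2 := by
        refine intervalIntegral.integral_mono_on hy.2 (hii (by fun_prop) _ _)
          (hii (by fun_prop) _ _) fun t ht => ?_
        have h2 : sin t ≤ sin y := by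
          rw [← sin_pi_sub t, ← sin_pi_sub y]
          exact sin_le_sin_of_le_of_le_pi_div_two (by linarith [ht.2]) (by linarith)
            (by linarith [ht.1])
        have h3 := sin_nonneg_of_nonneg_of_le_pi (hy.1.trans ht.1) ht.2
        gcongr
      refine h1.trans ?_
      rw [intervalIntegral.integral_const, smul_eq_mul]
      gcongr
      linarith
  have hbound : V ≤ (π ^ 2 / 4) * E + V / 2 := by
    have h1 : ∀ y ∈ Set.Icc 0 π, -(deriv v y * G y) ≤
        (π ^ 2 / 4) * (deriv v y * sin y) ^ 2 + V / (2 * π) := by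
      intro y hy
      have h2 := mul_le_mul_of_nonneg_left (hGb y hy) (sq_nonneg (deriv v y))
      refine abs_le_of_sq_le_sq' (a := deriv v y * G y) ?_ (by positivity) |>.1 |> neg_le.1
      have h3 : (deriv v y * G y) ^ 2 ≤ (deriv v y * sin y) ^ 2 * (V * (π / 2)) := by
        nlinarith
      have h4 : ((π ^ 2 / 4) * (deriv v y * sin y) ^ 2 + V / (2 * π)) ^ 2 -
          (deriv v y * sin y) ^ 2 * (V * (π / 2)) =
          ((π ^ 2 / 4) * (deriv v y * sin y) ^ 2 - V / (2 * π)) ^ 2 +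
          (deriv v y * sin y) ^ 2 * (π * V / 2 - V * (π / 2)) := by
        field_simp; ring
      have h5 : π * V / 2 - V * (π / 2) = 0 := by ring
      rw [h5, mul_zero, add_zero] at h4
      nlinarith [sq_nonneg ((π ^ 2 / 4) * (deriv v y * sin y) ^ 2 - V / (2 * π))]
    have h2 := intervalIntegral.integral_mono_on hpi.le (hii (by fun_prop) 0 π)
      (hii (by fun_prop) 0 π) h1
    rw [intervalIntegral.integral_neg, ← hparts, intervalIntegral.integral_add
      (hii (by fun_prop) _ _) (hii (by fun_prop) _ _), intervalIntegral.integral_const_mul,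
      intervalIntegral.integral_const, ← hE, smul_eq_mul] at h2
    have e : (π - 0) * (V / (2 * π)) = V / 2 := by field_simp; ring
    rw [e] at h2
    exact h2
  have h6 : 2 / π ^ 2 * V ≤ E := by
    rw [div_mul_eq_mul_div, div_le_iff₀ (by positivity)]
    nlinarith
  linarith

/-- The gap inequality `dirichlet_gap_pi`, rescaled to `(0, l)`. -/
theorem dirichlet_gap {f : ℝ → ℝ} (hf : ContDiff ℝ 1 f) {a b l : ℝ} (ha : 0 < a) (hb : b < l)
    (hl : 0 < l) (hsupp : ∀ y, y ∉ Set.Icc a b → f y = 0) :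
    (2 / l) * (∫ y in (0 : ℝ)..l, f y * sin (π * y / l)) ^ 2 ≤ ∫ y in (0 : ℝ)..l, f y ^ 2 ∧
    π ^ 2 / l ^ 2 * (∫ y in (0 : ℝ)..l, f y ^ 2) + 2 / l ^ 2 * ((∫ y in (0 : ℝ)..l, f y ^ 2) -
      (2 / l) * (∫ y in (0 : ℝ)..l, f y * sin (π * y / l)) ^ 2) ≤
        ∫ y in (0 : ℝ)..l, deriv f y ^ 2 := by
  have hpi := pi_pos
  set r := l / π with hr
  have hr0 : 0 < r := by positivity
  have hrl : r * π = l := by rw [hr]; field_simp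
  have hg : ContDiff ℝ 1 fun t => f (r * t) := hf.comp (contDiff_const.mul contDiff_id)
  have hgd : ∀ t, deriv (fun t => f (r * t)) t = r * deriv f (r * t) := by
    intro t
    have h1 : HasDerivAt (fun t => r * t) (r * 1) t := (hasDerivAt_id t).const_mul r
    have h2 := (hf.differentiable one_ne_zero (r * t)).hasDerivAt.comp t h1
    rw [show (fun t => f (r * t)) = f ∘ fun t => r * t from rfl, h2.deriv]
    ring
  have key := dirichlet_gap_pi hg (a := a / r) (b := b / r) (by positivity)
    (by rw [div_lt_iff₀ hr0]; linarith) fun t ht => hsupp _ fun h => ht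
      ⟨by rw [div_le_iff₀ hr0]; linarith [h.1], by rw [le_div_iff₀ hr0]; linarith [h.2]⟩
  have e1 : ∫ t in (0 : ℝ)..π, f (r * t) ^ 2 = r⁻¹ * ∫ y in (0 : ℝ)..l, f y ^ 2 := by
    rw [intervalIntegral.integral_comp_mul_left (fun y => f y ^ 2) hr0.ne', mul_zero, hrl,
      smul_eq_mul]
  have e2 : ∫ t in (0 : ℝ)..π, f (r * t) * sin t =
      r⁻¹ * ∫ y in (0 : ℝ)..l, f y * sin (π * y / l) := by
    have : ∀ t, f (r * t) * sin t = f (r * t) * sin (π * (r * t) / l) := fun t => by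
      congr 2
      rw [hr]
      field_simp
    simp only [this]
    rw [intervalIntegral.integral_comp_mul_left (fun y => f y * sin (π * y / l)) hr0.ne',
      mul_zero, hrl, smul_eq_mul]
  have e3 : ∫ t in (0 : ℝ)..π, deriv (fun t => f (r * t)) t ^ 2 =
      r * ∫ y in (0 : ℝ)..l, deriv f y ^ 2 := by
    simp only [hgd, mul_pow]
    rw [intervalIntegral.integral_const_mul,
      intervalIntegral.integral_comp_mul_left (fun y => deriv f y ^ 2) hr0.ne', mul_zero, hrl,
      smul_eq_mul]
    field_simp
  rw [e1, e2, e3] at key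
  set A := ∫ y in (0 : ℝ)..l, f y ^ 2
  set B := ∫ y in (0 : ℝ)..l, f y * sin (π * y / l)
  set C := ∫ y in (0 : ℝ)..l, deriv f y ^ 2
  obtain ⟨k1, k2⟩ := key
  constructor
  · have := mul_le_mul_of_nonneg_left k1 hr0.le
    have e : r * (2 / π * (r⁻¹ * B) ^ 2) = 2 / l * B ^ 2 := by rw [hr]; field_simp
    rw [e, mul_inv_cancel_left₀ hr0.ne'] at this
    exact this
  · have := mul_le_mul_of_nonneg_left k2 (inv_nonneg.2 hr0.le)
    rw [inv_mul_cancel_left₀ hr0.ne'] at this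
    refine le_of_eq_of_le ?_ this
    rw [hr]
    field_simp

end Transversal

/-! ### Reduction to the first transversal mode -/

section Reduction
open Real

theorem isOpen_strip {h : ℝ → ℝ} (hc : Continuous h) (ε : ℝ) : IsOpen (strip h ε) := by
  have h1 : IsOpen {p : ℝ × ℝ | 0 < p.2} := isOpen_lt continuous_const continuous_snd
  have h2 : IsOpen {p : ℝ × ℝ | p.2 < ε * h p.1} := isOpen_lt continuous_snd (by fun_prop)
  exact h1.inter h2

/-- On each slice, a compact subset of the strip stays away from the boundary of the strip. -/
theorem exists_slice_bounds {h : ℝ → ℝ} {ε : ℝ} {s : Set (ℝ × ℝ)} (hs : IsCompact s)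
    (hsub : s ⊆ strip h ε) (x : ℝ) :
    ∃ a b, 0 < a ∧ b < ε * h x ∧ ∀ y, y ∉ Set.Icc a b → (x, y) ∉ s := by
  have hK : IsCompact {y : ℝ | (x, y) ∈ s} :=
    (hs.image continuous_snd).of_isClosed_subset (hs.isClosed.preimage (by fun_prop))
      fun y hy => ⟨(x, y), hy, rfl⟩
  rcases Set.eq_empty_or_nonempty {y : ℝ | (x, y) ∈ s} with he | hne
  · refine ⟨1, ε * h x - 1, one_pos, by linarith, fun y _ hy => ?_⟩
    have : y ∈ {y : ℝ | (x, y) ∈ s} := hy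
    rw [he] at this
    exact this
  · obtain ⟨a, ha, hamin⟩ := hK.exists_isLeast hne
    obtain ⟨b, hb, hbmax⟩ := hK.exists_isGreatest hne
    exact ⟨a, b, (hsub ha).1, (hsub hb).2, fun y hy hys => hy ⟨hamin hys, hbmax hys⟩⟩

theorem integral_eq_iterated {g : ℝ × ℝ → ℝ} (hg : Continuous g) (hgs : HasCompactSupport g)
    {l : ℝ} (hsupp : ∀ p, g p ≠ 0 → 0 < p.2 ∧ p.2 ≤ l) :
    ∫ p, g p = ∫ x, ∫ y in (0 : ℝ)..l, g (x, y) := by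
  rw [Measure.volume_eq_prod, integral_prod _ (by
    rw [← Measure.volume_eq_prod]; exact hg.integrable_of_hasCompactSupport hgs)]
  congr 1
  ext x
  exact (intervalIntegral.integral_eq_integral_of_support_subset fun y hy => hsupp (x, y) hy).symm

theorem continuous_intervalIntegral_slice {g : ℝ × ℝ → ℝ} (hg : Continuous g) (a b : ℝ) :
    Continuous fun x => ∫ y in a..b, g (x, y) :=
  intervalIntegral.continuous_parametric_intervalIntegral_of_continuous'
    (f := fun x y => g (x, y)) hg a b

theorem hasCompactSupport_intervalIntegral_slice {g : ℝ × ℝ → ℝ} (hg : HasCompactSupport g)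
    (a b : ℝ) : HasCompactSupport fun x => ∫ y in a..b, g (x, y) := by
  refine HasCompactSupport.of_support_subset_isCompact (hg.isCompact.image continuous_fst)
    fun x hx => ?_
  by_contra hcon
  refine hx ?_
  have : ∀ y, g (x, y) = 0 := fun y =>
    image_eq_zero_of_notMem_tsupport fun hy => hcon ⟨(x, y), hy, rfl⟩
  simp [this]

/-- The coefficient of `ψ(x, ·)` with respect to the normalized first Dirichlet eigenfunction
`√(2 / l) sin (π y / l)` of the interval `(0, l)`. -/
def transMean (l : ℝ) (ψ : ℝ × ℝ → ℝ) (x : ℝ) : ℝ :=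
  √(2 / l) * ∫ y in (0 : ℝ)..l, ψ (x, y) * sin (π * y / l)

theorem sq_transMean {l : ℝ} (hl : 0 < l) (ψ : ℝ × ℝ → ℝ) (x : ℝ) :
    transMean l ψ x ^ 2 = 2 / l * (∫ y in (0 : ℝ)..l, ψ (x, y) * sin (π * y / l)) ^ 2 := by
  rw [transMean, mul_pow, Real.sq_sqrt (by positivity)]

theorem continuous_transMean {ψ : ℝ × ℝ → ℝ} (hψ : Continuous ψ) (l : ℝ) :
    Continuous (transMean l ψ) :=
  continuous_const.mul (continuous_intervalIntegral_slice (g := fun p => ψ p * sin (π * p.2 / l))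
    (by fun_prop) 0 l)

theorem hasCompactSupport_transMean {ψ : ℝ × ℝ → ℝ} (hψ : HasCompactSupport ψ) (l : ℝ) :
    HasCompactSupport (transMean l ψ) :=
  (hasCompactSupport_intervalIntegral_slice (g := fun p => ψ p * sin (π * p.2 / l))
    hψ.mul_right 0 l).mul_left

theorem hasDerivAt_slice {ψ : ℝ × ℝ → ℝ} (hψ : ContDiff ℝ 1 ψ) (x y : ℝ) :
    HasDerivAt (fun x => ψ (x, y)) (fderiv ℝ ψ (x, y) (1, 0)) x := by
  have h1 : HasDerivAt (fun x : ℝ => (x, y)) ((1 : ℝ), (0 : ℝ)) x :=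
    (hasDerivAt_id x).prodMk (hasDerivAt_const x y)
  exact (hψ.differentiable one_ne_zero (x, y)).hasFDerivAt.comp_hasDerivAt x h1

theorem hasDerivAt_slice' {ψ : ℝ × ℝ → ℝ} (hψ : ContDiff ℝ 1 ψ) (x y : ℝ) :
    HasDerivAt (fun y => ψ (x, y)) (fderiv ℝ ψ (x, y) (0, 1)) y := by
  have h1 : HasDerivAt (fun y : ℝ => (x, y)) ((0 : ℝ), (1 : ℝ)) y :=
    (hasDerivAt_const y x).prodMk (hasDerivAt_id y)
  exact (hψ.differentiable one_ne_zero (x, y)).hasFDerivAt.comp_hasDerivAt y h1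

theorem hasDerivAt_transMean {ψ : ℝ × ℝ → ℝ} (hψ : ContDiff ℝ 1 ψ) (hψs : HasCompactSupport ψ)
    (l x : ℝ) :
    HasDerivAt (transMean l ψ) (transMean l (fun p => fderiv ℝ ψ p (1, 0)) x) x := by
  have hd : Continuous fun p => fderiv ℝ ψ p (1, 0) :=
    (hψ.continuous_fderiv one_ne_zero).clm_apply continuous_const
  obtain ⟨C, hC⟩ := hd.bounded_above_of_compact_support (hψs.fderiv_apply ℝ (1, 0))
  have hψc := hψ.continuous
  refine HasDerivAt.const_mul _ (intervalIntegral.hasDerivAt_integral_of_dominated_loc_of_deriv_le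
    (F := fun x y => ψ (x, y) * sin (π * y / l)) (μ := volume) (a := 0) (b := l)
    (F' := fun x y => fderiv ℝ ψ (x, y) (1, 0) * sin (π * y / l))
    (bound := fun _ => C) (s := Set.univ) univ_mem (Eventually.of_forall fun x' => ?_) ?_ ?_
    (ae_of_all _ fun y _ x' _ => ?_) intervalIntegrable_const
    (ae_of_all _ fun y _ x' _ => ?_)).2
  · exact Continuous.aestronglyMeasurable (by fun_prop)
  · exact Continuous.intervalIntegrable (by fun_prop) _ _
  · have : Continuous fun y => fderiv ℝ ψ (x, y) (1, 0) := hd.comp (by fun_prop)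
    exact Continuous.aestronglyMeasurable (by fun_prop)
  · rw [norm_mul]
    refine (mul_le_of_le_one_right (norm_nonneg _) (abs_sin_le_one _)).trans (hC _)
  · exact (hasDerivAt_slice hψ x' y).mul_const _

theorem contDiff_transMean {ψ : ℝ × ℝ → ℝ} (hψ : ContDiff ℝ 1 ψ) (hψs : HasCompactSupport ψ)
    (l : ℝ) : ContDiff ℝ 1 (transMean l ψ) := by
  rw [contDiff_one_iff_deriv]
  refine ⟨fun x => (hasDerivAt_transMean hψ hψs l x).differentiableAt, ?_⟩
  rw [show deriv (transMean l ψ) = transMean l (fun p => fderiv ℝ ψ p (1, 0)) from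
    funext fun x => (hasDerivAt_transMean hψ hψs l x).deriv]
  exact continuous_transMean ((hψ.continuous_fderiv one_ne_zero).clm_apply continuous_const) l

theorem transMean_sum {k : ℕ} (l : ℝ) (ψ : Fin k → ℝ × ℝ → ℝ) (hψ : ∀ i, Continuous (ψ i))
    (c : Fin k → ℝ) : transMean l (fun p => ∑ i, c i * ψ i p) =
      fun x => ∑ i, c i * transMean l (ψ i) x := by
  ext x
  simp only [transMean, Finset.sum_mul]
  rw [intervalIntegral.integral_finsetSum]
  · rw [Finset.mul_sum]
    refine Finset.sum_congr rfl fun i _ => ?_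
    simp only [mul_assoc]
    rw [intervalIntegral.integral_const_mul]
    ring
  · intro i _
    have := hψ i
    exact Continuous.intervalIntegrable (by fun_prop) _ _

variable {h : ℝ → ℝ} {ε M : ℝ}

/-- The excess of the lowest Dirichlet eigenvalue of the slice `(0, ε h(x))` over that of the widest
slice `(0, ε M)`. -/
def excess (h : ℝ → ℝ) (ε M x : ℝ) : ℝ := π ^ 2 / (ε * h x) ^ 2 - π ^ 2 / (ε * M) ^ 2

theorem excess_nonneg (hε : 0 < ε) (hpos : ∀ x, 0 < h x) (hM : ∀ x, h x ≤ M) (x : ℝ) :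
    0 ≤ excess h ε M x := by
  rw [excess, sub_nonneg]
  have := hpos x
  have := hM x
  gcongr

theorem continuous_excess (hε : 0 < ε) (hc : Continuous h) (hpos : ∀ x, 0 < h x) (M : ℝ) :
    Continuous (excess h ε M) := by
  refine Continuous.sub (Continuous.div continuous_const (by fun_prop) fun x => ?_) continuous_const
  have := hpos x
  positivity

/-- The energy of a test function on one slice. The gap inequality on the interval `(0, ε M)` with
weight `δ` is combined with the one on the slice `(0, ε h(x))` with weight `1 - δ`; the coefficient
is that of the interval `(0, ε M)`, which does not depend on `x`. -/
theorem slice_energy_le (hε : 0 < ε) (hpos : ∀ x, 0 < h x) (hM : ∀ x, h x ≤ M)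
    {ψ : ℝ × ℝ → ℝ} (hψ : ContDiff ℝ ∞ ψ) (hψs : HasCompactSupport ψ)
    (hψt : tsupport ψ ⊆ strip h ε) {δ : ℝ} (hδ : 0 ≤ δ) (hδ1 : δ ≤ 1) (x : ℝ) :
    transMean (ε * M) ψ x ^ 2 ≤ ∫ y in (0 : ℝ)..(ε * M), ψ (x, y) ^ 2 ∧
    deriv (transMean (ε * M) ψ) x ^ 2 +
      π ^ 2 / (ε * M) ^ 2 * (∫ y in (0 : ℝ)..(ε * M), ψ (x, y) ^ 2) +
      (1 - δ) * (excess h ε M x * transMean (ε * M) ψ x ^ 2) +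
      δ * (2 / (ε * M) ^ 2) *
        ((∫ y in (0 : ℝ)..(ε * M), ψ (x, y) ^ 2) - transMean (ε * M) ψ x ^ 2) ≤
    (∫ y in (0 : ℝ)..(ε * M), (fderiv ℝ ψ (x, y) (1, 0)) ^ 2) +
      ∫ y in (0 : ℝ)..(ε * M), (fderiv ℝ ψ (x, y) (0, 1)) ^ 2 := by
  have hMp : 0 < M := (hpos 0).trans_le (hM 0)
  set l := ε * M with hl
  have hl0 : 0 < l := by positivity
  have hψ1 : ContDiff ℝ 1 ψ := hψ.of_le (by simp)
  obtain ⟨a, b, ha, hb, hab⟩ := exists_slice_bounds hψs.isCompact hψt x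
  have hbl : b < l := hb.trans_le (by rw [hl]; have := hM x; gcongr)
  have hhx : 0 < ε * h x := mul_pos hε (hpos x)
  have hf : ContDiff ℝ 1 fun y => ψ (x, y) := hψ1.comp (by fun_prop)
  have hfs : ∀ y, y ∉ Set.Icc a b → ψ (x, y) = 0 := fun y hy =>
    image_eq_zero_of_notMem_tsupport (hab y hy)
  have hfd : ∀ y, deriv (fun y => ψ (x, y)) y = fderiv ℝ ψ (x, y) (0, 1) := fun y =>
    (hasDerivAt_slice' hψ1 x y).deriv
  have hg : ContDiff ℝ 1 fun y => fderiv ℝ ψ (x, y) (1, 0) := by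
    have : ContDiff ℝ 1 fun p => fderiv ℝ ψ p (1, 0) :=
      ((contDiff_infty_iff_fderiv.1 hψ).2.of_le (by simp)).clm_apply contDiff_const
    exact this.comp (by fun_prop)
  have hzero : ∀ y, y ∉ Set.Icc a b → fderiv ℝ ψ (x, y) = 0 := fun y hy =>
    image_eq_zero_of_notMem_tsupport fun hmem => hab y hy (tsupport_fderiv_subset ℝ hmem)
  have hgs : ∀ y, y ∉ Set.Icc a b → fderiv ℝ ψ (x, y) (1, 0) = 0 := fun y hy => by
    rw [hzero y hy]; rfl
  have hys : ∀ y, y ∉ Set.Icc a b → fderiv ℝ ψ (x, y) (0, 1) = 0 := fun y hy => by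
    rw [hzero y hy]; rfl
  obtain ⟨g1, g2⟩ := dirichlet_gap hf ha hbl hl0 hfs
  obtain ⟨k1, k2⟩ := dirichlet_gap hf ha hb hhx hfs
  obtain ⟨m1, -⟩ := dirichlet_gap hg ha hbl hl0 hgs
  have hchange : ∀ F : ℝ → ℝ, (∀ y, y ∉ Set.Icc a b → F y = 0) →
      ∫ y in (0 : ℝ)..(ε * h x), F y = ∫ y in (0 : ℝ)..l, F y := by
    intro F hF
    have hs : ∀ y, F y ≠ 0 → y ∈ Set.Icc a b := fun y hy => by
      by_contra hcon
      exact hy (hF y hcon)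
    rw [intervalIntegral.integral_eq_integral_of_support_subset,
      intervalIntegral.integral_eq_integral_of_support_subset]
    · exact fun y hy => ⟨ha.trans_le (hs y hy).1, (hs y hy).2.trans hbl.le⟩
    · exact fun y hy => ⟨ha.trans_le (hs y hy).1, (hs y hy).2.trans hb.le⟩
  simp only [hfd] at g2 k2
  rw [hchange (fun y => ψ (x, y) ^ 2) (fun y hy => by simp [hfs y hy])] at k1 k2
  rw [hchange (fun y => ψ (x, y) * sin (π * y / (ε * h x)))
    (fun y hy => by simp [hfs y hy])] at k1 k2
  rw [hchange (fun y => fderiv ℝ ψ (x, y) (0, 1) ^ 2) (fun y hy => by simp [hys y hy])] at k2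
  rw [← sq_transMean hl0] at g1 g2
  rw [← sq_transMean hl0 (fun p => fderiv ℝ ψ p (1, 0))] at m1
  rw [(hasDerivAt_transMean hψ1 hψs l x).deriv]
  refine ⟨g1, ?_⟩
  set N := ∫ y in (0 : ℝ)..l, ψ (x, y) ^ 2
  set Y := ∫ y in (0 : ℝ)..l, (fderiv ℝ ψ (x, y) (0, 1)) ^ 2
  set t := transMean l ψ x ^ 2
  have hQ := excess_nonneg hε hpos hM x
  have k3 : excess h ε M x * N + π ^ 2 / l ^ 2 * N ≤ Y := by
    have e : excess h ε M x * N + π ^ 2 / l ^ 2 * N = π ^ 2 / (ε * h x) ^ 2 * N := by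
      rw [excess]; ring
    have : 0 ≤ 2 / (ε * h x) ^ 2 * (N - 2 / (ε * h x) *
      (∫ y in (0 : ℝ)..l, ψ (x, y) * sin (π * y / (ε * h x))) ^ 2) :=
      mul_nonneg (by positivity) (by linarith)
    linarith
  have k4 : excess h ε M x * t ≤ excess h ε M x * N := mul_le_mul_of_nonneg_left g1 hQ
  have k5 := mul_le_mul_of_nonneg_left (k4.trans (by linarith :
    excess h ε M x * N ≤ Y - π ^ 2 / l ^ 2 * N)) (by linarith : 0 ≤ 1 - δ)
  have k6 := mul_le_mul_of_nonneg_left (by linarith :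
    2 / l ^ 2 * (N - t) ≤ Y - π ^ 2 / l ^ 2 * N) hδ
  linarith

theorem setIntegral_strip_eq {g : ℝ × ℝ → ℝ} (hg : Continuous g) (hgs : HasCompactSupport g)
    (hgt : tsupport g ⊆ strip h ε) (hε : 0 < ε) (hM : ∀ x, h x ≤ M) :
    ∫ p in strip h ε, g p = ∫ x, ∫ y in (0 : ℝ)..(ε * M), g (x, y) := by
  rw [setIntegral_eq_integral_of_forall_compl_eq_zero fun p hp =>
    image_eq_zero_of_notMem_tsupport fun h => hp (hgt h)]
  refine integral_eq_iterated hg hgs fun p hp => ?_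
  have := hgt (subset_tsupport _ hp)
  exact ⟨this.1, this.2.le.trans (by have := hM p.1; gcongr)⟩

/-- The energy of a test function `ψ` in the strip is bounded below by a one-dimensional energy of
its first transversal coefficient `χ`, plus a multiple of `(‖ψ‖² - ‖χ‖²) / ε²`. -/
theorem energy_ge (hε : 0 < ε) (hc : Continuous h) (hpos : ∀ x, 0 < h x) (hM : ∀ x, h x ≤ M)
    {ψ : ℝ × ℝ → ℝ} (hψ : ContDiff ℝ ∞ ψ) (hψs : HasCompactSupport ψ)
    (hψt : tsupport ψ ⊆ strip h ε) {δ : ℝ} (hδ : 0 ≤ δ) (hδ1 : δ ≤ 1) :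
    ∫ x, transMean (ε * M) ψ x ^ 2 ≤ ∫ p in strip h ε, ψ p ^ 2 ∧
    (∫ x, deriv (transMean (ε * M) ψ) x ^ 2) +
      π ^ 2 / (ε * M) ^ 2 * (∫ p in strip h ε, ψ p ^ 2) +
      (1 - δ) * (∫ x, excess h ε M x * transMean (ε * M) ψ x ^ 2) +
      δ * (2 / (ε * M) ^ 2) *
        ((∫ p in strip h ε, ψ p ^ 2) - ∫ x, transMean (ε * M) ψ x ^ 2) ≤
    (∫ p in strip h ε, (fderiv ℝ ψ p (1, 0)) ^ 2) +
      ∫ p in strip h ε, (fderiv ℝ ψ p (0, 1)) ^ 2 := by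
  have hMp : 0 < M := (hpos 0).trans_le (hM 0)
  set l := ε * M with hl
  have hψ1 : ContDiff ℝ 1 ψ := hψ.of_le (by simp)
  have hdc : ∀ v, Continuous fun p => fderiv ℝ ψ p v := fun v =>
    (hψ1.continuous_fderiv one_ne_zero).clm_apply continuous_const
  have hds : ∀ v, HasCompactSupport fun p => fderiv ℝ ψ p v := fun v => hψs.fderiv_apply ℝ v
  have hdt : ∀ v, tsupport (fun p => fderiv ℝ ψ p v) ⊆ strip h ε := fun v =>
    (tsupport_fderiv_apply_subset ℝ v).trans hψt
  have sqc : ∀ {X : Type} [TopologicalSpace X] {g : X → ℝ}, HasCompactSupport g →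
      HasCompactSupport fun p => g p ^ 2 := fun {X} _ {g} hg =>
    hg.comp_left (g := fun t : ℝ => t ^ 2) (by simp)
  have sqt : ∀ {g : ℝ × ℝ → ℝ}, tsupport g ⊆ strip h ε → tsupport (fun p => g p ^ 2) ⊆ strip h ε :=
    fun {g} hg => (closure_mono fun p hp => by
      simpa using hp).trans hg
  have e : ∀ {g : ℝ × ℝ → ℝ}, Continuous g → HasCompactSupport g → tsupport g ⊆ strip h ε →
      ∫ p in strip h ε, g p ^ 2 = ∫ x, ∫ y in (0 : ℝ)..l, g (x, y) ^ 2 := fun h1 h2 h3 =>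
    setIntegral_strip_eq (h1.pow 2) (sqc h2) (sqt h3) hε hM
  have i : ∀ {g : ℝ × ℝ → ℝ}, Continuous g → HasCompactSupport g →
      Integrable fun x => ∫ y in (0 : ℝ)..l, g (x, y) ^ 2 := fun h1 h2 =>
    (continuous_intervalIntegral_slice (h1.pow 2) 0 l).integrable_of_hasCompactSupport
      (hasCompactSupport_intervalIntegral_slice (sqc h2) 0 l)
  rw [e hψ.continuous hψs hψt, e (hdc _) (hds _) (hdt _), e (hdc _) (hds _) (hdt _)]
  have hχ := contDiff_transMean hψ1 hψs l
  have hχs := hasCompactSupport_transMean hψs l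
  have hχd : Continuous (deriv (transMean l ψ)) := hχ.continuous_deriv le_rfl
  have j1 : Integrable fun x => transMean l ψ x ^ 2 :=
    (hχ.continuous.pow 2).integrable_of_hasCompactSupport (sqc hχs)
  have j2 : Integrable fun x => deriv (transMean l ψ) x ^ 2 :=
    (hχd.pow 2).integrable_of_hasCompactSupport (sqc hχs.deriv)
  have j3 : Integrable fun x => excess h ε M x * transMean l ψ x ^ 2 :=
    ((continuous_excess hε hc hpos M).mul (hχ.continuous.pow 2)).integrable_of_hasCompactSupport
      (sqc hχs).mul_left
  have hsl := slice_energy_le hε hpos hM hψ hψs hψt hδ hδ1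
  refine ⟨integral_mono j1 (i hψ.continuous hψs) fun x => (hsl x).1, ?_⟩
  have iN := i hψ.continuous hψs
  have iX := i (hdc (1, 0)) (hds (1, 0))
  have iY := i (hdc (0, 1)) (hds (0, 1))
  have s1 : Integrable fun x => deriv (transMean l ψ) x ^ 2 +
      π ^ 2 / l ^ 2 * ∫ y in (0 : ℝ)..l, ψ (x, y) ^ 2 := j2.add (iN.const_mul _)
  have s2 : Integrable fun x => (deriv (transMean l ψ) x ^ 2 +
      π ^ 2 / l ^ 2 * ∫ y in (0 : ℝ)..l, ψ (x, y) ^ 2) +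
      (1 - δ) * (excess h ε M x * transMean l ψ x ^ 2) := s1.add (j3.const_mul _)
  have s3 : Integrable fun x => δ * (2 / l ^ 2) *
      ((∫ y in (0 : ℝ)..l, ψ (x, y) ^ 2) - transMean l ψ x ^ 2) := (iN.sub j1).const_mul _
  have key := integral_mono (s2.add s3) (iX.add iY) fun x => (hsl x).2
  simp only [Pi.add_apply] at key
  rw [integral_add s2 s3, integral_add s1 (j3.const_mul _), integral_add j2 (iN.const_mul _),
    integral_const_mul, integral_const_mul, integral_const_mul, integral_sub iN j1,
    integral_add iX iY] at key
  exact key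

end Reduction

/-! ### The form of the Dirichlet Laplacian up to finitely many functionals -/

section StripDefect
open Real

variable {h : ℝ → ℝ} {ε M : ℝ}

/-- Integrals of the first transversal coefficient over intervals are bounded functionals on
`L²` of the strip. -/
theorem exists_inner_eq_integral_transMean (hε : 0 < ε) (hM : ∀ x, h x ≤ M)
    {a b : ℝ} (hab : a ≤ b) : ∃ g : Lp ℝ 2 (volume.restrict (strip h ε)),
      ∀ (w : Lp ℝ 2 (volume.restrict (strip h ε))) (ψ : ℝ × ℝ → ℝ), Continuous ψ →
        HasCompactSupport ψ → tsupport ψ ⊆ strip h ε → w =ᵐ[volume.restrict (strip h ε)] ψ →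
        inner ℝ g w = ∫ x in a..b, transMean (ε * M) ψ x := by
  set l := ε * M with hl
  set S : Set (ℝ × ℝ) := Set.Ioc a b ×ˢ Set.univ with hS
  have hSm : MeasurableSet S := measurableSet_Ioc.prod MeasurableSet.univ
  set F : ℝ × ℝ → ℝ := fun p => √(2 / l) * sin (π * p.2 / l) with hF
  have hFc : Continuous F := by fun_prop
  have hmem : MemLp (S.indicator F) 2 (volume.restrict (strip h ε)) := by
    rw [memLp_indicator_iff_restrict hSm, Measure.restrict_restrict hSm]
    have hfin : volume (S ∩ strip h ε) ≠ ⊤ := by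
      refine ne_top_of_le_ne_top (b := volume (Set.Ioc a b ×ˢ Set.Ioc 0 l)) ?_ (measure_mono ?_)
      · rw [Measure.volume_eq_prod, Measure.prod_prod]
        exact ENNReal.mul_ne_top (by simp) (by simp)
      · rintro ⟨x, y⟩ ⟨h1, h2⟩
        refine ⟨h1.1, h2.1, h2.2.le.trans ?_⟩
        rw [hl]
        have := hM x
        gcongr
    have : IsFiniteMeasure (volume.restrict (S ∩ strip h ε)) := ⟨by simpa using hfin.lt_top⟩
    refine MemLp.of_bound hFc.aestronglyMeasurable (√(2 / l)) (ae_of_all _ fun p => ?_)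
    rw [norm_mul, Real.norm_of_nonneg (Real.sqrt_nonneg _)]
    exact mul_le_of_le_one_right (Real.sqrt_nonneg _) (abs_sin_le_one _)
  refine ⟨hmem.toLp, fun w ψ h1 h2 h3 h4 => ?_⟩
  rw [inner_Lp_eq_integral hmem.coeFn_toLp h4,
    setIntegral_eq_integral_of_forall_compl_eq_zero fun p hp => by
      rw [image_eq_zero_of_notMem_tsupport fun h => hp (h3 h), mul_zero]]
  have e1 : ∀ p, S.indicator F p * ψ p = S.indicator (fun p => F p * ψ p) p := fun p => by
    by_cases hp : p ∈ S <;> simp [hp]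
  simp only [e1]
  have hi : Integrable (fun p => F p * ψ p) :=
    (hFc.mul h1).integrable_of_hasCompactSupport h2.mul_left
  rw [Measure.volume_eq_prod, integral_prod _ (by
    rw [← Measure.volume_eq_prod]; exact hi.indicator hSm), intervalIntegral.integral_of_le hab,
    ← integral_indicator measurableSet_Ioc]
  congr 1
  ext x
  by_cases hx : x ∈ Set.Ioc a b
  · rw [Set.indicator_of_mem hx, transMean, ← intervalIntegral.integral_const_mul,
      intervalIntegral.integral_eq_integral_of_support_subset]
    · congr 1
      ext y
      rw [Set.indicator_of_mem (by exact ⟨hx, Set.mem_univ _⟩), hF]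
      ring
    · intro y hy
      have hy' : ψ (x, y) ≠ 0 := fun h0 => hy (by simp [h0])
      have := h3 (subset_tsupport _ hy')
      refine ⟨this.1, this.2.le.trans ?_⟩
      rw [hl]
      have := hM x
      gcongr
  · rw [Set.indicator_of_notMem hx]
    have : ∀ y, S.indicator (fun p => F p * ψ p) (x, y) = 0 := fun y =>
      Set.indicator_of_notMem (fun h => hx h.1) _
    simp [this]

/-- Where `|x| ≥ R` the excess bounds the energy, and where `|x| ≤ R` the Poincaré inequality for
the first transversal coefficient does, up to finitely many functionals. The gap takes care of the
other transversal modes. -/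
theorem formDefect_testTriples (hε : 0 < ε) (hc : Continuous h) (hpos : ∀ x, 0 < h x)
    (hM : ∀ x, h x ≤ M) {κ R : ℝ} (hR : 0 < R) (hκ0 : 0 ≤ κ)
    (hκ : ∀ x, R ≤ |x| → κ ≤ excess h ε M x) (hκ2 : κ ≤ 2 / (ε * M) ^ 2) :
    FormDefect (testTriples (strip h ε)) (π ^ 2 / (ε * M) ^ 2 + κ / 2) := by
  obtain ⟨n, C, a, hC, ha, hP⟩ := exists_partition_poincare (κ / 2) R (by positivity) hR
  choose g hg using fun k : ℕ => exists_inner_eq_integral_transMean (h := h) hε hM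
    (ha (Nat.le_succ k))
  refine ⟨n, fun k => √C • g k, ?_⟩
  rintro w ⟨ψ, h1, h2, h3, e1, e2, e3⟩
  have hψ1 : ContDiff ℝ 1 ψ := h1.of_le (by simp)
  obtain ⟨E1, E2⟩ := energy_ge hε hc hpos hM h1 h2 h3 (δ := 1 / 2) (by norm_num) (by norm_num)
  rw [norm_sq_Lp_eq_integral e1, norm_sq_Lp_eq_integral e2, norm_sq_Lp_eq_integral e3]
  have es : ∑ i : Fin n, inner ℝ (√C • g i) w.1 ^ 2
      = C * ∑ k ∈ Finset.range n, (∫ x in (a k)..(a (k + 1)), transMean (ε * M) ψ x) ^ 2 := by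
    rw [Finset.mul_sum, Finset.sum_range]
    refine Finset.sum_congr rfl fun i _ => ?_
    rw [real_inner_smul_left, mul_pow, Real.sq_sqrt hC, hg i w.1 ψ h1.continuous h2 h3 e1]
  rw [es]
  have hχ := contDiff_transMean hψ1 h2 (ε * M)
  have hχs := hasCompactSupport_transMean h2 (ε * M)
  set χ := transMean (ε * M) ψ with hχdef
  have key := hP χ hχ hχs
  have hQc := continuous_excess hε hc hpos M
  have hsupp : ∀ {g : ℝ → ℝ}, Continuous g → Integrable fun x => g x * χ x ^ 2 := by
    intro g hg
    refine (hg.mul (hχ.continuous.pow 2)).integrable_of_hasCompactSupport ?_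
    have := (hχs.mul_left (f' := χ) (f := χ)).mul_left (f := g)
    simpa only [sq] using this
  have hmain : κ * ∫ x, χ x ^ 2 ≤ (∫ x, excess h ε M x * χ x ^ 2) +
      κ * ∫ x in (-R)..R, χ x ^ 2 := by
    have i1 : Integrable fun x => χ x ^ 2 := by simpa using hsupp (g := fun _ => 1) continuous_const
    rw [intervalIntegral.integral_of_le (by linarith), ← integral_const_mul,
      ← integral_indicator measurableSet_Ioc, ← integral_const_mul]
    have i2 := hsupp hQc
    rw [← integral_add i2 ((i1.indicator measurableSet_Ioc).const_mul _)]
    refine integral_mono (i1.const_mul _)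
      (i2.add ((i1.indicator measurableSet_Ioc).const_mul _)) fun x => ?_
    have hn := sq_nonneg (χ x)
    have hQ := excess_nonneg hε hpos hM x
    by_cases hx : x ∈ Set.Ioc (-R) R
    · simp only [Set.indicator_of_mem hx]
      linarith [mul_nonneg hQ hn]
    · simp only [Set.indicator_of_notMem hx]
      have : R ≤ |x| := by
        by_contra! hlt
        exact hx ⟨(abs_lt.1 hlt).1, (abs_lt.1 hlt).2.le⟩
      linarith [mul_le_mul_of_nonneg_right (hκ x this) hn]
  have hgap := mul_le_mul_of_nonneg_right hκ2 (sub_nonneg.2 E1)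
  linarith

end StripDefect

/-! ### Negative subspaces in terms of functions -/

section Functions

theorem coeFn_sum_smul {X : Type*} [MeasurableSpace X] {μ : Measure X} {k : ℕ}
    {f : Fin k → Lp ℝ 2 μ} {φ : Fin k → X → ℝ} (hf : ∀ i, f i =ᵐ[μ] φ i) (c : Fin k → ℝ) :
    (∑ i, c i • f i : Lp ℝ 2 μ) =ᵐ[μ] fun x => ∑ i, c i * φ i x := by
  have h1 : (∑ i, c i • f i : Lp ℝ 2 μ) =ᵐ[μ] ∑ i, (c i • f i : Lp ℝ 2 μ) :=
    Lp.coeFn_finsetSum _ _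
  have h2 : ∀ᵐ x ∂μ, ∀ i, (c i • f i : Lp ℝ 2 μ) x = c i * φ i x := by
    rw [ae_all_iff]
    intro i
    filter_upwards [Lp.coeFn_smul (c i) (f i), hf i] with x a b
    rw [a, Pi.smul_apply, b, smul_eq_mul]
  filter_upwards [h1, h2] with x a b
  rw [a, Finset.sum_apply]
  exact Finset.sum_congr rfl fun i _ => b i

theorem fderiv_sum_mul {k : ℕ} {φ : Fin k → ℝ × ℝ → ℝ} (hφ : ∀ i, Differentiable ℝ (φ i))
    (c : Fin k → ℝ) (p v : ℝ × ℝ) :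
    fderiv ℝ (fun p => ∑ i, c i * φ i p) p v = ∑ i, c i * fderiv ℝ (φ i) p v := by
  have : HasFDerivAt (fun p => ∑ i, c i * φ i p) (∑ i, c i • fderiv ℝ (φ i) p) p :=
    HasFDerivAt.fun_sum fun i _ => (hφ i p).hasFDerivAt.const_mul (c i)
  rw [this.fderiv]
  simp

theorem deriv_sum_mul {k : ℕ} {φ : Fin k → ℝ → ℝ} (hφ : ∀ i, Differentiable ℝ (φ i))
    (c : Fin k → ℝ) (x : ℝ) :
    deriv (fun x => ∑ i, c i * φ i x) x = ∑ i, c i * deriv (φ i) x :=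
  (HasDerivAt.fun_sum fun i _ => (hφ i x).hasDerivAt.const_mul (c i)).deriv

theorem sum_smul_triple {H : Type*} [NormedAddCommGroup H] [InnerProductSpace ℝ H] {k : ℕ}
    (Φ : Fin k → H × H × H) (c : Fin k → ℝ) : ∑ i, c i • Φ i =
      (∑ i, c i • (Φ i).1, ∑ i, c i • (Φ i).2.1, ∑ i, c i • (Φ i).2.2) := by
  ext <;> simp [Prod.fst_sum, Prod.snd_sum]

/-- For test functions the condition `NegTriples` is one on their Dirichlet integrals. -/
theorem negTriples_testTriples_iff {Ω : Set (ℝ × ℝ)} {k : ℕ} {s : ℝ} :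
    NegTriples (testTriples Ω) k s ↔ ∃ ψ : Fin k → ℝ × ℝ → ℝ,
      (∀ i, ContDiff ℝ ∞ (ψ i) ∧ HasCompactSupport (ψ i) ∧ tsupport (ψ i) ⊆ Ω) ∧
      ∀ c : Fin k → ℝ, c ≠ 0 →
        (∫ p in Ω, (fderiv ℝ (fun p => ∑ i, c i * ψ i p) p (1, 0)) ^ 2) +
          (∫ p in Ω, (fderiv ℝ (fun p => ∑ i, c i * ψ i p) p (0, 1)) ^ 2) <
        s * ∫ p in Ω, (∑ i, c i * ψ i p) ^ 2 := by
  have key : ∀ (Φ : Fin k → Lp ℝ 2 (volume.restrict Ω) × Lp ℝ 2 (volume.restrict Ω) ×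
      Lp ℝ 2 (volume.restrict Ω)) (ψ : Fin k → ℝ × ℝ → ℝ), (∀ i, ContDiff ℝ ∞ (ψ i)) →
      (∀ i, (Φ i).1 =ᵐ[volume.restrict Ω] ψ i) →
      (∀ i, (Φ i).2.1 =ᵐ[volume.restrict Ω] fun p => fderiv ℝ (ψ i) p (1, 0)) →
      (∀ i, (Φ i).2.2 =ᵐ[volume.restrict Ω] fun p => fderiv ℝ (ψ i) p (0, 1)) →
      ∀ c : Fin k → ℝ, (‖(∑ i, c i • Φ i).2.1‖ ^ 2 + ‖(∑ i, c i • Φ i).2.2‖ ^ 2 <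
        s * ‖(∑ i, c i • Φ i).1‖ ^ 2 ↔
        (∫ p in Ω, (fderiv ℝ (fun p => ∑ i, c i * ψ i p) p (1, 0)) ^ 2) +
          (∫ p in Ω, (fderiv ℝ (fun p => ∑ i, c i * ψ i p) p (0, 1)) ^ 2) <
        s * ∫ p in Ω, (∑ i, c i * ψ i p) ^ 2) := by
    intro Φ ψ hψ h1 h2 h3 c
    have hd : ∀ i, Differentiable ℝ (ψ i) := fun i => (hψ i).differentiable (by simp)
    rw [sum_smul_triple, norm_sq_Lp_eq_integral (coeFn_sum_smul h1 c),
      norm_sq_Lp_eq_integral (coeFn_sum_smul h2 c), norm_sq_Lp_eq_integral (coeFn_sum_smul h3 c)]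
    simp only [fderiv_sum_mul hd]
  constructor
  · rintro ⟨Φ, hΦ, hneg⟩
    choose ψ h1 h2 h3 h4 h5 h6 using hΦ
    exact ⟨ψ, fun i => ⟨h1 i, h2 i, h3 i⟩, fun c hc => (key Φ ψ h1 h4 h5 h6 c).1 (hneg c hc)⟩
  · rintro ⟨ψ, hψ, hneg⟩
    have hex : ∀ i, ∃ w ∈ testTriples Ω, w.1 =ᵐ[volume.restrict Ω] ψ i ∧
        w.2.1 =ᵐ[volume.restrict Ω] (fun p => fderiv ℝ (ψ i) p (1, 0)) ∧
        w.2.2 =ᵐ[volume.restrict Ω] (fun p => fderiv ℝ (ψ i) p (0, 1)) := by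
      intro i
      obtain ⟨h1, h2, h3⟩ := hψ i
      have hd : Continuous (fderiv ℝ (ψ i)) := h1.continuous_fderiv (by simp)
      have m0 : MemLp (ψ i) 2 (volume.restrict Ω) := h1.continuous.memLp_of_hasCompactSupport h2
      have m1 : MemLp (fun p => fderiv ℝ (ψ i) p (1, 0)) 2 (volume.restrict Ω) :=
        (hd.clm_apply continuous_const).memLp_of_hasCompactSupport (h2.fderiv_apply ℝ (1, 0))
      have m2 : MemLp (fun p => fderiv ℝ (ψ i) p (0, 1)) 2 (volume.restrict Ω) :=
        (hd.clm_apply continuous_const).memLp_of_hasCompactSupport (h2.fderiv_apply ℝ (0, 1))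
      exact ⟨(m0.toLp, m1.toLp, m2.toLp),
        ⟨ψ i, h1, h2, h3, m0.coeFn_toLp, m1.coeFn_toLp, m2.coeFn_toLp⟩,
        m0.coeFn_toLp, m1.coeFn_toLp, m2.coeFn_toLp⟩
    choose Φ hΦ h1 h2 h3 using hex
    exact ⟨Φ, hΦ, fun c hc => (key Φ ψ (fun i => (hψ i).1) h1 h2 h3 c).2 (hneg c hc)⟩

theorem schrodinger_negative_iff {q : ℝ → ℝ} (hq0 : ∀ x, 0 ≤ q x) {k : ℕ} {s : ℝ}
    {Φ : Fin k → Lp ℝ 2 (volume : Measure ℝ) × Lp ℝ 2 (volume : Measure ℝ) ×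
      Lp ℝ 2 (volume : Measure ℝ)} {u : Fin k → ℝ → ℝ} (hu : ∀ i, ContDiff ℝ 1 (u i))
    (h1 : ∀ i, (Φ i).1 =ᵐ[volume] u i) (h2 : ∀ i, (Φ i).2.1 =ᵐ[volume] deriv (u i))
    (h3 : ∀ i, (Φ i).2.2 =ᵐ[volume] fun x => √(q x) * u i x) (c : Fin k → ℝ) :
    ‖(∑ i, c i • Φ i).2.1‖ ^ 2 + ‖(∑ i, c i • Φ i).2.2‖ ^ 2 < s * ‖(∑ i, c i • Φ i).1‖ ^ 2 ↔
      (∫ x, deriv (fun x => ∑ i, c i * u i x) x ^ 2) + (∫ x, q x * (∑ i, c i * u i x) ^ 2) <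
        s * ∫ x, (∑ i, c i * u i x) ^ 2 := by
  have hd : ∀ i, Differentiable ℝ (u i) := fun i => (hu i).differentiable one_ne_zero
  rw [sum_smul_triple, norm_sq_Lp_eq_integral (coeFn_sum_smul h1 c),
    norm_sq_Lp_eq_integral (coeFn_sum_smul h2 c), norm_sq_Lp_eq_integral (coeFn_sum_smul h3 c)]
  simp only [deriv_sum_mul hd]
  have : ∀ x, (∑ i, c i * (√(q x) * u i x)) ^ 2 = q x * (∑ i, c i * u i x) ^ 2 := fun x => by
    rw [← Real.sq_sqrt (hq0 x), ← mul_pow, Real.sq_sqrt (hq0 x), Finset.mul_sum]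
    simp only [mul_left_comm]
  simp only [this]

theorem negTriples_schrodingerForm {q : ℝ → ℝ} (hq : Continuous q) (hq0 : ∀ x, 0 ≤ q x)
    {k : ℕ} {s : ℝ} {u : Fin k → ℝ → ℝ} (hu : ∀ i, ContDiff ℝ 1 (u i))
    (hus : ∀ i, HasCompactSupport (u i))
    (h : ∀ c : Fin k → ℝ, c ≠ 0 →
      (∫ x, deriv (fun x => ∑ i, c i * u i x) x ^ 2) + (∫ x, q x * (∑ i, c i * u i x) ^ 2) <
        s * ∫ x, (∑ i, c i * u i x) ^ 2) : NegTriples (schrodingerForm q) k s := by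
  have hd : ∀ i, Continuous (deriv (u i)) := fun i => (hu i).continuous_deriv le_rfl
  have m0 : ∀ i, MemLp (u i) 2 (volume : Measure ℝ) := fun i =>
    (hu i).continuous.memLp_of_hasCompactSupport (hus i)
  have m1 : ∀ i, MemLp (deriv (u i)) 2 (volume : Measure ℝ) := fun i =>
    (hd i).memLp_of_hasCompactSupport (hus i).deriv
  have m2 : ∀ i, MemLp (fun x => √(q x) * u i x) 2 (volume : Measure ℝ) := fun i =>
    (hq.sqrt.mul (hu i).continuous).memLp_of_hasCompactSupport (hus i).mul_left
  exact ⟨fun i => ((m0 i).toLp, (m1 i).toLp, (m2 i).toLp),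
    fun i => mem_schrodingerForm_of_contDiff (hu i) (m0 i).coeFn_toLp (m1 i).coeFn_toLp
      (m2 i).coeFn_toLp,
    fun c hc => (schrodinger_negative_iff hq0 hu (fun i => (m0 i).coeFn_toLp)
      (fun i => (m1 i).coeFn_toLp) (fun i => (m2 i).coeFn_toLp) c).2 (h c hc)⟩

/-- Negative subspaces of the Schrödinger form can be chosen to consist of test functions. -/
theorem NegTriples.exists_contDiff {q : ℝ → ℝ} (hq : Continuous q) (hq0 : ∀ x, 0 ≤ q x)
    {k : ℕ} {s : ℝ} (h : NegTriples (schrodingerForm q) k s) : ∃ u : Fin k → ℝ → ℝ,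
      (∀ i, ContDiff ℝ ∞ (u i) ∧ HasCompactSupport (u i)) ∧ ∀ c : Fin k → ℝ, c ≠ 0 →
      (∫ x, deriv (fun x => ∑ i, c i * u i x) x ^ 2) + (∫ x, q x * (∑ i, c i * u i x) ^ 2) <
        s * ∫ x, (∑ i, c i * u i x) ^ 2 := by
  obtain ⟨Φ, hΦ, hneg⟩ := h
  obtain ⟨Ψ, hΨ, hneg⟩ : NegTriples (schrodingerCore q) k s := NegTriples.of_closure
    ⟨Φ, fun i => schrodingerForm_le_closure_core hq hq0 (hΦ i), hneg⟩
  choose u h1 h2 h3 h4 h5 using hΨ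
  exact ⟨u, fun i => ⟨h1 i, h2 i⟩, fun c hc => (schrodinger_negative_iff hq0
    (fun i => (h1 i).of_le (by simp)) h3 h4 h5 c).1 (hneg c hc)⟩

end Functions

/-! ### Comparison with the Schrödinger form from below -/

section LowerBound
open Real

theorem exists_cutoff : ∃ C : ℝ, 0 < C ∧ ∀ R : ℝ, 0 < R → ∃ η : ℝ → ℝ, ContDiff ℝ 1 η ∧
    (∀ x, 0 ≤ η x) ∧ (∀ x, η x ≤ 1) ∧ (∀ x, |x| ≤ R → η x = 1) ∧
    (∀ x, 2 * R ≤ |x| → η x = 0) ∧ ∀ x, |deriv η x| ≤ C / R := by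
  let b : ContDiffBump (0 : ℝ) := ⟨1, 2, one_pos, one_lt_two⟩
  have hb : ContDiff ℝ 1 b := b.contDiff
  obtain ⟨C, hC⟩ := (hb.continuous_deriv le_rfl).bounded_above_of_compact_support
    b.hasCompactSupport.deriv
  refine ⟨max C 1, by positivity, fun R hR => ⟨fun x => b (R⁻¹ * x), hb.comp (by fun_prop),
    fun x => b.nonneg, fun x => b.le_one, fun x hx => ?_, fun x hx => ?_, fun x => ?_⟩⟩
  · refine b.one_of_mem_closedBall ?_
    rw [mem_closedBall_zero_iff, Real.norm_eq_abs, abs_mul, abs_of_pos (inv_pos.2 hR)]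
    change R⁻¹ * |x| ≤ 1
    rw [inv_mul_le_iff₀ hR]
    linarith
  · refine b.zero_of_le_dist ?_
    rw [dist_zero_right, Real.norm_eq_abs, abs_mul, abs_of_pos (inv_pos.2 hR)]
    change 2 ≤ R⁻¹ * |x|
    rw [le_inv_mul_iff₀ hR]
    linarith
  · rw [deriv_comp_mul_left R⁻¹ b x, smul_eq_mul, abs_mul, abs_of_pos (inv_pos.2 hR),
      div_eq_inv_mul]
    exact mul_le_mul_of_nonneg_left ((hC _).trans (le_max_left _ _)) (inv_pos.2 hR).le

theorem integrable_mul_sq {g χ : ℝ → ℝ} (hg : Continuous g) (hχ : Continuous χ)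
    (hχs : HasCompactSupport χ) : Integrable fun x => g x * χ x ^ 2 := by
  have h1 : HasCompactSupport fun x => χ x ^ 2 := by
    simp only [sq]
    exact hχs.mul_left
  exact (hg.mul (hχ.pow 2)).integrable_of_hasCompactSupport h1.mul_left

theorem add_sq_le_mul {δ : ℝ} (hδ : 0 < δ) (x y : ℝ) :
    (x + y) ^ 2 ≤ (1 + δ) * x ^ 2 + (1 + δ⁻¹) * y ^ 2 := by
  have h1 : 0 ≤ δ⁻¹ * (δ * x - y) ^ 2 := by positivity
  have h2 : δ⁻¹ * (δ * x - y) ^ 2 = δ * x ^ 2 - 2 * x * y + δ⁻¹ * y ^ 2 := by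
    field_simp
    ring
  linarith

/-- Cutting off a function of low energy: if the potential `W` dominates `(1 - δ) q` where the
cutoff `η` lives and is large where `η ≠ 1`, little is lost in passing from `χ` and `W` to
`η χ` and `q`. -/
theorem cutoff_form_lt {q W χ η : ℝ → ℝ} (hq : Continuous q) (hW : Continuous W)
    (hW0 : ∀ x, 0 ≤ W x) (hχ : ContDiff ℝ 1 χ) (hχs : HasCompactSupport χ) (hη : ContDiff ℝ 1 η)
    (hη0 : ∀ x, 0 ≤ η x) (hη1 : ∀ x, η x ≤ 1) {R R' B D δ r s s' : ℝ}
    (hηR : ∀ x, |x| ≤ R → η x = 1) (hηR' : ∀ x, R' ≤ |x| → η x = 0)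
    (hηd : ∀ x, |deriv η x| ≤ D) (hδ : 0 < δ) (hr : 0 < r) (hδr : r * (1 - δ) = 1) (hB : 0 < B)
    (hs' : 0 ≤ s') (h1 : ∀ x, |x| ≤ R' → (1 - δ) * q x ≤ W x) (h2 : ∀ x, R ≤ |x| → B ≤ W x)
    (hnum : (1 + δ) * r ^ 2 * s + (1 + δ⁻¹) * D ^ 2 ≤ s' * (1 - r * s * B⁻¹))
    (hneg : (∫ x, deriv χ x ^ 2) + (1 - δ) * (∫ x, W x * χ x ^ 2) < s * ∫ x, χ x ^ 2) :
    (∫ x, deriv (fun x => η x * χ x) x ^ 2) + (∫ x, q x * (η x * χ x) ^ 2) <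
      s' * ∫ x, (η x * χ x) ^ 2 := by
  have hu : ContDiff ℝ 1 fun x => η x * χ x := hη.mul hχ
  have hus : HasCompactSupport fun x => η x * χ x := hχs.mul_left
  have hχd : Continuous (deriv χ) := hχ.continuous_deriv le_rfl
  have hud : Continuous (deriv fun x => η x * χ x) := hu.continuous_deriv le_rfl
  have hone : Continuous fun _ : ℝ => (1 : ℝ) := continuous_const
  have iY : Integrable fun x => χ x ^ 2 := by
    simpa using integrable_mul_sq hone hχ.continuous hχs
  have iE : Integrable fun x => deriv χ x ^ 2 := by
    simpa using integrable_mul_sq hone hχd hχs.deriv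
  have iV := integrable_mul_sq hW hχ.continuous hχs
  have iu : Integrable fun x => (η x * χ x) ^ 2 := by
    simpa using integrable_mul_sq hone hu.continuous hus
  have iud : Integrable fun x => deriv (fun x => η x * χ x) x ^ 2 := by
    simpa using integrable_mul_sq hone hud hus.deriv
  have iuq := integrable_mul_sq hq hu.continuous hus
  have hD0 : 0 ≤ D := (abs_nonneg _).trans (hηd 0)
  have hr1 : 1 ≤ r := by nlinarith
  have p1 : ∀ x, deriv (fun x => η x * χ x) x ^ 2 ≤
      (1 + δ) * deriv χ x ^ 2 + (1 + δ⁻¹) * D ^ 2 * χ x ^ 2 := by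
    intro x
    rw [deriv_fun_mul (hη.differentiable one_ne_zero x) (hχ.differentiable one_ne_zero x),
      add_comm]
    refine (add_sq_le_mul hδ _ _).trans ?_
    rw [mul_pow, mul_pow, mul_assoc]
    have e1 : η x ^ 2 ≤ 1 := pow_le_one₀ (hη0 x) (hη1 x)
    have e2 : deriv η x ^ 2 ≤ D ^ 2 := sq_le_sq' (abs_le.1 (hηd x)).1 (abs_le.1 (hηd x)).2
    have e3 : η x ^ 2 * deriv χ x ^ 2 ≤ deriv χ x ^ 2 := mul_le_of_le_one_left (sq_nonneg _) e1
    gcongr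
  have p2 : ∀ x, q x * (η x * χ x) ^ 2 ≤ r * (W x * χ x ^ 2) := by
    intro x
    rcases le_or_gt |x| R' with hx | hx
    · have e1 : η x ^ 2 ≤ 1 := pow_le_one₀ (hη0 x) (hη1 x)
      have e2 : q x ≤ r * W x := by
        have := mul_le_mul_of_nonneg_left (h1 x hx) hr.le
        rw [← mul_assoc, hδr, one_mul] at this
        exact this
      have e3 : 0 ≤ r * W x := mul_nonneg hr.le (hW0 x)
      calc q x * (η x * χ x) ^ 2 ≤ r * W x * (η x * χ x) ^ 2 := by gcongr
        _ = r * W x * χ x ^ 2 * η x ^ 2 := by ring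
        _ ≤ r * W x * χ x ^ 2 := mul_le_of_le_one_right (by positivity) e1
        _ = r * (W x * χ x ^ 2) := by ring
    · rw [hηR' x hx.le]
      have := hW0 x
      simp only [zero_mul, ne_eq, OfNat.ofNat_ne_zero, not_false_eq_true, zero_pow, mul_zero]
      positivity
  have p3 : ∀ x, χ x ^ 2 ≤ (η x * χ x) ^ 2 + B⁻¹ * (W x * χ x ^ 2) := by
    intro x
    have h0 := hW0 x
    rcases le_or_gt |x| R with hx | hx
    · rw [hηR x hx, one_mul]
      exact le_add_of_nonneg_right (by positivity)
    · have : 1 ≤ B⁻¹ * W x := by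
        rw [le_inv_mul_iff₀ hB, mul_one]
        exact h2 x hx.le
      nlinarith [sq_nonneg (η x * χ x), mul_le_mul_of_nonneg_right this (sq_nonneg (χ x))]
  have I1 := integral_mono iud ((iE.const_mul _).add (iY.const_mul _)) p1
  have I2 := integral_mono iuq (iV.const_mul r) p2
  have I3 := integral_mono iY (iu.add (iV.const_mul B⁻¹)) p3
  simp only [Pi.add_apply] at I1 I3
  rw [integral_add (iE.const_mul _) (iY.const_mul _), integral_const_mul, integral_const_mul] at I1
  rw [integral_const_mul] at I2
  rw [integral_add iu (iV.const_mul _), integral_const_mul] at I3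
  set Y := ∫ x, χ x ^ 2
  set E := ∫ x, deriv χ x ^ 2
  set V := ∫ x, W x * χ x ^ 2
  have hE : 0 ≤ E := integral_nonneg fun x => sq_nonneg _
  have hY : 0 ≤ Y := integral_nonneg fun x => sq_nonneg _
  have hV : 0 ≤ V := integral_nonneg fun x => mul_nonneg (hW0 x) (sq_nonneg _)
  have c1 : V ≤ r * s * Y := by
    have := mul_le_mul_of_nonneg_left hneg.le hr.le
    rw [mul_add, ← mul_assoc r (1 - δ), hδr] at this
    nlinarith [mul_nonneg hr.le hE]
  have c2 : (1 + δ) * E + r * V < (1 + δ) * r ^ 2 * s * Y := by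
    have e1 : (1 + δ) * r ^ 2 * (E + (1 - δ) * V) < (1 + δ) * r ^ 2 * (s * Y) := by gcongr
    have e2 : (1 + δ) * r ^ 2 * ((1 - δ) * V) = (1 + δ) * r * V := by
      linear_combination (1 + δ) * r * V * hδr
    have e3 : (1 + δ) * E ≤ (1 + δ) * r ^ 2 * E := by
      have : 1 ≤ r ^ 2 := one_le_pow₀ hr1
      have : (1 + δ) * 1 ≤ (1 + δ) * r ^ 2 := by gcongr
      nlinarith
    have e4 : 0 ≤ δ * r * V := by positivity
    linarith
  have c3 : Y * (1 - r * s * B⁻¹) ≤ ∫ x, (η x * χ x) ^ 2 := by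
    have : B⁻¹ * V ≤ B⁻¹ * (r * s * Y) := by gcongr
    linarith
  have c4 := mul_le_mul_of_nonneg_left c3 hs'
  have c5 := mul_le_mul_of_nonneg_right hnum hY
  linarith

/-- The numerical condition of `cutoff_form_lt` can be met, with room for the parameters of the
cutoff. -/
theorem exists_cutoff_parameters {s s' : ℝ} (hs : 0 < s) (hss' : s < s') :
    ∃ δ r B₀ D₀ : ℝ, 0 < δ ∧ δ < 1 ∧ 0 < r ∧ r * (1 - δ) = 1 ∧ 0 < B₀ ∧ 0 < D₀ ∧
      ∀ D, |D| ≤ D₀ → (1 + δ) * r ^ 2 * s + (1 + δ⁻¹) * D ^ 2 ≤ s' * (1 - r * s * B₀⁻¹) := by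
  have hcont : ContinuousAt (fun δ : ℝ => (1 + δ) * ((1 - δ)⁻¹) ^ 2 * s) 0 := by
    refine ContinuousAt.mul (ContinuousAt.mul (by fun_prop) ((ContinuousAt.inv₀ (by fun_prop)
      (by norm_num)).pow 2)) continuousAt_const
  have h1 : ∀ᶠ δ : ℝ in 𝓝 0, (1 + δ) * ((1 - δ)⁻¹) ^ 2 * s < (s + s') / 2 :=
    hcont.eventually_lt continuousAt_const (by norm_num; linarith)
  have h2 : ∀ᶠ δ : ℝ in 𝓝 0, δ < 1 := gt_mem_nhds one_pos
  obtain ⟨δ, ⟨hδ1, hδ2⟩, hδ0⟩ := ((h1.and h2).filter_mono nhdsWithin_le_nhds |>.and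
    (self_mem_nhdsWithin (s := Set.Ioi (0 : ℝ)))).exists
  have hδ0 : 0 < δ := hδ0
  have hg : 0 < (s' - s) / 4 := by linarith
  have hr : 0 < (1 - δ)⁻¹ := inv_pos.2 (by linarith)
  refine ⟨δ, (1 - δ)⁻¹, s' * (1 - δ)⁻¹ * s / ((s' - s) / 4),
    √((s' - s) / 4 / (1 + δ⁻¹)), hδ0, hδ2, hr, inv_mul_cancel₀ (by linarith), ?_, ?_, ?_⟩
  · have : 0 < s' := hs.trans hss'
    positivity
  · positivity
  · intro D hD
    have hs' : 0 < s' := hs.trans hss'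
    have e1 : D ^ 2 ≤ (s' - s) / 4 / (1 + δ⁻¹) := by
      rw [← Real.sq_sqrt (by positivity : 0 ≤ (s' - s) / 4 / (1 + δ⁻¹)), ← sq_abs D]
      gcongr
    have e2 : (1 + δ⁻¹) * D ^ 2 ≤ (s' - s) / 4 := by
      rwa [le_div_iff₀' (by positivity)] at e1
    have e3 : s' * ((1 - δ)⁻¹ * s * (s' * (1 - δ)⁻¹ * s / ((s' - s) / 4))⁻¹) = (s' - s) / 4 := by
      generalize (1 - δ)⁻¹ = r at hr
      have := hr.ne'
      field_simp
    linarith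

variable {h : ℝ → ℝ} {M : ℝ}

theorem excess_eq_div_sq (ε x : ℝ) : excess h ε M x = excess h 1 M x / ε ^ 2 := by
  rw [excess, excess, one_mul, one_mul, sub_div, div_div, div_div, mul_pow, mul_pow,
    mul_comm (ε ^ 2), mul_comm (ε ^ 2)]

/-- The scale `a = ε ^ α` on which the eigenfunctions live satisfies `a ^ m * a ^ 2 = ε ^ 2`. -/
theorem scale_rpow_mul_sq {ε m : ℝ} (hε : 0 < ε) (hm : 0 < m) :
    (ε ^ (2 / (m + 2))) ^ m * (ε ^ (2 / (m + 2))) ^ 2 = ε ^ 2 := by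
  rw [← Real.rpow_natCast (ε ^ (2 / (m + 2))) 2, ← Real.rpow_add (Real.rpow_pos_of_pos hε _),
    ← Real.rpow_mul hε.le, ← Real.rpow_natCast ε 2]
  congr 1
  push_cast
  field_simp

theorem tendsto_scale {m : ℝ} (hm : 0 < m) :
    Tendsto (fun ε : ℝ => ε ^ (2 / (m + 2))) (𝓝[>] 0) (𝓝[>] 0) := by
  refine tendsto_nhdsWithin_iff.2 ⟨?_, ?_⟩
  · have : ContinuousAt (fun ε : ℝ => ε ^ (2 / (m + 2))) 0 :=
      Real.continuousAt_rpow_const _ _ (Or.inr (by positivity))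
    have h0 := this.tendsto
    rw [Real.zero_rpow (by positivity)] at h0
    exact h0.mono_left nhdsWithin_le_nhds
  · filter_upwards [self_mem_nhdsWithin] with ε hε
    exact Real.rpow_pos_of_pos hε _

theorem sum_mul_test {k : ℕ} {Ω : Set (ℝ × ℝ)} {ψ : Fin k → ℝ × ℝ → ℝ}
    (hψ : ∀ i, ContDiff ℝ ∞ (ψ i) ∧ HasCompactSupport (ψ i) ∧ tsupport (ψ i) ⊆ Ω)
    (c : Fin k → ℝ) : ContDiff ℝ ∞ (fun p => ∑ i, c i * ψ i p) ∧
      HasCompactSupport (fun p => ∑ i, c i * ψ i p) ∧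
      tsupport (fun p => ∑ i, c i * ψ i p) ⊆ Ω := by
  have hK : IsCompact (⋃ i, tsupport (ψ i)) := isCompact_iUnion fun i => (hψ i).2.1
  have hsub : Function.support (fun p => ∑ i, c i * ψ i p) ⊆ ⋃ i, tsupport (ψ i) := by
    intro p hp
    obtain ⟨i, -, hi⟩ := Finset.exists_ne_zero_of_sum_ne_zero hp
    exact Set.mem_iUnion.2 ⟨i, subset_tsupport _ (right_ne_zero_of_mul hi)⟩
  exact ⟨ContDiff.sum fun i _ => contDiff_const.mul (hψ i).1,
    HasCompactSupport.of_support_subset_isCompact hK hsub,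
    (closure_minimal hsub hK.isClosed).trans (Set.iUnion_subset fun i => (hψ i).2.2)⟩

/-- A negative subspace for the strip at the rescaled energy `s` gives one for the limiting form at
any higher energy: take the first transversal coefficients, rescaled and cut off. -/
theorem eventually_negTriples_schrodingerForm (hc : Continuous h) (hpos : ∀ x, 0 < h x)
    (hM : ∀ x, h x ≤ M) {q : ℝ → ℝ} (hq : Continuous q) (hq0 : ∀ x, 0 ≤ q x) {m : ℝ} (hm : 0 < m)
    (hhom : ∀ a, 0 < a → ∀ x, q (a * x) = a ^ m * q x)
    (htop : ∀ B, ∃ R, ∀ x, R ≤ |x| → B ≤ q x)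
    (hnear : ∀ δ > 0, ∃ ρ > 0, ∀ x, |x| ≤ ρ → (1 - δ) * q x ≤ excess h 1 M x)
    (hfar : ∀ ρ > 0, ∃ κ > 0, ∀ x, ρ ≤ |x| → κ ≤ excess h 1 M x) {s s' : ℝ} (hss' : s < s')
    (k : ℕ) : ∀ᶠ ε : ℝ in 𝓝[>] 0,
      NegTriples (testTriples (strip h ε)) k
        (π ^ 2 / (ε * M) ^ 2 + s / (ε ^ (2 / (m + 2))) ^ 2) →
      NegTriples (schrodingerForm q) k s' := by
  have hMp : 0 < M := (hpos 0).trans_le (hM 0)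
  rcases le_or_gt s 0 with hs | hs
  · -- The energy of a test function is at least `π² / (ε M)²` times its norm square.
    filter_upwards [self_mem_nhdsWithin] with ε hε hneg
    have hε : 0 < ε := hε
    obtain ⟨ψ, hψ, hneg⟩ := negTriples_testTriples_iff.1 hneg
    refine negTriples_schrodingerForm hq hq0 (u := fun _ _ => 0) (fun _ => contDiff_const)
      (fun _ => HasCompactSupport.zero) fun c hc0 => ?_
    exfalso
    have h0 := hneg c hc0
    obtain ⟨h1, h2, h3⟩ := sum_mul_test hψ c
    obtain ⟨-, E⟩ := energy_ge hε hc hpos hM h1 h2 h3 le_rfl zero_le_one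
    have e1 : 0 ≤ ∫ x, deriv (transMean (ε * M) fun p => ∑ i, c i * ψ i p) x ^ 2 :=
      integral_nonneg fun x => sq_nonneg _
    have e2 : 0 ≤ ∫ x, excess h ε M x * (transMean (ε * M) (fun p => ∑ i, c i * ψ i p) x) ^ 2 :=
      integral_nonneg fun x => mul_nonneg (excess_nonneg hε hpos hM x) (sq_nonneg _)
    have e3 : 0 ≤ ∫ p in strip h ε, (∑ i, c i * ψ i p) ^ 2 :=
      integral_nonneg fun x => sq_nonneg _
    have e4 : s / (ε ^ (2 / (m + 2))) ^ 2 * ∫ p in strip h ε, (∑ i, c i * ψ i p) ^ 2 ≤ 0 :=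
      mul_nonpos_of_nonpos_of_nonneg (div_nonpos_of_nonpos_of_nonneg hs (sq_nonneg _)) e3
    linarith
  obtain ⟨δ, r, B, D₀, hδ, hδ1, hr, hδr, hB, hD₀, hnum⟩ := exists_cutoff_parameters hs hss'
  obtain ⟨C, hC, hcut⟩ := exists_cutoff
  obtain ⟨R₀, hR₀⟩ := htop (r * B)
  obtain ⟨R, hR, hRR, hRC⟩ : ∃ R, 0 < R ∧ R₀ ≤ R ∧ C / R ≤ D₀ := by
    refine ⟨max (C / D₀) R₀, lt_max_of_lt_left (by positivity), le_max_right _ _, ?_⟩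
    rw [div_le_iff₀ (lt_max_of_lt_left (by positivity)), ← div_le_iff₀' hD₀]
    exact le_max_left _ _
  obtain ⟨η, hη, hη0, hη1, hηR, hηR', hηd⟩ := hcut R hR
  obtain ⟨ρ, hρ, hnear⟩ := hnear δ hδ
  obtain ⟨κ, hκ, hfar⟩ := hfar ρ hρ
  have ta := tendsto_nhdsWithin_iff.1 (tendsto_scale hm)
  have tam : Tendsto (fun ε : ℝ => (ε ^ (2 / (m + 2))) ^ m) (𝓝[>] 0) (𝓝 0) := by
    have := (Real.continuousAt_rpow_const (0 : ℝ) m (Or.inr hm.le)).tendsto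
    rw [Real.zero_rpow hm.ne'] at this
    exact this.comp ta.1
  filter_upwards [self_mem_nhdsWithin, ta.1.eventually_le_const (by positivity : 0 < ρ / (2 * R)),
    tam.eventually_le_const (by positivity : 0 < κ / B),
    tam.eventually_le_const (by positivity : 0 < 2 * δ / (s * M ^ 2))] with ε hε ha1 ha2 ha3 hneg
  have hε : 0 < ε := hε
  have hscale := scale_rpow_mul_sq hε hm
  have ha : 0 < ε ^ (2 / (m + 2)) := Real.rpow_pos_of_pos hε _
  set a := ε ^ (2 / (m + 2)) with hadef
  have ham : 0 < a ^ m := Real.rpow_pos_of_pos ha _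
  set W : ℝ → ℝ := fun x => excess h 1 M (a * x) / a ^ m with hWdef
  have hW : Continuous W := ((continuous_excess one_pos hc hpos M).comp (by fun_prop)).div_const _
  have hW0 : ∀ x, 0 ≤ W x := fun x => div_nonneg (excess_nonneg one_pos hpos hM _) ham.le
  have hWq : ∀ x, |a * x| ≤ ρ → (1 - δ) * q x ≤ W x := fun x hx => by
    have := hnear _ hx
    rw [hhom a ha] at this
    rw [hWdef, le_div_iff₀ ham]
    linarith
  have hWn : ∀ x, |x| ≤ 2 * R → (1 - δ) * q x ≤ W x := fun x hx => hWq x <| by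
    rw [abs_mul, abs_of_pos ha]
    rw [le_div_iff₀ (by positivity)] at ha1
    exact (mul_le_mul_of_nonneg_left hx ha.le).trans ha1
  have hWB : ∀ x, R ≤ |x| → B ≤ W x := fun x hx => by
    rcases le_or_gt |a * x| ρ with h1 | h1
    · have h2 := hR₀ x (hRR.trans hx)
      have h3 := mul_le_mul_of_nonneg_left h2 (by linarith : 0 ≤ 1 - δ)
      have h4 : (1 - δ) * (r * B) = B := by rw [← mul_assoc, mul_comm _ r, hδr, one_mul]
      exact h4.symm.le.trans (h3.trans (hWq x h1))
    · rw [hWdef, le_div_iff₀ ham]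
      rw [le_div_iff₀ hB] at ha2
      linarith [hfar _ h1.le]
  obtain ⟨ψ, hψ, hneg⟩ := negTriples_testTriples_iff.1 hneg
  set l := ε * M with hl
  have hχ : ∀ i, ContDiff ℝ 1 (fun x => transMean l (ψ i) (a * x)) := fun i =>
    (contDiff_transMean ((hψ i).1.of_le (by simp)) (hψ i).2.1 l).comp (by fun_prop)
  have hχs : ∀ i, HasCompactSupport (fun x => transMean l (ψ i) (a * x)) := fun i =>
    (hasCompactSupport_transMean (hψ i).2.1 l).comp_homeomorph (Homeomorph.mulLeft₀ a ha.ne')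
  refine negTriples_schrodingerForm hq hq0
    (u := fun i x => η x * transMean l (ψ i) (a * x)) (fun i => hη.mul (hχ i))
    (fun i => (hχs i).mul_left) fun c hc0 => ?_
  obtain ⟨h1, h2, h3⟩ := sum_mul_test hψ c
  have h1' : ContDiff ℝ 1 fun p => ∑ i, c i * ψ i p := h1.of_le (by simp)
  have esum : ∀ x, ∑ i, c i * (η x * transMean l (ψ i) (a * x)) =
      η x * transMean l (fun p => ∑ i, c i * ψ i p) (a * x) := fun x => by
    rw [transMean_sum l ψ fun i => (hψ i).1.continuous, Finset.mul_sum]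
    exact Finset.sum_congr rfl fun i _ => by ring
  simp only [esum]
  have h0 := hneg c hc0
  obtain ⟨E1, E2⟩ := energy_ge hε hc hpos hM h1 h2 h3 hδ.le hδ1.le
  have hX := contDiff_transMean h1' h2 l
  have hXs := hasCompactSupport_transMean h2 l
  rw [← hl] at E1 E2
  set X := transMean l fun p => ∑ i, c i * ψ i p with hXdef
  refine cutoff_form_lt hq hW hW0 (hX.comp (by fun_prop : ContDiff ℝ 1 fun x : ℝ => a * x))
    (hXs.comp_homeomorph (Homeomorph.mulLeft₀ a ha.ne')) hη hη0 hη1 hηR hηR' hηd hδ hr hδr hB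
    (hs.trans hss').le hWn hWB (hnum (C / R) (by rwa [abs_of_pos (by positivity)])) ?_
  -- The part of the energy above the first transversal mode absorbs the error in the norm.
  have hgap : s / a ^ 2 ≤ δ * (2 / l ^ 2) := by
    rw [le_div_iff₀ (by positivity)] at ha3
    rw [hl, mul_pow, ← hscale, ← mul_div_assoc, div_le_div_iff₀ (by positivity) (by positivity)]
    have := mul_le_mul_of_nonneg_right ha3 (sq_nonneg a)
    linarith
  have hgap' := mul_le_mul_of_nonneg_right hgap (sub_nonneg.2 E1)
  have e0 : (∫ x, deriv X x ^ 2) + (1 - δ) * (∫ x, excess h ε M x * X x ^ 2) <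
      s / a ^ 2 * ∫ x, X x ^ 2 := by linarith
  have e1 : ∀ x, deriv (X ∘ fun x => a * x) x = a * deriv X (a * x) := fun x => by
    have := deriv_comp_mul_left a X x
    rwa [smul_eq_mul] at this
  simp only [e1, Function.comp_apply, mul_pow]
  rw [Measure.integral_comp_mul_left (fun x => a ^ 2 * deriv X x ^ 2) a,
    Measure.integral_comp_mul_left (fun x => X x ^ 2) a,
    Measure.integral_comp_mul_left (fun x => excess h 1 M x / a ^ m * X x ^ 2) a,
    abs_of_pos (inv_pos.2 ha), integral_const_mul]
  have e2 : ∫ x, excess h 1 M x / a ^ m * X x ^ 2 = a ^ 2 * ∫ x, excess h ε M x * X x ^ 2 := by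
    rw [← integral_const_mul]
    congr 1
    ext x
    rw [excess_eq_div_sq ε x, ← hscale]
    field_simp
  rw [e2]
  simp only [smul_eq_mul]
  have e3 := mul_lt_mul_of_pos_left e0 (by positivity : 0 < a⁻¹ * a ^ 2)
  have e4 : a⁻¹ * a ^ 2 * (s / a ^ 2 * ∫ x, X x ^ 2) = s * (a⁻¹ * ∫ x, X x ^ 2) := by
    field_simp
  linarith

end LowerBound

/-! ### Near-optimal transversal profiles -/

section Profile
open Real

theorem integral_sin_pi_sq : ∫ y in (0 : ℝ)..1, sin (π * y) ^ 2 = 1 / 2 := by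
  rw [intervalIntegral.integral_comp_mul_left (fun y => sin y ^ 2) pi_ne_zero, integral_sin_sq]
  have := pi_ne_zero
  simp
  field_simp

theorem integral_cos_pi_sq : ∫ y in (0 : ℝ)..1, cos (π * y) ^ 2 = 1 / 2 := by
  rw [intervalIntegral.integral_comp_mul_left (fun y => cos y ^ 2) pi_ne_zero, integral_cos_sq]
  have := pi_ne_zero
  simp
  field_simp

/-- A smooth version of `u ↦ max u 0` that vanishes near `u ≤ 0`. -/
theorem exists_smooth_ramp {κ : ℝ} (hκ : 0 < κ) : ∃ G : ℝ → ℝ, ContDiff ℝ ∞ G ∧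
    (∀ u, u ≤ κ → G u = 0) ∧ (∀ u, |deriv G u| ≤ 1) ∧ ∀ u, 0 ≤ u → u ^ 2 - 4 * κ * u ≤ G u ^ 2 := by
  set g : ℝ → ℝ := fun v => smoothTransition (v / κ - 1) with hg
  have hgs : ContDiff ℝ ∞ g := smoothTransition.contDiff.comp (by fun_prop)
  have hgc : Continuous g := hgs.continuous
  have hd : ∀ u, HasDerivAt (fun u => ∫ v in (0 : ℝ)..u, g v) (g u) u := fun u =>
    intervalIntegral.integral_hasDerivAt_right (hgc.intervalIntegrable _ _)
      (hgc.stronglyMeasurableAtFilter _ _) hgc.continuousAt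
  have hd' : deriv (fun u => ∫ v in (0 : ℝ)..u, g v) = g := funext fun u => (hd u).deriv
  have hg0 : ∀ v, v ≤ κ → g v = 0 := fun v hv => smoothTransition.zero_of_nonpos (by
    rw [sub_nonpos, div_le_one hκ]; exact hv)
  have hg1 : ∀ v, 2 * κ ≤ v → g v = 1 := fun v hv => smoothTransition.one_of_one_le (by
    rw [le_sub_iff_add_le, le_div_iff₀ hκ]; linarith)
  refine ⟨fun u => ∫ v in (0 : ℝ)..u, g v, ?_, fun u hu => ?_, fun u => ?_, fun u hu => ?_⟩
  · rw [contDiff_infty_iff_deriv, hd']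
    exact ⟨fun u => (hd u).differentiableAt, hgs⟩
  · refine (intervalIntegral.integral_congr (g := fun _ => 0) fun v hv => hg0 v ?_).trans (by simp)
    rw [Set.mem_uIcc] at hv
    rcases hv with hv | hv <;> linarith [hv.1, hv.2]
  · rw [hd', abs_of_nonneg (smoothTransition.nonneg _)]
    exact smoothTransition.le_one _
  · rcases le_or_gt (2 * κ) u with h | h
    · have e1 : u - 2 * κ ≤ ∫ v in (0 : ℝ)..u, g v := by
        rw [← intervalIntegral.integral_add_adjacent_intervals
          (hgc.intervalIntegrable 0 (2 * κ)) (hgc.intervalIntegrable (2 * κ) u)]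
        have e2 : ∫ v in (2 * κ)..u, g v = u - 2 * κ := by
          rw [intervalIntegral.integral_congr (g := fun _ => (1 : ℝ))]
          · simp
          · intro v hv
            rw [Set.uIcc_of_le h] at hv
            exact hg1 v hv.1
        have e3 : 0 ≤ ∫ v in (0 : ℝ)..(2 * κ), g v :=
          intervalIntegral.integral_nonneg (by positivity) fun v _ => smoothTransition.nonneg _
        linarith
      have := pow_le_pow_left₀ (by linarith) e1 2
      nlinarith [sq_nonneg κ]
    · refine le_trans ?_ (sq_nonneg _)
      nlinarith

/-- The first Dirichlet eigenfunction of `(0, 1)` can be approximated in energy by test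
functions. -/
theorem exists_profile {τ : ℝ} (hτ : 0 < τ) : ∃ S : ℝ → ℝ, ContDiff ℝ ∞ S ∧
    (∃ σ, 0 < σ ∧ ∀ y, y ∉ Set.Icc σ (1 - σ) → S y = 0) ∧ 0 < ∫ y, S y ^ 2 ∧
    ∫ y, deriv S y ^ 2 ≤ (π ^ 2 + τ) * ∫ y, S y ^ 2 := by
  set κ := τ / (8 * (π ^ 2 + τ)) with hκdef
  have hπ := pi_pos
  have hκ : 0 < κ := by positivity
  have hκτ : (π ^ 2 + τ) * (1 - 8 * κ) = π ^ 2 := by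
    rw [hκdef]
    field_simp
    ring
  have hκ8 : 0 < 1 - 8 * κ := by
    have h1 : 0 < (π ^ 2 + τ) * (1 - 8 * κ) := by rw [hκτ]; positivity
    exact pos_of_mul_pos_right h1 (by positivity)
  obtain ⟨G, hG, hG0, hG1, hG2⟩ := exists_smooth_ramp hκ
  let b : ContDiffBump (1 / 2 : ℝ) := ⟨1 / 2, 1, by norm_num, by norm_num⟩
  have hb1 : ∀ y ∈ Set.Icc (0 : ℝ) 1, b y = 1 := fun y hy => b.one_of_mem_closedBall (by
    rw [Metric.mem_closedBall, Real.dist_eq, abs_le]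
    change -(1 / 2) ≤ y - 1 / 2 ∧ y - 1 / 2 ≤ 1 / 2
    constructor <;> linarith [hy.1, hy.2])
  have hb0 : ∀ y, y ∉ Set.Ioo (-(1 / 2) : ℝ) (3 / 2) → b y = 0 := fun y hy => b.zero_of_le_dist (by
    rw [Real.dist_eq]
    change 1 ≤ |y - 1 / 2|
    by_contra! hlt
    rw [abs_lt] at hlt
    exact hy ⟨by linarith, by linarith⟩)
  set S : ℝ → ℝ := fun y => G (sin (π * y)) * b y with hS
  have hSs : ContDiff ℝ ∞ S := (hG.comp (by fun_prop)).mul b.contDiff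
  have hS1 : ∀ y ∈ Set.Icc (0 : ℝ) 1, S y = G (sin (π * y)) := fun y hy => by
    rw [hS]; simp only [hb1 y hy, mul_one]
  -- `sin (π y)` is small outside `[σ, 1 - σ]`, as `sin` is `1`-Lipschitz.
  have hσ : ∀ y, y ∉ Set.Icc (κ / π) (1 - κ / π) → S y = 0 := by
    intro y hy
    rcases lt_or_ge y (-(1 / 2)) with h1 | h1
    · rw [hS]
      simp only [hb0 y fun h => by linarith [h.1], mul_zero]
    rcases lt_or_ge (3 / 2) y with h2 | h2
    · rw [hS]
      simp only [hb0 y fun h => by linarith [h.2], mul_zero]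
    have : sin (π * y) ≤ κ := by
      rcases lt_or_ge y (κ / π) with h3 | h3
      · rw [lt_div_iff₀ hπ] at h3
        rcases le_or_gt 0 y with h4 | h4
        · exact (sin_le (by positivity)).trans (by linarith)
        · refine (sin_nonpos_of_nonpos_of_neg_pi_le ?_ ?_).trans hκ.le <;> nlinarith
      · have h4 : 1 - κ / π < y := by
          by_contra! h
          exact hy ⟨h3, h⟩
        have e : sin (π * y) = sin (π * (1 - y)) := by
          rw [mul_sub, mul_one, sin_pi_sub]
        rw [e]
        have h5 : 1 - y < κ / π := by linarith
        rw [lt_div_iff₀ hπ] at h5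
        rcases le_or_gt 0 (1 - y) with h6 | h6
        · exact (sin_le (by positivity)).trans (by linarith)
        · refine (sin_nonpos_of_nonpos_of_neg_pi_le ?_ ?_).trans hκ.le <;> nlinarith
    rw [hS]
    simp only [hG0 _ this, zero_mul]
  have hSt : tsupport S ⊆ Set.Icc (κ / π) (1 - κ / π) :=
    closure_minimal (fun y hy => by by_contra h; exact hy (hσ y h)) isClosed_Icc
  have hσ0 : 0 < κ / π := by positivity
  have hSd : ∀ y, deriv S y ^ 2 ≤ π ^ 2 * cos (π * y) ^ 2 := by
    intro y
    by_cases hy : y ∈ Set.Icc (κ / π) (1 - κ / π)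
    · have hev : S =ᶠ[𝓝 y] fun y => G (sin (π * y)) := by
        filter_upwards [Ioo_mem_nhds (show 0 < y by linarith [hy.1])
          (show y < 1 by linarith [hy.2])] with z hz
        exact hS1 z ⟨hz.1.le, hz.2.le⟩
      have hd : HasDerivAt (fun y => G (sin (π * y)))
          (deriv G (sin (π * y)) * (cos (π * y) * (π * 1))) y :=
        (hG.differentiable (by simp) _).hasDerivAt.comp y
          (((hasDerivAt_id y).const_mul π).sin)
      rw [hev.deriv_eq, hd.deriv, mul_one, mul_pow, mul_pow]
      have : deriv G (sin (π * y)) ^ 2 ≤ 1 := by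
        rw [← sq_abs]
        exact pow_le_one₀ (abs_nonneg _) (hG1 _)
      calc _ ≤ 1 * (cos (π * y) ^ 2 * π ^ 2) := by gcongr
        _ = _ := by ring
    · have : deriv S y = 0 := image_eq_zero_of_notMem_tsupport fun h =>
        hy (hSt (tsupport_deriv_subset h))
      rw [this, zero_pow two_ne_zero]
      positivity
  have hint : ∀ F : ℝ → ℝ, (∀ y, y ∉ Set.Icc (κ / π) (1 - κ / π) → F y = 0) →
      ∫ y, F y = ∫ y in (0 : ℝ)..1, F y := fun F hF =>
    (intervalIntegral.integral_eq_integral_of_support_subset fun y hy => by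
      have : y ∈ Set.Icc (κ / π) (1 - κ / π) := by by_contra h; exact hy (hF y h)
      exact ⟨by linarith [this.1], by linarith [this.2]⟩).symm
  have e1 : 1 / 2 - 4 * κ ≤ ∫ y, S y ^ 2 := by
    rw [hint (fun y => S y ^ 2) fun y hy => by simp [hσ y hy]]
    have e : ∫ y in (0 : ℝ)..1, (sin (π * y) ^ 2 - 4 * κ) = 1 / 2 - 4 * κ := by
      rw [intervalIntegral.integral_sub (Continuous.intervalIntegrable (by fun_prop) _ _)
        intervalIntegrable_const, integral_sin_pi_sq]
      simp
    rw [← e]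
    refine intervalIntegral.integral_mono_on zero_le_one
      (Continuous.intervalIntegrable (by fun_prop) _ _)
      ((hSs.continuous.pow 2).intervalIntegrable _ _) fun y hy => ?_
    rw [hS1 y hy]
    have h0 : 0 ≤ sin (π * y) := sin_nonneg_of_nonneg_of_le_pi (mul_nonneg hπ.le hy.1)
      (by nlinarith [hy.2])
    have := hG2 _ h0
    nlinarith [sin_le_one (π * y)]
  have e2 : ∫ y, deriv S y ^ 2 ≤ π ^ 2 * (1 / 2) := by
    rw [hint (fun y => deriv S y ^ 2) fun y hy => by
      have : deriv S y = 0 := image_eq_zero_of_notMem_tsupport fun h =>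
        hy (hSt (tsupport_deriv_subset h))
      simp [this], ← integral_cos_pi_sq, ← intervalIntegral.integral_const_mul]
    exact intervalIntegral.integral_mono zero_le_one
      (((hSs.continuous_deriv (by simp)).pow 2).intervalIntegrable _ _)
      (Continuous.intervalIntegrable (by fun_prop) _ _) hSd
  refine ⟨S, hSs, ⟨κ / π, hσ0, hσ⟩, by linarith, e2.trans ?_⟩
  have := mul_le_mul_of_nonneg_left e1 (by positivity : 0 ≤ π ^ 2 + τ)
  linarith

end Profile

/-! ### Trial functions in the strip -/

section Trial

variable {h k A T : ℝ → ℝ} {ε σ : ℝ}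

/-- The functions `A(x) T(y / k(x))` have a common compact support in the strip if `T` ranges over
functions vanishing outside `[σ, 1 - σ]`. -/
theorem exists_compact_support_mul_comp_div (hk : Continuous k) (hk0 : ∀ x, 0 < k x)
    (hAs : HasCompactSupport A) (hσ : 0 < σ) (hkh : ∀ x ∈ tsupport A, k x ≤ ε * h x) :
    ∃ K : Set (ℝ × ℝ), IsCompact K ∧ K ⊆ strip h ε ∧ ∀ T : ℝ → ℝ,
      (∀ y, y ∉ Set.Icc σ (1 - σ) → T y = 0) → ∀ p ∉ K, A p.1 * T (p.2 / k p.1) = 0 := by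
  refine ⟨(fun p : ℝ × ℝ => (p.1, p.2 * k p.1)) '' (tsupport A ×ˢ Set.Icc σ (1 - σ)),
    (hAs.isCompact.prod isCompact_Icc).image (by fun_prop), ?_, fun T hT p hp => ?_⟩
  · rintro _ ⟨⟨x, z⟩, ⟨hx, hz⟩, rfl⟩
    have h1 := hk0 x
    refine ⟨mul_pos (hσ.trans_le hz.1) h1, ?_⟩
    calc z * k x < 1 * k x := by
          have := hz.2
          gcongr
          simp only at this
          linarith
      _ ≤ ε * h x := by rw [one_mul]; exact hkh x hx
  · by_contra hne
    refine hp ⟨(p.1, p.2 / k p.1), ⟨subset_tsupport _ (left_ne_zero_of_mul hne), ?_⟩, ?_⟩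
    · by_contra hcon
      exact hne (by rw [hT _ hcon, mul_zero])
    · simp [(hk0 p.1).ne']

theorem continuous_mul_comp_div (hk : Continuous k) (hk0 : ∀ x, 0 < k x) (hA : Continuous A)
    (hT : Continuous T) : Continuous fun p : ℝ × ℝ => A p.1 * T (p.2 / k p.1) :=
  (hA.comp continuous_fst).mul (hT.comp (continuous_snd.div (hk.comp continuous_fst)
    fun p => (hk0 p.1).ne'))

theorem integral_strip_mul_comp_div (hk : Continuous k) (hk0 : ∀ x, 0 < k x) (hA : Continuous A)
    (hAs : HasCompactSupport A) (hT : Continuous T) (hσ : 0 < σ)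
    (hTσ : ∀ y, y ∉ Set.Icc σ (1 - σ) → T y = 0) (hkh : ∀ x ∈ tsupport A, k x ≤ ε * h x) :
    IntegrableOn (fun p : ℝ × ℝ => A p.1 * T (p.2 / k p.1)) (strip h ε) ∧
    ∫ p in strip h ε, A p.1 * T (p.2 / k p.1) = (∫ x, A x * k x) * ∫ y, T y := by
  obtain ⟨K, hK, hKs, hK0⟩ := exists_compact_support_mul_comp_div hk hk0 hAs hσ hkh
  have hi : Integrable fun p : ℝ × ℝ => A p.1 * T (p.2 / k p.1) :=
    (continuous_mul_comp_div hk hk0 hA hT).integrable_of_hasCompactSupport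
      (HasCompactSupport.intro hK (hK0 T hTσ))
  refine ⟨hi.integrableOn, ?_⟩
  rw [setIntegral_eq_integral_of_forall_compl_eq_zero fun p hp => hK0 T hTσ p fun h => hp (hKs h),
    Measure.volume_eq_prod, integral_prod _ (by rw [← Measure.volume_eq_prod]; exact hi),
    ← integral_mul_const]
  congr 1
  ext x
  simp only
  rw [integral_const_mul, Measure.integral_comp_div T (k x), abs_of_pos (hk0 x), smul_eq_mul,
    mul_assoc]

variable {S : ℝ → ℝ}

theorem contDiff_mul_comp_div (hk : ContDiff ℝ ∞ k) (hk0 : ∀ x, 0 < k x) (hA : ContDiff ℝ ∞ A)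
    (hS : ContDiff ℝ ∞ S) : ContDiff ℝ ∞ fun p : ℝ × ℝ => A p.1 * S (p.2 / k p.1) :=
  (hA.comp contDiff_fst).mul (hS.comp (contDiff_snd.div (hk.comp contDiff_fst)
    fun p => (hk0 p.1).ne'))

theorem fderiv_mul_comp_div_fst (hk : ContDiff ℝ ∞ k) (hk0 : ∀ x, 0 < k x) (hA : ContDiff ℝ ∞ A)
    (hS : ContDiff ℝ ∞ S) (p : ℝ × ℝ) :
    fderiv ℝ (fun p : ℝ × ℝ => A p.1 * S (p.2 / k p.1)) p (1, 0) =
      deriv A p.1 * S (p.2 / k p.1) +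
        A p.1 * (deriv S (p.2 / k p.1) * (-(p.2 * deriv k p.1) / k p.1 ^ 2)) := by
  have h1 := hasDerivAt_slice ((contDiff_mul_comp_div hk hk0 hA hS).of_le (by simp)) p.1 p.2
  have dk := (hk.differentiable (by simp) p.1).hasDerivAt
  have h2 : HasDerivAt (fun x => p.2 / k x) (-(p.2 * deriv k p.1) / k p.1 ^ 2) p.1 := by
    have := (hasDerivAt_const p.1 p.2).fun_div dk (hk0 p.1).ne'
    simpa using this
  exact h1.unique ((hA.differentiable (by simp) p.1).hasDerivAt.mul
    ((hS.differentiable (by simp) (p.2 / k p.1)).hasDerivAt.comp p.1 h2))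

theorem fderiv_mul_comp_div_snd (hk : ContDiff ℝ ∞ k) (hk0 : ∀ x, 0 < k x) (hA : ContDiff ℝ ∞ A)
    (hS : ContDiff ℝ ∞ S) (p : ℝ × ℝ) :
    fderiv ℝ (fun p : ℝ × ℝ => A p.1 * S (p.2 / k p.1)) p (0, 1) =
      A p.1 * (deriv S (p.2 / k p.1) * (1 / k p.1)) := by
  have h1 := hasDerivAt_slice' ((contDiff_mul_comp_div hk hk0 hA hS).of_le (by simp)) p.1 p.2
  exact h1.unique (((hS.differentiable (by simp) (p.2 / k p.1)).hasDerivAt.comp p.2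
    ((hasDerivAt_id p.2).div_const (k p.1))).const_mul (A p.1))

/-- The norm and the energy of the trial function `A(x) S(y / k(x))`. -/
theorem trial_energy (hk : ContDiff ℝ ∞ k) (hk0 : ∀ x, 0 < k x) (hA : ContDiff ℝ ∞ A)
    (hAs : HasCompactSupport A) (hS : ContDiff ℝ ∞ S) (hσ : 0 < σ)
    (hSσ : ∀ y, y ∉ Set.Icc σ (1 - σ) → S y = 0) (hkh : ∀ x ∈ tsupport A, k x ≤ ε * h x)
    {δ : ℝ} (hδ : 0 < δ) :
    ∫ p in strip h ε, (A p.1 * S (p.2 / k p.1)) ^ 2 = (∫ x, A x ^ 2 * k x) * (∫ y, S y ^ 2) ∧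
    ∫ p in strip h ε, (fderiv ℝ (fun p : ℝ × ℝ => A p.1 * S (p.2 / k p.1)) p (0, 1)) ^ 2 =
      (∫ x, A x ^ 2 / k x) * (∫ y, deriv S y ^ 2) ∧
    ∫ p in strip h ε, (fderiv ℝ (fun p : ℝ × ℝ => A p.1 * S (p.2 / k p.1)) p (1, 0)) ^ 2 ≤
      (1 + δ) * ((∫ x, deriv A x ^ 2 * k x) * (∫ y, S y ^ 2)) +
      (1 + δ⁻¹) * ((∫ x, A x ^ 2 * (deriv k x ^ 2 / k x)) * (∫ y, deriv S y ^ 2)) := by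
  have hkc := hk.continuous
  have hkd : Continuous (deriv k) := hk.continuous_deriv (by simp)
  have hAd : Continuous (deriv A) := hA.continuous_deriv (by simp)
  have hSd : Continuous (deriv S) := hS.continuous_deriv (by simp)
  have sq_t : ∀ {f g : ℝ → ℝ}, (∀ x, f x = 0 → g x = 0) → tsupport g ⊆ tsupport f :=
    fun {f g} hfg => closure_mono fun x hx h0 => hx (hfg x h0)
  have hS' : ∀ y, y ∉ Set.Icc σ (1 - σ) → deriv S y = 0 := fun y hy =>
    image_eq_zero_of_notMem_tsupport fun h => hy ((closure_minimal
      (fun z hz => by by_contra hcon; exact hz (hSσ z hcon)) isClosed_Icc)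
        (tsupport_deriv_subset h))
  have main : ∀ {f g T : ℝ → ℝ}, tsupport f ⊆ tsupport A → Continuous g →
      (∀ x, f x = 0 → g x = 0) → Continuous T → (∀ y, y ∉ Set.Icc σ (1 - σ) → T y = 0) →
      IntegrableOn (fun p : ℝ × ℝ => g p.1 * T (p.2 / k p.1)) (strip h ε) ∧
      ∫ p in strip h ε, g p.1 * T (p.2 / k p.1) = (∫ x, g x * k x) * ∫ y, T y :=
    fun {f g T} hf hg hfg hT hT0 => by
      have h1 : tsupport g ⊆ tsupport A := (sq_t hfg).trans hf
      exact integral_strip_mul_comp_div hkc hk0 hg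
        (hAs.isCompact.of_isClosed_subset (isClosed_tsupport g) h1) hT hσ hT0
        fun x hx => hkh x (h1 hx)
  have m1 := main (f := A) (g := fun x => A x ^ 2) (T := fun y => S y ^ 2) le_rfl
    (hA.continuous.pow 2) (fun x hx => by simp [hx]) (hS.continuous.pow 2)
    fun y hy => by simp [hSσ y hy]
  have hAk : Continuous fun x => A x ^ 2 / k x ^ 2 :=
    (hA.continuous.pow 2).div (hkc.pow 2) fun x => pow_ne_zero 2 (hk0 x).ne'
  have m2 := main (f := A) (g := fun x => A x ^ 2 / k x ^ 2) (T := fun y => deriv S y ^ 2) le_rfl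
    hAk (fun x hx => by simp [hx]) (hSd.pow 2) fun y hy => by simp [hS' y hy]
  have m3 := main (f := deriv A) (g := fun x => deriv A x ^ 2) (T := fun y => S y ^ 2)
    tsupport_deriv_subset (hAd.pow 2) (fun x hx => by simp [hx]) (hS.continuous.pow 2)
    fun y hy => by simp [hSσ y hy]
  have m4 := main (f := A) (g := fun x => A x ^ 2 / k x ^ 2 * deriv k x ^ 2)
    (T := fun y => deriv S y ^ 2) le_rfl (hAk.mul (hkd.pow 2)) (fun x hx => by simp [hx])
    (hSd.pow 2) fun y hy => by simp [hS' y hy]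
  refine ⟨?_, ?_, ?_⟩
  · simp only [mul_pow]
    exact m1.2
  · rw [show (∫ x, A x ^ 2 / k x) = ∫ x, A x ^ 2 / k x ^ 2 * k x from by
      congr 1
      ext x
      have := (hk0 x).ne'
      field_simp, ← m2.2]
    congr 1
    ext p
    rw [fderiv_mul_comp_div_snd hk hk0 hA hS]
    ring
  · rw [show (∫ x, A x ^ 2 * (deriv k x ^ 2 / k x)) =
      ∫ x, A x ^ 2 / k x ^ 2 * deriv k x ^ 2 * k x from by
        congr 1
        ext x
        have := (hk0 x).ne'
        field_simp, ← m3.2, ← m4.2, ← integral_const_mul, ← integral_const_mul,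
      ← integral_add (m3.1.const_mul _) (m4.1.const_mul _)]
    refine integral_mono_of_nonneg (ae_of_all _ fun p => sq_nonneg _)
      ((m3.1.const_mul _).add (m4.1.const_mul _)) (ae_of_all _ fun p => ?_)
    simp only [fderiv_mul_comp_div_fst hk hk0 hA hS]
    refine (add_sq_le_mul hδ _ _).trans ?_
    have hk1 := hk0 p.1
    have hkey : (A p.1 * (deriv S (p.2 / k p.1) * (-(p.2 * deriv k p.1) / k p.1 ^ 2))) ^ 2 ≤
        A p.1 ^ 2 / k p.1 ^ 2 * deriv k p.1 ^ 2 * deriv S (p.2 / k p.1) ^ 2 := by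
      by_cases hy : p.2 / k p.1 ∈ Set.Icc σ (1 - σ)
      · have e : (A p.1 * (deriv S (p.2 / k p.1) * (-(p.2 * deriv k p.1) / k p.1 ^ 2))) ^ 2 =
            A p.1 ^ 2 / k p.1 ^ 2 * deriv k p.1 ^ 2 * deriv S (p.2 / k p.1) ^ 2 *
              (p.2 / k p.1) ^ 2 := by
          field_simp
        rw [e]
        exact mul_le_of_le_one_right (by positivity)
          (pow_le_one₀ (hσ.le.trans hy.1) (hy.2.trans (by linarith)))
      · rw [hS' _ hy]
        simp
    rw [mul_pow]
    have : 0 ≤ 1 + δ⁻¹ := by positivity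
    gcongr

end Trial

/-! ### Comparison with the Schrödinger form from above -/

section UpperBound
open Real

/-- The one-dimensional inequality behind the trial functions: in the variable `x / ε ^ α`, the
trial function built from `u` lives on a strip of width proportional to `K = M - b p`. -/
theorem rescaled_energy_lt {q u p : ℝ → ℝ} {M P P' R b δ s s' : ℝ} (hM : 0 < M)
    (hq : Continuous q) (hu : ContDiff ℝ 1 u) (hus : HasCompactSupport u)
    (huR : ∀ x, R ≤ |x| → u x = 0) (hp : ContDiff ℝ 1 p) (hp0 : ∀ x, 0 ≤ p x)
    (hpP : ∀ x, p x ≤ P) (hpP' : ∀ x, |x| ≤ R → |deriv p x| ≤ P')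
    (hpq : ∀ x, |x| ≤ R → 2 * π ^ 2 * p x ≤ M ^ 3 * q x + 2 * π ^ 2 * δ)
    (hb : 0 < b) (hb1 : b ≤ 1) (hδ : 0 < δ) (hbM : M ≤ (1 + δ) * (M - b * P)) (hs' : 0 ≤ s')
    (hnum : (1 + δ) * M * s + (1 + δ⁻¹) * b ^ 2 * (π ^ 2 + δ) * (P' ^ 2 * (1 + δ) / M) +
      (1 + δ) * (δ * (2 * π ^ 2 / M ^ 2 + 1 / M)) ≤ s' * (M - b * P))
    (hneg : (∫ x, deriv u x ^ 2) + (∫ x, q x * u x ^ 2) < s * ∫ x, u x ^ 2) :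
    (1 + δ) * (∫ x, deriv u x ^ 2 * (M - b * p x)) +
      (1 + δ⁻¹) * b ^ 2 * (π ^ 2 + δ * b) * (∫ x, u x ^ 2 * (deriv p x ^ 2 / (M - b * p x))) +
      b⁻¹ * ((π ^ 2 + δ * b) * (∫ x, u x ^ 2 / (M - b * p x)) -
        π ^ 2 / M ^ 2 * ∫ x, u x ^ 2 * (M - b * p x)) <
      s' * ∫ x, u x ^ 2 * (M - b * p x) := by
  have hud : Continuous (deriv u) := hu.continuous_deriv le_rfl
  have hpd : Continuous (deriv p) := hp.continuous_deriv le_rfl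
  have hpc := hp.continuous
  have hKP : ∀ x, M - b * P ≤ M - b * p x := fun x => by
    have := mul_le_mul_of_nonneg_left (hpP x) hb.le
    linarith
  have hK1 : ∀ x, M ≤ (1 + δ) * (M - b * p x) := fun x =>
    hbM.trans (mul_le_mul_of_nonneg_left (hKP x) (by linarith))
  have hK0 : ∀ x, 0 < M - b * p x := fun x =>
    pos_of_mul_pos_right (hM.trans_le (hK1 x)) (by linarith)
  have hKM : ∀ x, M - b * p x ≤ M := fun x => by
    have := mul_nonneg hb.le (hp0 x)
    linarith
  have hKi : ∀ x, 1 / (M - b * p x) ≤ (1 + δ) / M := fun x => by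
    rw [div_le_div_iff₀ (hK0 x) hM, one_mul]
    exact hK1 x
  have hKc : Continuous fun x => M - b * p x := by fun_prop
  have hKic : Continuous fun x => 1 / (M - b * p x) :=
    continuous_const.div hKc fun x => (hK0 x).ne'
  have hone : Continuous fun _ : ℝ => (1 : ℝ) := continuous_const
  have iY : Integrable fun x => u x ^ 2 := by
    simpa using integrable_mul_sq hone hu.continuous hus
  have iE : Integrable fun x => deriv u x ^ 2 := by simpa using integrable_mul_sq hone hud hus.deriv
  have iV := integrable_mul_sq hq hu.continuous hus
  have i1 : Integrable fun x => deriv u x ^ 2 * (M - b * p x) := by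
    simpa only [mul_comm] using integrable_mul_sq hKc hud hus.deriv
  have i2 : Integrable fun x => u x ^ 2 * (deriv p x ^ 2 / (M - b * p x)) := by
    have : Continuous fun x => deriv p x ^ 2 / (M - b * p x) :=
      (hpd.pow 2).div hKc fun x => (hK0 x).ne'
    simpa only [mul_comm] using integrable_mul_sq this hu.continuous hus
  have i3 : Integrable fun x => u x ^ 2 / (M - b * p x) := by
    have := integrable_mul_sq hKic hu.continuous hus
    simpa only [one_div, inv_mul_eq_div] using this
  have i4 : Integrable fun x => u x ^ 2 * (M - b * p x) := by
    simpa only [mul_comm] using integrable_mul_sq hKc hu.continuous hus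
  have f1 : ∫ x, deriv u x ^ 2 * (M - b * p x) ≤ M * ∫ x, deriv u x ^ 2 := by
    rw [← integral_const_mul]
    refine integral_mono i1 (iE.const_mul _) fun x => ?_
    have := mul_le_mul_of_nonneg_left (hKM x) (sq_nonneg (deriv u x))
    simp only
    linarith
  have f2 : ∫ x, u x ^ 2 * (deriv p x ^ 2 / (M - b * p x)) ≤
      P' ^ 2 * (1 + δ) / M * ∫ x, u x ^ 2 := by
    rw [← integral_const_mul]
    refine integral_mono i2 (iY.const_mul _) fun x => ?_
    simp only
    rcases le_or_gt R |x| with hx | hx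
    · simp [huR x hx]
    · have e1 : deriv p x ^ 2 ≤ P' ^ 2 := sq_le_sq' (abs_le.1 (hpP' x hx.le)).1
        (abs_le.1 (hpP' x hx.le)).2
      have e2 : deriv p x ^ 2 / (M - b * p x) ≤ P' ^ 2 * (1 + δ) / M := by
        rw [div_eq_mul_one_div, mul_div_assoc]
        have : 0 ≤ 1 / (M - b * p x) := one_div_nonneg.2 (hK0 x).le
        exact mul_le_mul e1 (hKi x) this (sq_nonneg _)
      rw [mul_comm]
      gcongr
  have f4 : (M - b * P) * (∫ x, u x ^ 2) ≤ ∫ x, u x ^ 2 * (M - b * p x) := by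
    rw [← integral_const_mul]
    refine integral_mono (iY.const_mul _) i4 fun x => ?_
    have := mul_le_mul_of_nonneg_left (hKP x) (sq_nonneg (u x))
    simp only
    linarith
  have f3 : b⁻¹ * ((π ^ 2 + δ * b) * (∫ x, u x ^ 2 / (M - b * p x)) -
        π ^ 2 / M ^ 2 * ∫ x, u x ^ 2 * (M - b * p x)) ≤
      (1 + δ) * (M * (∫ x, q x * u x ^ 2) + δ * (2 * π ^ 2 / M ^ 2 + 1 / M) * ∫ x, u x ^ 2) := by
    rw [← integral_const_mul, ← integral_const_mul,
      ← integral_sub (i3.const_mul _) (i4.const_mul _), ← integral_const_mul, ← integral_const_mul,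
      ← integral_const_mul, ← integral_add (iV.const_mul _) (iY.const_mul _), ← integral_const_mul]
    refine integral_mono (((i3.const_mul _).sub (i4.const_mul _)).const_mul _)
      (((iV.const_mul _).add (iY.const_mul _)).const_mul _) fun x => ?_
    simp only
    rcases le_or_gt R |x| with hx | hx
    · simp [huR x hx]
    have hK := hK0 x
    have e1 : b⁻¹ * ((π ^ 2 + δ * b) * (u x ^ 2 / (M - b * p x)) -
        π ^ 2 / M ^ 2 * (u x ^ 2 * (M - b * p x))) =
        u x ^ 2 * (1 / (M - b * p x)) * (δ + π ^ 2 * p x * (2 * M - b * p x) / M ^ 2) := by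
      field_simp
      ring
    have e2 : π ^ 2 * p x * (2 * M - b * p x) / M ^ 2 ≤ 2 * π ^ 2 * p x / M := by
      rw [div_le_div_iff₀ (by positivity) hM]
      have : 0 ≤ π ^ 2 * p x * (b * p x) * M := by
        have := hp0 x
        positivity
      linarith
    have e3 : 2 * π ^ 2 * p x / M ≤ (M ^ 3 * q x + 2 * π ^ 2 * δ) / M := by
      have := hpq x hx.le
      gcongr
    have e4 : 0 ≤ δ + π ^ 2 * p x * (2 * M - b * p x) / M ^ 2 := by
      have := hp0 x
      have h2 : 0 ≤ 2 * M - b * p x := by linarith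
      positivity
    rw [e1]
    calc u x ^ 2 * (1 / (M - b * p x)) * (δ + π ^ 2 * p x * (2 * M - b * p x) / M ^ 2)
        ≤ u x ^ 2 * ((1 + δ) / M) * (δ + π ^ 2 * p x * (2 * M - b * p x) / M ^ 2) := by
          have := hKi x
          gcongr
      _ ≤ u x ^ 2 * ((1 + δ) / M) * (δ + (M ^ 3 * q x + 2 * π ^ 2 * δ) / M) := by
          have := e2.trans e3
          gcongr
      _ = (1 + δ) * (M * (q x * u x ^ 2) + δ * (2 * π ^ 2 / M ^ 2 + 1 / M) * u x ^ 2) := by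
          field_simp
          ring
  set E := ∫ x, deriv u x ^ 2
  set V := ∫ x, q x * u x ^ 2
  set Y := ∫ x, u x ^ 2
  have hY : 0 ≤ Y := integral_nonneg fun x => sq_nonneg _
  have g1 := mul_le_mul_of_nonneg_left f1 (by linarith : 0 ≤ 1 + δ)
  have g2 : (1 + δ⁻¹) * b ^ 2 * (π ^ 2 + δ * b) *
      (∫ x, u x ^ 2 * (deriv p x ^ 2 / (M - b * p x))) ≤
      (1 + δ⁻¹) * b ^ 2 * (π ^ 2 + δ) * (P' ^ 2 * (1 + δ) / M * Y) := by
    have h1 : δ * b ≤ δ := mul_le_of_le_one_right hδ.le hb1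
    have h2 : 0 ≤ ∫ x, u x ^ 2 * (deriv p x ^ 2 / (M - b * p x)) :=
      integral_nonneg fun x => by have := hK0 x; positivity
    gcongr
  have g3 := mul_lt_mul_of_pos_left hneg (by positivity : 0 < (1 + δ) * M)
  have g4 := mul_le_mul_of_nonneg_left f4 hs'
  have g5 := mul_le_mul_of_nonneg_right hnum hY
  linarith

variable {h : ℝ → ℝ} {M : ℝ}

/-- The trial function `u(x / a) S(y / k(x))` with `k(x) = ε (M - b p(x / a))`. -/
def trialFunction (ε a b M : ℝ) (p S u : ℝ → ℝ) (z : ℝ × ℝ) : ℝ :=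
  u (a⁻¹ * z.1) * S (z.2 / (ε * (M - b * p (a⁻¹ * z.1))))

theorem trialFunction_energy_lt {ε a b δ σ s' : ℝ} {p S u : ℝ → ℝ} (hε : 0 < ε) (ha : 0 < a)
    (hb : 0 < b) (hscale : b * a ^ 2 = ε ^ 2) (hp : ContDiff ℝ ∞ p)
    (hK : ∀ x, 0 < M - b * p x) (hu : ContDiff ℝ ∞ u) (hus : HasCompactSupport u)
    (hS : ContDiff ℝ ∞ S) (hσ : 0 < σ) (hSσ : ∀ y, y ∉ Set.Icc σ (1 - σ) → S y = 0)
    (hS0 : 0 < ∫ y, S y ^ 2)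
    (hS1 : ∫ y, deriv S y ^ 2 ≤ (π ^ 2 + δ * b) * ∫ y, S y ^ 2) (hδ : 0 < δ)
    (hkh : ∀ x ∈ tsupport (fun x => u (a⁻¹ * x)), ε * (M - b * p (a⁻¹ * x)) ≤ ε * h x)
    (hlt : (1 + δ) * (∫ x, deriv u x ^ 2 * (M - b * p x)) +
      (1 + δ⁻¹) * b ^ 2 * (π ^ 2 + δ * b) * (∫ x, u x ^ 2 * (deriv p x ^ 2 / (M - b * p x))) +
      b⁻¹ * ((π ^ 2 + δ * b) * (∫ x, u x ^ 2 / (M - b * p x)) -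
        π ^ 2 / M ^ 2 * ∫ x, u x ^ 2 * (M - b * p x)) <
      s' * ∫ x, u x ^ 2 * (M - b * p x)) :
    (∫ z in strip h ε, (fderiv ℝ (trialFunction ε a b M p S u) z (1, 0)) ^ 2) +
      (∫ z in strip h ε, (fderiv ℝ (trialFunction ε a b M p S u) z (0, 1)) ^ 2) <
    (π ^ 2 / (ε * M) ^ 2 + s' / a ^ 2) *
      ∫ z in strip h ε, trialFunction ε a b M p S u z ^ 2 := by
  have hk : ContDiff ℝ ∞ fun x => ε * (M - b * p (a⁻¹ * x)) :=
    contDiff_const.mul (contDiff_const.sub (contDiff_const.mul (hp.comp (by fun_prop))))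
  have hk0 : ∀ x, 0 < ε * (M - b * p (a⁻¹ * x)) := fun x => mul_pos hε (hK _)
  have hA : ContDiff ℝ ∞ fun x => u (a⁻¹ * x) := hu.comp (by fun_prop)
  have hAs : HasCompactSupport fun x => u (a⁻¹ * x) :=
    hus.comp_homeomorph (Homeomorph.mulLeft₀ a⁻¹ (inv_ne_zero ha.ne'))
  obtain ⟨t1, t2, t3⟩ := trial_energy hk hk0 hA hAs hS hσ hSσ hkh hδ
  have dA : ∀ x, deriv (fun x => u (a⁻¹ * x)) x = a⁻¹ * deriv u (a⁻¹ * x) := fun x => by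
    rw [deriv_comp_mul_left a⁻¹ u x, smul_eq_mul]
  have dk : ∀ x, deriv (fun x => ε * (M - b * p (a⁻¹ * x))) x =
      -(ε * (b * (a⁻¹ * deriv p (a⁻¹ * x)))) := fun x => by
    have h1 : HasDerivAt (fun x => p (a⁻¹ * x)) (deriv p (a⁻¹ * x) * (a⁻¹ * 1)) x :=
      (hp.differentiable (by simp) _).hasDerivAt.comp x ((hasDerivAt_id x).const_mul a⁻¹)
    rw [(((h1.const_mul b).const_sub M).const_mul ε).deriv]
    ring
  simp only [dA, dk] at t3
  have e1 := Measure.integral_comp_inv_mul_left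
    (fun x => u x ^ 2 * (ε * (M - b * p x))) a
  have e2 := Measure.integral_comp_inv_mul_left
    (fun x => u x ^ 2 / (ε * (M - b * p x))) a
  have e3 := Measure.integral_comp_inv_mul_left
    (fun x => (a⁻¹ * deriv u x) ^ 2 * (ε * (M - b * p x))) a
  have e4 := Measure.integral_comp_inv_mul_left
    (fun x => u x ^ 2 * ((-(ε * (b * (a⁻¹ * deriv p x)))) ^ 2 / (ε * (M - b * p x)))) a
  have c1 : ∫ x, u x ^ 2 * (ε * (M - b * p x)) = ε * ∫ x, u x ^ 2 * (M - b * p x) := by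
    rw [← integral_const_mul]
    congr 1
    ext x
    ring
  have c2 : ∫ x, u x ^ 2 / (ε * (M - b * p x)) = ε⁻¹ * ∫ x, u x ^ 2 / (M - b * p x) := by
    rw [← integral_const_mul]
    congr 1
    ext x
    have := (hK x).ne'
    field_simp
  have c3 : ∫ x, (a⁻¹ * deriv u x) ^ 2 * (ε * (M - b * p x)) =
      ε * a⁻¹ ^ 2 * ∫ x, deriv u x ^ 2 * (M - b * p x) := by
    rw [← integral_const_mul]
    congr 1
    ext x
    ring
  have c4 : ∫ x, u x ^ 2 * ((-(ε * (b * (a⁻¹ * deriv p x)))) ^ 2 / (ε * (M - b * p x))) =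
      ε * b ^ 2 * a⁻¹ ^ 2 * ∫ x, u x ^ 2 * (deriv p x ^ 2 / (M - b * p x)) := by
    rw [← integral_const_mul]
    congr 1
    ext x
    have := (hK x).ne'
    field_simp
  rw [smul_eq_mul, abs_of_pos ha] at e1 e2 e3 e4
  rw [c1] at e1
  rw [c2] at e2
  rw [c3] at e3
  rw [c4] at e4
  rw [e1] at t1
  rw [e2] at t2
  rw [e3, e4] at t3
  unfold trialFunction
  rw [t1, t2]
  refine (add_le_add_left t3 _).trans_lt ?_
  set I1 := ∫ x, u x ^ 2 * (M - b * p x)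
  have n2 : 0 ≤ ∫ x, u x ^ 2 / (M - b * p x) :=
    integral_nonneg fun x => by have := hK x; positivity
  set I2 := ∫ x, u x ^ 2 / (M - b * p x)
  set I3 := ∫ x, deriv u x ^ 2 * (M - b * p x)
  have n4 : 0 ≤ ∫ x, u x ^ 2 * (deriv p x ^ 2 / (M - b * p x)) :=
    integral_nonneg fun x => by have := hK x; positivity
  set I4 := ∫ x, u x ^ 2 * (deriv p x ^ 2 / (M - b * p x))
  set σ₀ := ∫ y, S y ^ 2
  set σ₁ := ∫ y, deriv S y ^ 2
  have hlt' := mul_lt_mul_of_pos_left hlt (by positivity : 0 < ε * a⁻¹ * σ₀)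
  have m4 : (1 + δ⁻¹) * (a * (ε * b ^ 2 * a⁻¹ ^ 2 * I4) * σ₁) ≤
      (1 + δ⁻¹) * (a * (ε * b ^ 2 * a⁻¹ ^ 2 * I4) * ((π ^ 2 + δ * b) * σ₀)) := by gcongr
  have m2 : a * (ε⁻¹ * I2) * σ₁ ≤ a * (ε⁻¹ * I2) * ((π ^ 2 + δ * b) * σ₀) := by gcongr
  -- `b⁻¹ ε / a = a / ε`, since `b a² = ε²`.
  have hrel : ε * a⁻¹ * b⁻¹ = a * ε⁻¹ := by
    field_simp
    linarith
  have x1 : ε * a⁻¹ * σ₀ * ((1 + δ) * I3 + (1 + δ⁻¹) * b ^ 2 * (π ^ 2 + δ * b) * I4 +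
      b⁻¹ * ((π ^ 2 + δ * b) * I2 - π ^ 2 / M ^ 2 * I1)) =
      (1 + δ) * (a * (ε * a⁻¹ ^ 2 * I3) * σ₀) +
      (1 + δ⁻¹) * (a * (ε * b ^ 2 * a⁻¹ ^ 2 * I4) * ((π ^ 2 + δ * b) * σ₀)) +
      (a * (ε⁻¹ * I2) * ((π ^ 2 + δ * b) * σ₀) -
        π ^ 2 / (ε * M) ^ 2 * (a * (ε * I1) * σ₀)) := by
    have y1 : ε * a⁻¹ * σ₀ * (b⁻¹ * ((π ^ 2 + δ * b) * I2 - π ^ 2 / M ^ 2 * I1)) =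
        a * ε⁻¹ * σ₀ * ((π ^ 2 + δ * b) * I2 - π ^ 2 / M ^ 2 * I1) := by
      rw [← hrel]; ring
    have y2 : π ^ 2 / (ε * M) ^ 2 * (a * (ε * I1) * σ₀) =
        a * ε⁻¹ * σ₀ * (π ^ 2 / M ^ 2 * I1) := by
      field_simp
    have y3 : a * a⁻¹ ^ 2 = a⁻¹ := by field_simp
    rw [mul_add, y1, y2]
    linear_combination ((1 + δ) * (-ε * I3) * σ₀ -
      (1 + δ⁻¹) * (ε * b ^ 2 * I4) * ((π ^ 2 + δ * b) * σ₀)) * y3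
  have x2 : ε * a⁻¹ * σ₀ * (s' * I1) = s' / a ^ 2 * (a * (ε * I1) * σ₀) := by
    field_simp
  rw [x1, x2] at hlt'
  linarith

/-- A bounded smooth function that exceeds `f` slightly on `[-R, R]`. -/
theorem exists_smooth_majorant {f : ℝ → ℝ} (hf : Continuous f) (hf0 : ∀ x, 0 ≤ f x) (R : ℝ)
    {δ : ℝ} (hδ : 0 < δ) : ∃ (p : ℝ → ℝ) (P P' : ℝ), ContDiff ℝ ∞ p ∧ (∀ x, 0 ≤ p x) ∧
      (∀ x, p x ≤ P) ∧ (∀ x, |x| ≤ R → |deriv p x| ≤ P') ∧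
      ∀ x, |x| ≤ R → f x + δ / 4 ≤ p x ∧ p x ≤ f x + δ := by
  obtain ⟨B, hB⟩ := (isCompact_Icc (a := -R) (b := R)).exists_bound_of_continuousOn hf.continuousOn
  have hfc : Continuous fun x => min (f x) |B| + δ / 2 := by fun_prop
  obtain ⟨p, hp, hpf, -⟩ := hfc.exists_contDiff_approx ⊤ (ε := fun _ => δ / 4) continuous_const
    fun _ => by positivity
  obtain ⟨P', hP'⟩ := (isCompact_Icc (a := -R) (b := R)).exists_bound_of_continuousOn
    (hp.continuous_deriv (by simp)).continuousOn
  have hdist : ∀ x, |p x - (min (f x) |B| + δ / 2)| < δ / 4 := fun x => hpf x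
  refine ⟨p, |B| + δ, P', hp, fun x => ?_, fun x => ?_, fun x hx => hP' x (abs_le.1 hx),
    fun x hx => ?_⟩
  · have := (abs_lt.1 (hdist x)).1
    have h0 : 0 ≤ min (f x) |B| := le_min (hf0 x) (abs_nonneg _)
    linarith
  · have := (abs_lt.1 (hdist x)).2
    have h0 : min (f x) |B| ≤ |B| := min_le_right _ _
    linarith
  · have h0 : min (f x) |B| = f x :=
      min_eq_left ((le_abs_self _).trans ((hB x (abs_le.1 hx)).trans (le_abs_self _)))
    have := abs_lt.1 (hdist x)
    rw [h0] at this
    constructor <;> linarith [this.1, this.2]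

/-- A negative subspace for the limiting form at the energy `s` gives one for the strip at any
higher rescaled energy, by means of `trialFunction`. -/
theorem eventually_negTriples_testTriples (hM : 0 < M) {q : ℝ → ℝ} (hq : Continuous q)
    (hq0 : ∀ x, 0 ≤ q x) {m : ℝ} (hm : 0 < m)
    (hhom : ∀ a, 0 < a → ∀ x, q (a * x) = a ^ m * q x)
    (hnear : ∀ δ > 0, ∃ ρ > 0, ∀ x, |x| ≤ ρ →
      M - (1 + δ) * (M ^ 3 / (2 * π ^ 2) * q x) ≤ h x) {s s' : ℝ} (hss' : s < s') {k : ℕ}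
    (hneg : NegTriples (schrodingerForm q) k s) : ∀ᶠ ε : ℝ in 𝓝[>] 0,
      NegTriples (testTriples (strip h ε)) k
        (π ^ 2 / (ε * M) ^ 2 + s' / (ε ^ (2 / (m + 2))) ^ 2) := by
  have hπ := pi_pos
  obtain ⟨u, hu, hneg⟩ := hneg.exists_contDiff hq hq0
  rcases le_or_gt s 0 with hs | hs
  · refine Eventually.of_forall fun ε => negTriples_testTriples_iff.2 ⟨fun _ _ => 0,
      fun _ => ⟨contDiff_const, HasCompactSupport.zero, ?_⟩, fun c hc => ?_⟩
    · have : tsupport (fun _ : ℝ × ℝ => (0 : ℝ)) = ∅ := by simp [tsupport]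
      rw [this]
      exact Set.empty_subset _
    · exfalso
      have h1 := hneg c hc
      have e1 : 0 ≤ ∫ x, deriv (fun x => ∑ i, c i * u i x) x ^ 2 :=
        integral_nonneg fun x => sq_nonneg _
      have e2 : 0 ≤ ∫ x, q x * (∑ i, c i * u i x) ^ 2 :=
        integral_nonneg fun x => mul_nonneg (hq0 x) (sq_nonneg _)
      have e3 : s * ∫ x, (∑ i, c i * u i x) ^ 2 ≤ 0 :=
        mul_nonpos_of_nonpos_of_nonneg hs (integral_nonneg fun x => sq_nonneg _)
      linarith
  have hs' : 0 < s' := hs.trans hss'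
  obtain ⟨R, hR, huR⟩ : ∃ R > 0, ∀ i x, R ≤ |x| → u i x = 0 := by
    choose r hr hur using fun i => exists_forall_abs_ge_eq_zero (hu i).2
    refine ⟨1 + ∑ i, r i, by have := Finset.sum_nonneg fun i (_ : i ∈ Finset.univ) => (hr i).le
                             linarith, fun i x hx => hur i x ?_⟩
    have := Finset.single_le_sum (fun i _ => (hr i).le) (Finset.mem_univ i)
    linarith
  obtain ⟨δ, hδ, hδnum⟩ : ∃ δ > 0,
      (1 + δ) * M * s + (1 + δ) * (δ * (2 * π ^ 2 / M ^ 2 + 1 / M)) < s' * M := by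
    have hcont : ContinuousAt (fun δ : ℝ =>
        (1 + δ) * M * s + (1 + δ) * (δ * (2 * π ^ 2 / M ^ 2 + 1 / M))) 0 := by fun_prop
    have h1 : ∀ᶠ δ : ℝ in 𝓝 0,
        (1 + δ) * M * s + (1 + δ) * (δ * (2 * π ^ 2 / M ^ 2 + 1 / M)) < s' * M :=
      hcont.eventually_lt continuousAt_const (by
        have := mul_lt_mul_of_pos_left hss' hM
        simp only [add_zero, one_mul, zero_mul, mul_zero]
        linarith)
    obtain ⟨δ, h2, h3⟩ := ((h1.filter_mono nhdsWithin_le_nhds).and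
      (self_mem_nhdsWithin (s := Set.Ioi (0 : ℝ)))).exists
    exact ⟨δ, h3, h2⟩
  set β := M ^ 3 / (2 * π ^ 2) with hβ
  have hβ0 : 0 < β := by positivity
  obtain ⟨p, P, P', hp, hp0, hpP, hpP', hpf⟩ := exists_smooth_majorant
    (f := fun x => β * q x) (by fun_prop) (fun x => mul_nonneg hβ0.le (hq0 x)) R hδ
  have hP0 : 0 ≤ P := (hp0 0).trans (hpP 0)
  obtain ⟨ρ, hρ, hnear⟩ := hnear (δ / 4 / (P + 1)) (by positivity)
  have ta := tendsto_nhdsWithin_iff.1 (tendsto_scale hm)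
  have tam : Tendsto (fun ε : ℝ => (ε ^ (2 / (m + 2))) ^ m) (𝓝[>] 0) (𝓝 0) := by
    have := (Real.continuousAt_rpow_const (0 : ℝ) m (Or.inr hm.le)).tendsto
    rw [Real.zero_rpow hm.ne'] at this
    exact this.comp ta.1
  have hnum : ∀ᶠ b : ℝ in 𝓝 0, (1 + δ) * M * s +
      (1 + δ⁻¹) * b ^ 2 * (π ^ 2 + δ) * (P' ^ 2 * (1 + δ) / M) +
      (1 + δ) * (δ * (2 * π ^ 2 / M ^ 2 + 1 / M)) < s' * (M - b * P) := by
    refine ContinuousAt.eventually_lt (by fun_prop) (by fun_prop) ?_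
    simp only [zero_pow two_ne_zero, mul_zero, zero_mul, add_zero, sub_zero]
    exact hδnum
  have hbM : ∀ᶠ b : ℝ in 𝓝 0, M < (1 + δ) * (M - b * P) := by
    refine ContinuousAt.eventually_lt (by fun_prop) (by fun_prop) ?_
    simp only [zero_mul, sub_zero]
    nlinarith
  filter_upwards [self_mem_nhdsWithin, ta.1.eventually_le_const (by positivity : 0 < ρ / R),
    tam.eventually_le_const one_pos, tam.eventually hnum, tam.eventually hbM]
    with ε hε haR hb1 hnum hbM
  have hε : 0 < ε := hε
  have hscale := scale_rpow_mul_sq hε hm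
  have ha : 0 < ε ^ (2 / (m + 2)) := Real.rpow_pos_of_pos hε _
  set a := ε ^ (2 / (m + 2)) with hadef
  have ham : 0 < a ^ m := Real.rpow_pos_of_pos ha _
  have hhoma := hhom a ha
  set b := a ^ m with hbdef
  -- Relative to the threshold, of order `1 / ε²`, the error of the profile must be small compared
  -- to `1 / a² = b / ε²`, so the profile is chosen after `ε`.
  obtain ⟨S, hS, ⟨σ, hσ, hSσ⟩, hS0, hS1⟩ := exists_profile (mul_pos hδ ham)
  have hK : ∀ x, 0 < M - b * p x := fun x => by
    have h1 := mul_le_mul_of_nonneg_left (hpP x) ham.le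
    have h2 : 0 < M - b * P := pos_of_mul_pos_right (hM.trans hbM) (by linarith)
    linarith
  have hstrip : ∀ x, |x| ≤ R → M - b * p x ≤ h (a * x) := fun x hx => by
    have h1 := hnear (a * x) (by
      rw [abs_mul, abs_of_pos ha]
      rw [le_div_iff₀ hR] at haR
      exact (mul_le_mul_of_nonneg_left hx ha.le).trans haR)
    rw [hhoma] at h1
    refine le_trans ?_ h1
    have h2 := (hpf x hx).1
    have h3 : δ / 4 / (P + 1) * (β * q x) ≤ δ / 4 := by
      rw [div_mul_eq_mul_div, div_le_iff₀ (by positivity)]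
      have := hpP x
      gcongr
      linarith
    have h4 : b * ((1 + δ / 4 / (P + 1)) * (β * q x)) ≤ b * p x := by
      gcongr
      linarith
    linarith
  have hsupp : ∀ v : ℝ → ℝ, (∀ x, R ≤ |x| → v x = 0) →
      ∀ x ∈ tsupport (fun x => v (a⁻¹ * x)), ε * (M - b * p (a⁻¹ * x)) ≤ ε * h x := by
    intro v hv x hx
    have h1 : |a⁻¹ * x| ≤ R := by
      have hcl : IsClosed {x : ℝ | |a⁻¹ * x| ≤ R} := isClosed_le (by fun_prop) continuous_const
      refine closure_minimal (fun y hy => ?_) hcl hx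
      by_contra hcon
      exact hy (hv _ (not_le.1 hcon).le)
    have h2 := hstrip _ h1
    rw [mul_inv_cancel_left₀ ha.ne'] at h2
    gcongr
  have hkc : ContDiff ℝ ∞ fun x => ε * (M - b * p (a⁻¹ * x)) :=
    contDiff_const.mul (contDiff_const.sub (contDiff_const.mul (hp.comp (by fun_prop))))
  have hk0 : ∀ x, 0 < ε * (M - b * p (a⁻¹ * x)) := fun x => mul_pos hε (hK _)
  refine negTriples_testTriples_iff.2 ⟨fun i => trialFunction ε a b M p S (u i), fun i => ?_,
    fun c hc => ?_⟩
  · have hAs : HasCompactSupport fun x => u i (a⁻¹ * x) :=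
      (hu i).2.comp_homeomorph (Homeomorph.mulLeft₀ a⁻¹ (inv_ne_zero ha.ne'))
    obtain ⟨K, hKc, hKs, hK0⟩ := exists_compact_support_mul_comp_div (h := h) (ε := ε)
      hkc.continuous hk0 hAs hσ (hsupp _ (huR i))
    have hz : ∀ z ∉ K, trialFunction ε a b M p S (u i) z = 0 := fun z hz => hK0 S hSσ z hz
    exact ⟨contDiff_mul_comp_div hkc hk0 ((hu i).1.comp (by fun_prop)) hS,
      HasCompactSupport.intro hKc hz, (closure_minimal (fun z h1 => by
        by_contra h2
        exact h1 (hz z h2)) hKc.isClosed).trans hKs⟩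
  · have hsum : ∀ z, ∑ i, c i * trialFunction ε a b M p S (u i) z =
        trialFunction ε a b M p S (fun x => ∑ i, c i * u i x) z := fun z => by
      simp only [trialFunction, Finset.sum_mul, mul_assoc]
    simp only [hsum]
    have hv : ContDiff ℝ ∞ fun x => ∑ i, c i * u i x :=
      ContDiff.sum fun i _ => contDiff_const.mul (hu i).1
    have hvR : ∀ x, R ≤ |x| → ∑ i, c i * u i x = 0 := fun x hx =>
      Finset.sum_eq_zero fun i _ => by rw [huR i x hx, mul_zero]
    have hvs := hasCompactSupport_of_abs_ge hvR
    refine trialFunction_energy_lt hε ha ham hscale hp hK hv hvs hS hσ hSσ hS0 hS1 hδ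
      (hsupp _ hvR) ?_
    refine rescaled_energy_lt hM hq (hv.of_le (by simp)) hvs hvR (hp.of_le (by simp)) hp0 hpP hpP'
      (fun x hx => ?_) ham hb1 hδ hbM.le hs'.le hnum.le (hneg c hc)
    have h1 := mul_le_mul_of_nonneg_left (hpf x hx).2 (by positivity : 0 ≤ 2 * π ^ 2)
    have h2 : 2 * π ^ 2 * (β * q x) = M ^ 3 * q x := by
      rw [hβ]
      field_simp
    linarith

end UpperBound

/-! ### The limiting potential and the profile near its maximum -/

section Potential
open Real

variable {M cp cm m : ℝ}

theorem potential_eq (hm : 0 < m) (x : ℝ) : potential M cp cm m x =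
    2 * π ^ 2 * M⁻¹ ^ 3 * (cp * max x 0 ^ m + cm * max (-x) 0 ^ m) := by
  rw [potential]
  split_ifs with h
  · rw [max_eq_left h.le, max_eq_right (by linarith), zero_rpow hm.ne']
    ring
  · rw [max_eq_right (not_lt.1 h), max_eq_left (by linarith [not_lt.1 h]), zero_rpow hm.ne',
      abs_of_nonpos (not_lt.1 h)]
    ring

theorem continuous_potential (hm : 0 < m) : Continuous (potential M cp cm m) := by
  rw [show potential M cp cm m = _ from funext fun x => potential_eq hm x]
  have h1 : Continuous fun x : ℝ => max x 0 ^ m :=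
    (continuous_id.max continuous_const).rpow_const fun _ => Or.inr hm.le
  have h2 : Continuous fun x : ℝ => max (-x) 0 ^ m :=
    (continuous_neg.max continuous_const).rpow_const fun _ => Or.inr hm.le
  fun_prop

theorem potential_nonneg (hM : 0 < M) (hcp : 0 < cp) (hcm : 0 < cm) (x : ℝ) :
    0 ≤ potential M cp cm m x := by
  rw [potential]
  split_ifs with h <;> positivity

theorem potential_mul {a : ℝ} (ha : 0 < a) (x : ℝ) :
    potential M cp cm m (a * x) = a ^ m * potential M cp cm m x := by
  simp only [potential, mul_pos_iff_of_pos_left ha]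
  split_ifs with h
  · rw [mul_rpow ha.le h.le]
    ring
  · rw [abs_mul, abs_of_pos ha, mul_rpow ha.le (abs_nonneg _)]
    ring

theorem le_potential (hM : 0 < M) (x : ℝ) :
    2 * π ^ 2 * M⁻¹ ^ 3 * min cp cm * |x| ^ m ≤ potential M cp cm m x := by
  rw [potential]
  split_ifs with h
  · rw [abs_of_pos h]
    have := min_le_left cp cm
    gcongr
  · have := min_le_right cp cm
    gcongr

theorem exists_le_potential (hM : 0 < M) (hcp : 0 < cp) (hcm : 0 < cm) (hm : 0 < m) (B : ℝ) :
    ∃ R, 0 < R ∧ ∀ x, R ≤ |x| → B ≤ potential M cp cm m x := by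
  have hc : 0 < 2 * π ^ 2 * M⁻¹ ^ 3 * min cp cm := by
    have := lt_min hcp hcm
    positivity
  have ht : Tendsto (fun r : ℝ => 2 * π ^ 2 * M⁻¹ ^ 3 * min cp cm * r ^ m) atTop atTop :=
    (tendsto_rpow_atTop hm).const_mul_atTop hc
  obtain ⟨R, hR⟩ := (eventually_atTop.1 ((ht.eventually_ge_atTop B).and (eventually_gt_atTop 0)))
  exact ⟨R, (hR R le_rfl).2, fun x hx => (hR _ hx).1.trans (le_potential hM x)⟩

variable {h : ℝ → ℝ}

theorem eq_apply_zero_of_expansion (h_cont : Continuous h) (hm : 0 < m)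
    (h_right : (fun x : ℝ => h x - (M - cp * x ^ m)) =O[𝓝[>] 0] (fun x : ℝ => x ^ (m + 1))) :
    M = h 0 := by
  have h1 : Tendsto (fun x : ℝ => x ^ (m + 1)) (𝓝[>] 0) (𝓝 0) := by
    have := (Real.continuousAt_rpow_const (0 : ℝ) (m + 1) (Or.inr (by positivity))).tendsto
    rw [zero_rpow (by positivity)] at this
    exact this.mono_left nhdsWithin_le_nhds
  have h2 : Tendsto (fun x : ℝ => h x - (M - cp * x ^ m)) (𝓝[>] 0) (𝓝 (h 0 - M)) := by
    have : ContinuousAt (fun x : ℝ => h x - (M - cp * x ^ m)) 0 :=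
      h_cont.continuousAt.sub (continuousAt_const.sub
        (continuousAt_const.mul (Real.continuousAt_rpow_const _ _ (Or.inr hm.le))))
    have := this.tendsto
    rw [zero_rpow hm.ne', mul_zero, sub_zero] at this
    exact this.mono_left nhdsWithin_le_nhds
  have := tendsto_nhds_unique h2 (h_right.trans_tendsto h1)
  linarith

theorem eventually_abs_le_of_isBigO {g : ℝ → ℝ} {c δ : ℝ} {l : Filter ℝ} (hl : l ≤ 𝓝 0)
    (hl0 : ∀ᶠ x in l, x ≠ 0) (hc : 0 < c) (hδ : 0 < δ)
    (hg : g =O[l] fun x : ℝ => |x| ^ (m + 1)) : ∀ᶠ x in l, |g x| ≤ δ * (c * |x| ^ m) := by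
  obtain ⟨C, hC, hCg⟩ := hg.exists_pos
  have hsmall : ∀ᶠ x in l, |x| ≤ δ * c / C := by
    have : Tendsto (fun x : ℝ => |x|) l (𝓝 0) := by
      have := (continuous_abs (G := ℝ)).tendsto 0
      rw [abs_zero] at this
      exact this.mono_left hl
    exact this.eventually_le_const (by positivity)
  filter_upwards [hCg.bound, hsmall, hl0] with x h1 h2 h3
  rw [Real.norm_eq_abs, Real.norm_of_nonneg (by positivity), rpow_add_one (abs_pos.2 h3).ne'] at h1
  refine h1.trans ?_
  rw [le_div_iff₀ hC] at h2
  have := mul_le_mul_of_nonneg_left h2 (by positivity : 0 ≤ |x| ^ m)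
  linarith

/-- The two one-sided expansions at `0` say that `M - h` is asymptotic to a multiple of the
limiting potential. -/
theorem exists_abs_sub_le_potential (hM : 0 < M) (hcp : 0 < cp) (hcm : 0 < cm) (hm : 0 < m)
    (h0 : M = h 0)
    (h_right : (fun x : ℝ => h x - (M - cp * x ^ m)) =O[𝓝[>] 0] (fun x : ℝ => x ^ (m + 1)))
    (h_left : (fun x : ℝ => h x - (M - cm * |x| ^ m)) =O[𝓝[<] 0] (fun x : ℝ => |x| ^ (m + 1)))
    {δ : ℝ} (hδ : 0 < δ) : ∃ ρ > 0, ∀ x, |x| ≤ ρ →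
      |h x - (M - M ^ 3 / (2 * π ^ 2) * potential M cp cm m x)| ≤
        δ * (M ^ 3 / (2 * π ^ 2) * potential M cp cm m x) := by
  have hpi := pi_pos
  have e1 : ∀ c y : ℝ, M ^ 3 / (2 * π ^ 2) * (2 * π ^ 2 * M⁻¹ ^ 3 * c * y) = c * y := fun c y => by
    field_simp
  have hr : ∀ᶠ x in 𝓝[>] (0 : ℝ), |h x - (M - M ^ 3 / (2 * π ^ 2) * potential M cp cm m x)| ≤
      δ * (M ^ 3 / (2 * π ^ 2) * potential M cp cm m x) := by
    have hg : (fun x : ℝ => h x - (M - cp * x ^ m)) =O[𝓝[>] 0] (fun x : ℝ => |x| ^ (m + 1)) := by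
      refine h_right.trans_eventuallyEq ?_
      filter_upwards [self_mem_nhdsWithin] with x hx
      rw [abs_of_pos hx]
    filter_upwards [self_mem_nhdsWithin, eventually_abs_le_of_isBigO nhdsWithin_le_nhds
      (by filter_upwards [self_mem_nhdsWithin] with x hx using ne_of_gt hx) hcp hδ hg] with x hx h1
    have hx : 0 < x := hx
    rw [abs_of_pos hx] at h1
    rwa [potential, if_pos hx, e1]
  have hl : ∀ᶠ x in 𝓝[<] (0 : ℝ), |h x - (M - M ^ 3 / (2 * π ^ 2) * potential M cp cm m x)| ≤
      δ * (M ^ 3 / (2 * π ^ 2) * potential M cp cm m x) := by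
    filter_upwards [self_mem_nhdsWithin, eventually_abs_le_of_isBigO nhdsWithin_le_nhds
      (by filter_upwards [self_mem_nhdsWithin] with x hx using ne_of_lt hx) hcm hδ h_left]
      with x hx h1
    have hx : x < 0 := hx
    rwa [potential, if_neg hx.not_gt, e1]
  have hz : |h 0 - (M - M ^ 3 / (2 * π ^ 2) * potential M cp cm m 0)| ≤
      δ * (M ^ 3 / (2 * π ^ 2) * potential M cp cm m 0) := by
    rw [potential, if_neg (lt_irrefl _), abs_zero, zero_rpow hm.ne', ← h0]
    simp
  have hall : ∀ᶠ x in 𝓝 (0 : ℝ), |h x - (M - M ^ 3 / (2 * π ^ 2) * potential M cp cm m x)| ≤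
      δ * (M ^ 3 / (2 * π ^ 2) * potential M cp cm m x) := by
    rw [← nhdsNE_sup_pure, ← nhdsLT_sup_nhdsGT, eventually_sup, eventually_sup]
    exact ⟨⟨hl, hr⟩, hz⟩
  obtain ⟨ρ, hρ, hball⟩ := Metric.eventually_nhds_iff.1 hall
  refine ⟨ρ / 2, by positivity, fun x hx => hball ?_⟩
  rw [dist_zero_right, Real.norm_eq_abs]
  linarith

theorem mul_sub_le_excess (hpos : ∀ x, 0 < h x) (hM : ∀ x, h x ≤ M) (x : ℝ) :
    2 * π ^ 2 / M ^ 3 * (M - h x) ≤ excess h 1 M x := by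
  have h1 := hpos x
  have h2 := hM x
  have h3 : 0 < M := h1.trans_le h2
  have e : excess h 1 M x - 2 * π ^ 2 / M ^ 3 * (M - h x) =
      π ^ 2 * (M - h x) ^ 2 * (M + 2 * h x) / (h x ^ 2 * M ^ 3) := by
    rw [excess]
    field_simp
    ring
  have : 0 ≤ π ^ 2 * (M - h x) ^ 2 * (M + 2 * h x) / (h x ^ 2 * M ^ 3) := by positivity
  linarith

/-- Away from its maximum the profile stays below `M` by a fixed amount. -/
theorem exists_excess_ge (hpos : ∀ x, 0 < h x) (h_cont : Continuous h) (h0 : M = h 0)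
    (h_max : ∀ x, x ≠ 0 → h x < h 0)
    (h_inf : limsup h (comap (fun x : ℝ => |x|) atTop) < M) {ρ : ℝ} (hρ : 0 < ρ) :
    ∃ κ > 0, ∀ x, ρ ≤ |x| → κ ≤ excess h 1 M x := by
  have hle : ∀ x, h x ≤ M := fun x => by
    rcases eq_or_ne x 0 with rfl | hx
    · exact h0.ge
    · exact h0 ▸ (h_max x hx).le
  obtain ⟨b, hb1, hb2⟩ := exists_between h_inf
  have hev := eventually_lt_of_limsup_lt hb1 (isBoundedUnder_of ⟨M, hle⟩)
  obtain ⟨R, hR⟩ := eventually_atTop.1 (eventually_comap.1 hev)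
  have hM : 0 < M := h0 ▸ hpos 0
  obtain ⟨b', hb'1, hb'2⟩ : ∃ b' < M, ∀ x, ρ ≤ |x| → h x ≤ b' := by
    have hK : IsCompact {x : ℝ | ρ ≤ |x| ∧ |x| ≤ R} := by
      refine (isCompact_Icc (a := -R) (b := R)).of_isClosed_subset ?_ fun x hx => abs_le.1 hx.2
      exact (isClosed_le continuous_const continuous_abs).inter
        (isClosed_le continuous_abs continuous_const)
    rcases Set.eq_empty_or_nonempty {x : ℝ | ρ ≤ |x| ∧ |x| ≤ R} with he | hne
    · refine ⟨b, hb2, fun x hx => ?_⟩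
      rcases le_or_gt |x| R with h1 | h1
      · exact absurd (show x ∈ {x : ℝ | ρ ≤ |x| ∧ |x| ≤ R} from ⟨hx, h1⟩) (by simp [he])
      · exact (hR _ h1.le x rfl).le
    · obtain ⟨z, hz, hzmax⟩ := hK.exists_isMaxOn hne h_cont.continuousOn
      refine ⟨max b (h z), max_lt hb2 ?_, fun x hx => ?_⟩
      · rw [h0]
        exact h_max z (abs_pos.1 (hρ.trans_le hz.1))
      · rcases le_or_gt |x| R with h1 | h1
        · exact (hzmax ⟨hx, h1⟩).trans (le_max_right _ _)
        · exact (hR _ h1.le x rfl).le.trans (le_max_left _ _)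
  have hpi := pi_pos
  refine ⟨2 * π ^ 2 / M ^ 3 * (M - b'), mul_pos (by positivity) (by linarith), fun x hx => ?_⟩
  refine le_trans ?_ (mul_sub_le_excess hpos hle x)
  have := hb'2 x hx
  gcongr

end Potential

/-! ### Many trial functions for the limiting operator -/

theorem sq_sum_of_pairwise_mul_eq_zero {k : ℕ} {a : Fin k → ℝ}
    (ha : ∀ i j, i ≠ j → a i * a j = 0) (c : Fin k → ℝ) :
    (∑ i, c i * a i) ^ 2 = ∑ i, c i ^ 2 * a i ^ 2 := by
  rw [sq, Finset.sum_mul_sum]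
  refine Finset.sum_congr rfl fun i _ => ?_
  rw [Finset.sum_eq_single i]
  · ring
  · intro j _ hj
    linear_combination (c i * c j) * ha i j hj.symm
  · simp

/-- Bumps with disjoint supports span subspaces of any finite dimension on which the form is
bounded. -/
theorem exists_negTriples_schrodingerForm {q : ℝ → ℝ} (hq : Continuous q) (hq0 : ∀ x, 0 ≤ q x)
    (k : ℕ) : ∃ s, NegTriples (schrodingerForm q) k s := by
  let b : Fin k → ℝ → ℝ := fun i =>
    (⟨1, 2, one_pos, one_lt_two⟩ : ContDiffBump (6 * (i : ℕ) : ℝ))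
  have hb : ∀ i, ContDiff ℝ 1 (b i) := fun i => ContDiffBump.contDiff _
  have hbs : ∀ i, HasCompactSupport (b i) := fun i => ContDiffBump.hasCompactSupport _
  have hbt : ∀ i, tsupport (b i) = Metric.closedBall (6 * (i : ℕ) : ℝ) 2 := fun i =>
    ContDiffBump.tsupport_eq _
  have hdisj : ∀ i j, i ≠ j → ∀ x, x ∈ tsupport (b i) → x ∉ tsupport (b j) := by
    intro i j hij x hi hj
    rw [hbt, Metric.mem_closedBall, Real.dist_eq, abs_le] at hi hj
    rcases lt_or_gt_of_ne (fun h => hij (Fin.ext h) : (i : ℕ) ≠ j) with h | h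
    · have : ((i : ℕ) : ℝ) + 1 ≤ (j : ℕ) := by exact_mod_cast h
      linarith [hi.1, hi.2, hj.1, hj.2]
    · have : ((j : ℕ) : ℝ) + 1 ≤ (i : ℕ) := by exact_mod_cast h
      linarith [hi.1, hi.2, hj.1, hj.2]
  have hmul : ∀ f : Fin k → ℝ → ℝ, (∀ i, tsupport (f i) ⊆ tsupport (b i)) →
      ∀ x i j, i ≠ j → f i x * f j x = 0 := by
    intro f hf x i j hij
    by_contra hne
    exact hdisj i j hij x (hf i (subset_tsupport _ (left_ne_zero_of_mul hne)))
      (hf j (subset_tsupport _ (right_ne_zero_of_mul hne)))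
  have hbd : ∀ i, Continuous (deriv (b i)) := fun i => (hb i).continuous_deriv le_rfl
  have hone : Continuous fun _ : ℝ => (1 : ℝ) := continuous_const
  have iN : ∀ i, Integrable fun x => b i x ^ 2 := fun i => by
    simpa using integrable_mul_sq hone (hb i).continuous (hbs i)
  have iE : ∀ i, Integrable fun x => deriv (b i) x ^ 2 := fun i => by
    simpa using integrable_mul_sq hone (hbd i) (hbs i).deriv
  have iV : ∀ i, Integrable fun x => q x * b i x ^ 2 := fun i =>
    integrable_mul_sq hq (hb i).continuous (hbs i)
  have hN : ∀ i, 0 < ∫ x, b i x ^ 2 := fun i => by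
    refine ((hb i).continuous.pow 2).integral_pos_of_hasCompactSupport_nonneg_nonzero
      ?_ (fun x => sq_nonneg _) (x := 6 * (i : ℕ)) ?_
    · simp only [sq]
      exact (hbs i).mul_left
    · have : b i (6 * (i : ℕ)) = 1 := ContDiffBump.one_of_mem_closedBall _
        (Metric.mem_closedBall_self zero_le_one)
      rw [this]
      norm_num
  set F : Fin k → ℝ := fun i => (∫ x, deriv (b i) x ^ 2) + ∫ x, q x * b i x ^ 2 with hF
  have hF0 : ∀ i, 0 ≤ F i := fun i => add_nonneg (integral_nonneg fun x => sq_nonneg _)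
    (integral_nonneg fun x => mul_nonneg (hq0 x) (sq_nonneg _))
  set s := 1 + ∑ i, F i / ∫ x, b i x ^ 2 with hs
  refine ⟨s, negTriples_schrodingerForm hq hq0 hb hbs fun c hc => ?_⟩
  simp only [deriv_sum_mul fun i => (hb i).differentiable one_ne_zero,
    sq_sum_of_pairwise_mul_eq_zero fun i j hij => hmul b (fun i => le_rfl) _ i j hij,
    sq_sum_of_pairwise_mul_eq_zero fun i j hij =>
      hmul (fun i => deriv (b i)) (fun i => tsupport_deriv_subset) _ i j hij]
  simp only [Finset.mul_sum, mul_left_comm (q _)]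
  rw [integral_finsetSum _ fun i _ => (iE i).const_mul _,
    integral_finsetSum _ fun i _ => (iV i).const_mul _,
    integral_finsetSum _ fun i _ => (iN i).const_mul _]
  simp only [integral_const_mul]
  rw [← Finset.sum_add_distrib, Finset.mul_sum]
  have hle : ∀ i, F i < s * ∫ x, b i x ^ 2 := fun i => by
    have h1 : F i / ∫ x, b i x ^ 2 ≤ ∑ i, F i / ∫ x, b i x ^ 2 :=
      Finset.single_le_sum (f := fun i => F i / ∫ x, b i x ^ 2)
        (fun i _ => div_nonneg (hF0 i) (hN i).le) (Finset.mem_univ i)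
    rw [← div_lt_iff₀ (hN i)]
    linarith
  obtain ⟨i₀, hi₀⟩ := Function.ne_iff.1 hc
  refine Finset.sum_lt_sum (fun i _ => ?_) ⟨i₀, Finset.mem_univ _, ?_⟩
  · have := mul_le_mul_of_nonneg_left (hle i).le (sq_nonneg (c i))
    simp only [hF] at this
    linarith
  · have := mul_lt_mul_of_pos_left (hle i₀) (by positivity [show c i₀ ≠ 0 from hi₀] : 0 < c i₀ ^ 2)
    simp only [hF] at this
    linarith

/-! ### The eigenvalues of the strip -/

section Strip
open Real

theorem NegTriples.of_le {H : Type*} [NormedAddCommGroup H] [InnerProductSpace ℝ H]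
    {D D' : Submodule ℝ (H × H × H)} (hD : D ≤ D') {k : ℕ} {s : ℝ} (h : NegTriples D k s) :
    NegTriples D' k s :=
  let ⟨Φ, hΦ, hneg⟩ := h
  ⟨Φ, fun i => hD (hΦ i), hneg⟩

variable {h : ℝ → ℝ} {M κ : ℝ}

/-- The level below which the spectrum is discrete exceeds the threshold by a multiple of
`1 / ε²`. -/
theorem formDefect_sobolevZero (hc : Continuous h) (hpos : ∀ x, 0 < h x) (hM : ∀ x, h x ≤ M)
    (hκ : 0 < κ) (hfar : ∀ x, 1 ≤ |x| → κ ≤ excess h 1 M x) (hκM : κ ≤ 2 / M ^ 2)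
    {ε : ℝ} (hε : 0 < ε) :
    FormDefect (sobolevZero (strip h ε)) (π ^ 2 / (ε * M) ^ 2 + κ / ε ^ 2 / 2) := by
  have hM0 : 0 < M := (hpos 0).trans_le (hM 0)
  refine (formDefect_testTriples hε hc hpos hM one_pos (by positivity) (fun x hx => ?_) ?_).closure
  · rw [excess_eq_div_sq]
    have := hfar x hx
    gcongr
  · rw [mul_pow, mul_comm, ← div_div]
    gcongr

/-- `t` is the `j`-th eigenvalue of the Dirichlet Laplacian on the strip, it lies below the
essential spectrum, and it is given by the min-max principle. -/
def IsMinMaxEigenvalue (h : ℝ → ℝ) (ε : ℝ) (j : ℕ) (t : ℝ) : Prop :=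
  IsNthEigenvalue (dirichletLaplacian (strip h ε)) j t ∧
  (t : EReal) < essBottom (dirichletLaplacian (strip h ε)) ∧
  (∀ s, t < s → NegTriples (testTriples (strip h ε)) (j + 1) s) ∧
  ∀ s, NegTriples (testTriples (strip h ε)) (j + 1) s → t ≤ s

theorem le_essBottom_strip (hc : Continuous h) (hpos : ∀ x, 0 < h x) (hM : ∀ x, h x ≤ M)
    (hκ : 0 < κ) (hfar : ∀ x, 1 ≤ |x| → κ ≤ excess h 1 M x) (hκM : κ ≤ 2 / M ^ 2)
    {ε : ℝ} (hε : 0 < ε) : ((π ^ 2 / (ε * M) ^ 2 + κ / ε ^ 2 / 2 : ℝ) : EReal) ≤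
      essBottom (dirichletLaplacian (strip h ε)) :=
  le_essBottom (dirichletLaplacian_graph (isOpen_strip hc ε)) (Submodule.isClosed_topologicalClosure _)
    (formDefect_sobolevZero hc hpos hM hκ hfar hκM hε)

theorem exists_isMinMaxEigenvalue (hc : Continuous h) (hpos : ∀ x, 0 < h x) (hM : ∀ x, h x ≤ M)
    (hκ : 0 < κ) (hfar : ∀ x, 1 ≤ |x| → κ ≤ excess h 1 M x) (hκM : κ ≤ 2 / M ^ 2)
    {ε s : ℝ} (hε : 0 < ε) {j : ℕ} (hs : s < π ^ 2 / (ε * M) ^ 2 + κ / ε ^ 2 / 2)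
    (hneg : NegTriples (testTriples (strip h ε)) (j + 1) s) :
    ∃ t, IsMinMaxEigenvalue h ε j t := by
  obtain ⟨t, hts, h1, h2, h3⟩ := exists_isNthEigenvalue
    (dirichletLaplacian_graph (isOpen_strip hc ε)) (Submodule.isClosed_topologicalClosure _)
    (formDefect_sobolevZero hc hpos hM hκ hfar hκM hε) hs
    (hneg.of_le (Submodule.le_topologicalClosure _))
  refine ⟨t, h1, ?_, fun s hs => (h2 s hs).of_closure, fun s hs =>
    h3 s (hs.of_le (Submodule.le_topologicalClosure _))⟩
  refine lt_of_lt_of_le ?_ (le_essBottom_strip hc hpos hM hκ hfar hκM hε)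
  exact_mod_cast hts.trans_lt hs

theorem tendsto_div_sq_atTop {c : ℝ} (hc : 0 < c) :
    Tendsto (fun ε : ℝ => c / ε ^ 2) (𝓝[>] 0) atTop := by
  refine Tendsto.const_mul_atTop hc (tendsto_inv_nhdsGT_zero.comp ?_)
  refine tendsto_nhdsWithin_iff.2 ⟨?_, ?_⟩
  · have : ContinuousAt (fun ε : ℝ => ε ^ 2) 0 := by fun_prop
    have h0 := this.tendsto
    rw [zero_pow two_ne_zero] at h0
    exact h0.mono_left nhdsWithin_le_nhds
  · filter_upwards [self_mem_nhdsWithin] with ε hε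
    exact pow_pos (show 0 < ε from hε) 2

theorem tendsto_essBottom_strip (hc : Continuous h) (hpos : ∀ x, 0 < h x) (hM : ∀ x, h x ≤ M)
    (hκ : 0 < κ) (hfar : ∀ x, 1 ≤ |x| → κ ≤ excess h 1 M x) (hκM : κ ≤ 2 / M ^ 2) :
    Tendsto (fun ε : ℝ => essBottom (dirichletLaplacian (strip h ε))) (𝓝[>] 0) (𝓝 ⊤) := by
  rw [EReal.tendsto_nhds_top_iff_real]
  intro x
  filter_upwards [self_mem_nhdsWithin,
    (tendsto_div_sq_atTop (half_pos hκ)).eventually_gt_atTop x] with ε hε hx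
  refine lt_of_lt_of_le ?_ (le_essBottom_strip hc hpos hM hκ hfar hκM hε)
  have h1 : κ / ε ^ 2 / 2 = κ / 2 / ε ^ 2 := by ring
  have h2 : 0 ≤ π ^ 2 / (ε * M) ^ 2 := by positivity
  have : x < π ^ 2 / (ε * M) ^ 2 + κ / ε ^ 2 / 2 := by linarith
  exact_mod_cast this

theorem eventually_scale_lt {m : ℝ} (hm : 0 < m) (hκ : 0 < κ) (M s : ℝ) : ∀ᶠ ε : ℝ in 𝓝[>] 0,
    π ^ 2 / (ε * M) ^ 2 + s / (ε ^ (2 / (m + 2))) ^ 2 <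
      π ^ 2 / (ε * M) ^ 2 + κ / ε ^ 2 / 2 := by
  have ta := (tendsto_nhdsWithin_iff.1 (tendsto_scale hm)).1
  have tam : Tendsto (fun ε : ℝ => s * (ε ^ (2 / (m + 2))) ^ m) (𝓝[>] 0) (𝓝 0) := by
    have := (Real.continuousAt_rpow_const (0 : ℝ) m (Or.inr hm.le)).tendsto
    rw [zero_rpow hm.ne'] at this
    simpa using (this.comp ta).const_mul s
  filter_upwards [self_mem_nhdsWithin, tam.eventually_lt_const (half_pos hκ)] with ε hε h1
  have hε : 0 < ε := hε
  have hscale := scale_rpow_mul_sq hε hm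
  have ha : 0 < ε ^ (2 / (m + 2)) := rpow_pos_of_pos hε _
  have ham : 0 < (ε ^ (2 / (m + 2))) ^ m := rpow_pos_of_pos ha _
  have : s / (ε ^ (2 / (m + 2))) ^ 2 < κ / ε ^ 2 / 2 := by
    rw [← hscale, div_div, div_lt_div_iff₀ (by positivity) (by positivity)]
    have := mul_lt_mul_of_pos_right h1 (by positivity : 0 < (ε ^ (2 / (m + 2))) ^ 2)
    linarith
  linarith

end Strip

end NarrowStrip

end

theorem theorem1 (h : ℝ → ℝ) (M cp cm m : ℝ)
    (h_pos : ∀ x, 0 < h x) (h_cont : Continuous h)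
    (hM : 0 < M) (hcp : 0 < cp) (hcm : 0 < cm) (hm : 1 ≤ m)
    -- (i) `0` is the only point of global maximum
    (h_max : ∀ x, x ≠ 0 → h x < h 0)
    -- (ii) regularity off `0` and the one-sided expansions at `0`
    (h_C1 : ContDiffOn ℝ 1 h {0}ᶜ)
    (h_right : (fun x : ℝ => h x - (M - cp * x ^ m)) =O[𝓝[>] 0] (fun x : ℝ => x ^ (m + 1)))
    (h_left : (fun x : ℝ => h x - (M - cm * |x| ^ m)) =O[𝓝[<] 0] (fun x : ℝ => |x| ^ (m + 1)))
    -- (iii) `limsup_{|x| → ∞} h(x) < M`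
    (h_inf : limsup h (comap (fun x : ℝ => |x|) atTop) < M) :
    -- the bottom of the essential spectrum tends to infinity
    Tendsto (fun ε : ℝ => NarrowStrip.essBottom
      (NarrowStrip.dirichletLaplacian (NarrowStrip.strip h ε))) (𝓝[>] 0) (𝓝 ⊤) ∧
    -- for small `ε` there is spectrum below it
    (∀ᶠ ε : ℝ in 𝓝[>] 0, ∃ t ∈ NarrowStrip.spec
      (NarrowStrip.dirichletLaplacian (NarrowStrip.strip h ε)),
      (t : EReal) < NarrowStrip.essBottom
        (NarrowStrip.dirichletLaplacian (NarrowStrip.strip h ε))) ∧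
    -- the number of eigenvalues below it tends to infinity
    Tendsto (fun ε : ℝ => NarrowStrip.eigenvalueCount
        (NarrowStrip.dirichletLaplacian (NarrowStrip.strip h ε))
        {t : ℝ | (t : EReal) < NarrowStrip.essBottom
          (NarrowStrip.dirichletLaplacian (NarrowStrip.strip h ε))})
      (𝓝[>] 0) (𝓝 ⊤) ∧
    -- asymptotics of the eigenvalues `lam j ε` below it; `mu j` are the eigenvalues of `H`
    ∃ (mu : ℕ → ℝ) (lam : ℕ → ℝ → ℝ),
      (∀ j, NarrowStrip.IsNthEigenvalue
        (NarrowStrip.schrodinger (NarrowStrip.potential M cp cm m)) j (mu j)) ∧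
      ∀ j,
        (∀ᶠ ε : ℝ in 𝓝[>] 0,
          NarrowStrip.IsNthEigenvalue
            (NarrowStrip.dirichletLaplacian (NarrowStrip.strip h ε)) j (lam j ε) ∧
          (lam j ε : EReal) < NarrowStrip.essBottom
            (NarrowStrip.dirichletLaplacian (NarrowStrip.strip h ε))) ∧
        Tendsto (fun ε : ℝ => ε ^ (2 * (2 / (m + 2))) *
            (lam j ε - Real.pi ^ 2 / (M ^ 2 * ε ^ 2)))
          (𝓝[>] 0) (𝓝 (mu j)) := by
  open NarrowStrip in
  classical
  have hm0 : 0 < m := one_pos.trans_le hm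
  have h0 : M = h 0 := eq_apply_zero_of_expansion h_cont hm0 h_right
  have hle : ∀ x, h x ≤ M := fun x => by
    rcases eq_or_ne x 0 with rfl | hx
    · exact h0.ge
    · exact h0 ▸ (h_max x hx).le
  have hπ := Real.pi_pos
  have hqc := continuous_potential (M := M) (cp := cp) (cm := cm) hm0
  have hq0 := potential_nonneg (m := m) hM hcp hcm
  have hhom : ∀ a, 0 < a → ∀ x, potential M cp cm m (a * x) = a ^ m * potential M cp cm m x :=
    fun a ha x => potential_mul ha x
  set q := potential M cp cm m with hq
  have hexp := fun δ (hδ : 0 < δ) =>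
    exists_abs_sub_le_potential hM hcp hcm hm0 h0 h_right h_left hδ
  have hnear_le : ∀ δ > 0, ∃ ρ > 0, ∀ x, |x| ≤ ρ → (1 - δ) * q x ≤ excess h 1 M x := by
    intro δ hδ
    obtain ⟨ρ, hρ, hx⟩ := hexp δ hδ
    refine ⟨ρ, hρ, fun x hxρ => le_trans ?_ (mul_sub_le_excess h_pos hle x)⟩
    have h1 := (abs_le.1 (hx x hxρ)).2
    have h2 : (1 - δ) * q x =
        2 * Real.pi ^ 2 / M ^ 3 * ((1 - δ) * (M ^ 3 / (2 * Real.pi ^ 2) * q x)) := by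
      field_simp
    rw [h2]
    gcongr
    linarith
  have hnear_ge : ∀ δ > 0, ∃ ρ > 0, ∀ x, |x| ≤ ρ →
      M - (1 + δ) * (M ^ 3 / (2 * Real.pi ^ 2) * q x) ≤ h x := by
    intro δ hδ
    obtain ⟨ρ, hρ, hx⟩ := hexp δ hδ
    refine ⟨ρ, hρ, fun x hxρ => ?_⟩
    have h1 := (abs_le.1 (hx x hxρ)).1
    linarith
  have hfar : ∀ ρ > 0, ∃ κ > 0, ∀ x, ρ ≤ |x| → κ ≤ excess h 1 M x := fun ρ hρ =>
    exists_excess_ge h_pos h_cont h0 h_max h_inf hρ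
  have htop := fun B => exists_le_potential hM hcp hcm hm0 B
  -- The spectrum is discrete up to the level `κ / (2 ε²)` above the threshold.
  obtain ⟨κ, hκ, hκfar, hκM⟩ : ∃ κ > 0, (∀ x, 1 ≤ |x| → κ ≤ excess h 1 M x) ∧
      κ ≤ 2 / M ^ 2 := by
    obtain ⟨κ, hκ, hκfar⟩ := hfar 1 one_pos
    exact ⟨min κ (2 / M ^ 2), lt_min hκ (by positivity),
      fun x hx => (min_le_left _ _).trans (hκfar x hx), min_le_right _ _⟩
  have hmu : ∀ j, ∃ t, IsNthEigenvalue (schrodinger q) j t ∧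
      (∀ s, t < s → NegTriples (schrodingerForm q) (j + 1) s) ∧
      ∀ s, NegTriples (schrodingerForm q) (j + 1) s → t ≤ s := by
    intro j
    obtain ⟨s, hs⟩ := exists_negTriples_schrodingerForm hqc hq0 (j + 1)
    obtain ⟨R, hR, hRq⟩ := htop (s + 1)
    obtain ⟨t, -, ht⟩ := exists_isNthEigenvalue (schrodinger_graph hqc)
      (isClosed_schrodingerForm hqc) (formDefect_schrodingerForm hqc hq0 hR hRq)
      (lt_add_one s) hs
    exact ⟨t, ht⟩
  choose mu hmu1 hmu2 hmu3 using hmu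
  -- The value `0` is taken only for `ε` that are not small.
  let lam : ℕ → ℝ → ℝ := fun j ε =>
    if hex : ∃ t, IsMinMaxEigenvalue h ε j t then hex.choose else 0
  have hupper : ∀ j s, mu j < s → ∀ᶠ ε : ℝ in 𝓝[>] 0,
      NegTriples (testTriples (strip h ε)) (j + 1)
        (Real.pi ^ 2 / (ε * M) ^ 2 + s / (ε ^ (2 / (m + 2))) ^ 2) := by
    intro j s hs
    obtain ⟨s₁, h1, h2⟩ := exists_between hs
    exact eventually_negTriples_testTriples hM hqc hq0 hm0 hhom hnear_ge h2 (hmu2 j s₁ h1)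
  have hlam : ∀ j, ∀ᶠ ε : ℝ in 𝓝[>] 0, IsMinMaxEigenvalue h ε j (lam j ε) := by
    intro j
    filter_upwards [self_mem_nhdsWithin, hupper j (mu j + 1) (lt_add_one _),
      eventually_scale_lt hm0 hκ M (mu j + 1)] with ε hε h1 h2
    have hex := exists_isMinMaxEigenvalue h_cont h_pos hle hκ hκfar hκM hε h2 h1
    simp only [lam, dif_pos hex]
    exact hex.choose_spec
  have hess := tendsto_essBottom_strip h_cont h_pos hle hκ hκfar hκM
  refine ⟨hess, ?_, ?_, mu, lam, hmu1, fun j => ⟨?_, ?_⟩⟩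
  · filter_upwards [hlam 0] with ε hε
    exact ⟨lam 0 ε, mem_spec_of_eigenspace_ne_bot _ hε.1.eigenspace_ne_bot, hε.2.1⟩
  · rw [ENat.tendsto_nhds_top_iff_natCast_lt]
    intro j
    filter_upwards [hlam j] with ε hε
    refine hε.1.2.trans_le (eigenvalueCount_mono _ fun t ht => ?_)
    exact lt_of_le_of_lt (EReal.coe_le_coe_iff.2 ht) hε.2.1
  · filter_upwards [hlam j] with ε hε
    exact ⟨hε.1, hε.2.1⟩
  · -- In terms of the scale `a = ε ^ α`: the eigenvalue `π² / (ε M)² + s / a²` is rescaled to `s`.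
    have hrw : ∀ ε : ℝ, 0 < ε → ∀ s : ℝ,
        ε ^ (2 * (2 / (m + 2))) * (Real.pi ^ 2 / (ε * M) ^ 2 + s / (ε ^ (2 / (m + 2))) ^ 2 -
          Real.pi ^ 2 / (M ^ 2 * ε ^ 2)) = s := by
      intro ε hε s
      have ha : 0 < ε ^ (2 / (m + 2)) := Real.rpow_pos_of_pos hε _
      have e1 : ε ^ (2 * (2 / (m + 2))) = (ε ^ (2 / (m + 2))) ^ 2 := by
        rw [mul_comm, Real.rpow_mul hε.le, ← Real.rpow_natCast (ε ^ (2 / (m + 2))) 2]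
        norm_num
      rw [e1, mul_pow, mul_comm (ε ^ 2), add_sub_cancel_left, mul_div_cancel₀ _ (by positivity)]
    refine tendsto_order.2 ⟨fun s hs => ?_, fun s hs => ?_⟩
    · obtain ⟨s₁, h1, h2⟩ := exists_between hs
      obtain ⟨s₂, h3, h4⟩ := exists_between h2
      filter_upwards [self_mem_nhdsWithin, hlam j, eventually_negTriples_schrodingerForm h_cont
        h_pos hle hqc hq0 hm0 hhom (fun B => (htop B).imp fun R hR => hR.2) hnear_le hfar h3
        (j + 1)] with ε hε hl hcomp
      have hε : 0 < ε := hε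
      have hge : Real.pi ^ 2 / (ε * M) ^ 2 + s₁ / (ε ^ (2 / (m + 2))) ^ 2 ≤ lam j ε := by
        by_contra! hlt
        exact absurd (hmu3 j s₂ (hcomp (hl.2.2.1 _ hlt))) (not_le.2 h4)
      refine h1.trans_le ?_
      rw [← hrw ε hε s₁]
      gcongr
    · obtain ⟨s₁, h1, h2⟩ := exists_between hs
      filter_upwards [self_mem_nhdsWithin, hlam j, hupper j s₁ h1] with ε hε hl hneg
      have hε : 0 < ε := hε
      refine lt_of_le_of_lt ?_ h2
      rw [← hrw ε hε s₁]
      have := hl.2.2.2 _ hneg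
      gcongr
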